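/- Conventions. $I=[0,1]$. A subset $\widetilde Y$ of a space $Y$ is *exhaustive* if it meets every path component of $Y$. Let $f:X\to Y$ be a surjective continuous map and $F_y=f^{-1}(y)$. For $x\in F_y$, elements of $\pi_1(X,F_y,x)$ are represented by paths in $X$ that start in $F_y$ and end at $x$, and $\partial_*:\pi_{q+1}(X,F_y,x)\to\pi_q(F_y,x)$ denotes the boundary map of the pair. The map $f$ is a *$c$-quasifibration with respect to* an exhaustive subset $\widetilde Y\subset Y$ if for all $y\in\widetilde Y$ and $x\in F_y$ there are maps $\partial:\pi_{q+1}(Y,y)\to\pi_q(F_y,x)$ for all $q\ge 0$, group homomorphisms for $q\ge 1$, such that (a) the sequence $$\cdots\to\pi_{q+1}(Y,y)\xrightarrow{\partial}\pi_q(F_y,x)\xrightarrow{i_*}\pi_q(X,x)\xrightarrow{f_*}\pi_q(Y,y)\to\cdots\to\pi_1(Y,y)\xrightarrow{\partial}\pi_0(F_y,x)\xrightarrow{i_*}\pi_0(X,x)\xrightarrow{f_*}\pi_0(Y,y)\to 1$$ is exact, where exactness at $\pi_1(Y,y)$ includes that $\partial c=\partial c'$ in $\pi_0(F_y,x)$ if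 and only if $c'=c\cdot f_*(g)$ for some $g\in\pi_1(X,x)$ (in a product the left factor is traversed first); (b) $\partial\circ f_*=\partial_*$ on $\pi_{q+1}(X,F_y,x)$ for all $q\ge 0$, where $f_*:\pi_{q+1}(X,F_y,x)\to\pi_{q+1}(Y,y)$. A subset $A\subset Y$ is *$c$-distinguished with respect to* an exhaustive subset $\widetilde A$ of $A$ if $f|:f^{-1}(A)\to A$ is a $c$-quasifibration with respect to $\widetilde A$. For $A\subset U\subset Y$, a *deformation* of $f|:f^{-1}(U)\to U$ to $f|:f^{-1}(A)\to A$ is a pair of continuous maps $H:f^{-1}(U)\times I\to f^{-1}(U)$ and $h:U\times I\to U$ such that $H_0$ and $h_0$ are the identity maps, $H_t$ fixes $f^{-1}(A)$ pointwise and $h_t$ fixes $A$ pointwise for all $t\in I$, $H_1$ has image in $f^{-1}(A)$ and $h_1$ has image in $A$, and $f\circ H_1=h_1\circ f$. A *weak equivalence* is a continuous map that induces a bijection on path components and isomorphisms on all homotopy groups at all base points. **Theorem.** Let $f:X\to Y$ be a surjective continuous map, and let $Y_1\subset Y_2\subset\cdots$ be a filtration of $Y$ by closed $T_1$ subspaces,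 that is, $Y=\bigcup_{i\ge1}Y_i$ and $Y$ has the colimit topology. Let $\widetilde Y_i\subset Y_i$ $(i\ge 1)$ be subsets with $\widetilde Y_i\subset\widetilde Y_{i+1}$ such that, for every $i$ and every open subset $U$ of $Y_i$, the set $\widetilde Y_i\cap U$ is exhaustive in $U$; put $\widetilde Y=\bigcup_{i\ge 1}\widetilde Y_i$. Assume: 1. $Y_1$ is $c$-distinguished with respect to $\widetilde Y_1$; 2. for every $i\ge1$, every open subset $U$ of $Y_{i+1}-Y_i$ is $c$-distinguished with respect to $\widetilde Y_{i+1}\cap U$; 3. for every $i\ge 1$ there are a neighborhood $U_{i+1}$ of $Y_i$ in $Y_{i+1}$ and a deformation $(H,h)$ of $f|:f^{-1}(U_{i+1})\to U_{i+1}$ to $f|:f^{-1}(Y_i)\to Y_i$ such that $h_1(\widetilde Y_{i+1}\cap U_{i+1})\subset\widetilde Y_i$ and, for every $y\in\widetilde Y_{i+1}\cap U_{i+1}$, the map $H_1:f^{-1}(y)\to f^{-1}(h_1(y))$ is a weak equivalence. Then every $Y_i$ is $c$-distinguished with respect to $\widetilde Y_i$, and $f$ is a $c$-quasifibration with respect to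 $\widetilde Y$. -/

import Mathlib

open scoped unitInterval Topology Topology.Homotopy

universe u v

noncomputable section

/-! ### Exhaustive subsets -/

/-- A subset is exhaustive if it meets every path component of the space. -/
def IsExhaustive {Y : Type u} [TopologicalSpace Y] (S : Set Y) : Prop :=
  ∀ y : Y, ∃ z ∈ S, Joined y z

/-- `S` is an exhaustive subset of the subspace `A`. -/
def IsExhaustiveIn {Y : Type u} [TopologicalSpace Y] (A S : Set Y) : Prop :=
  S ⊆ A ∧ IsExhaustive (Subtype.val ⁻¹' S : Set A)

/-! ### Homotopy groups: base elements and induced maps -/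

section Homotopy

variable {X : Type u} {Y : Type v} [TopologicalSpace X] [TopologicalSpace Y]

/-- The class of the constant map in `π_ n X x` (the neutral element if `n ≥ 1`). -/
def piBase (n : ℕ) (x : X) : π_ n X x :=
  Quotient.mk (GenLoop.Homotopic.setoid (Fin n) x) GenLoop.const

/-- Composition of a generalized loop with a map of pointed spaces `(X, x) → (Y, y)`. -/
def genLoopMap (n : ℕ) (f : C(X, Y)) {x : X} {y : Y} (h : f x = y)
    (p : Ω^ (Fin n) X x) : Ω^ (Fin n) Y y :=
  ⟨f.comp p.1, fun t ht => by
    have : p.1 t = x := p.2 t ht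
    simp [this, h]⟩

/-- The map `π_ n X x → π_ n Y y` induced by a map of pointed spaces `(X, x) → (Y, y)`. -/
def piMap (n : ℕ) (f : C(X, Y)) {x : X} {y : Y} (h : f x = y) : π_ n X x → π_ n Y y :=
  Quotient.map (genLoopMap n f h) fun _ _ hpq => hpq.map fun H => H.compContinuousMap f

/-- A weak (homotopy) equivalence: a bijection on path components which induces bijections on all
homotopy groups at all base points. The case `n = 0` is the statement on path components; the first
clause covers the case where `X` has no base points. -/
def IsWeakEquivalence (f : C(X, Y)) : Prop :=
  (Nonempty Y → Nonempty X) ∧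
    ∀ (n : ℕ) (x : X), Function.Bijective (piMap n f (rfl : f x = f x))

/-! ### Relative homotopy groups -/

/-- Maps of the cube `I^(q+1)` to `X` which send the face `t 0 = 0` to `A` and the union of all
other faces to the point `x`. -/
def RelLoop (q : ℕ) (A : Set X) (x : X) : Set C(I^ (Fin (q + 1)), X) :=
  {p | (∀ t, t 0 = 0 → p t ∈ A) ∧
    ∀ t, (t 0 = 1 ∨ ∃ i : Fin q, t i.succ = 0 ∨ t i.succ = 1) → p t = x}

/-- Homotopy through maps of the same kind. -/
def RelLoop.setoid (q : ℕ) (A : Set X) (x : X) : Setoid (RelLoop q A x) where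
  r p p' := ContinuousMap.HomotopicWith p.1 p'.1 fun g => g ∈ RelLoop q A x
  iseqv := ⟨fun p => ContinuousMap.HomotopicWith.refl p.1 p.2, fun h => h.symm,
    fun h h' => h.trans h'⟩

/-- The set underlying the relative homotopy group `π_{q+1}(X, A, x)`. -/
def RelPi (q : ℕ) (A : Set X) (x : X) : Type u :=
  Quotient (RelLoop.setoid q A x)

/-- The restriction of a relative loop to the face `t 0 = 0`. -/
def RelLoop.face (q : ℕ) (A : Set X) (x : A) (p : RelLoop q A (x : X)) : Ω^ (Fin q) A x :=
  ⟨⟨fun t => ⟨p.1 (Fin.cons 0 t), p.2.1 _ rfl⟩, by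
      refine Continuous.subtype_mk (p.1.continuous.comp ?_) _
      exact Continuous.finCons continuous_const continuous_id⟩, by
    rintro t ⟨i, hi⟩
    exact Subtype.ext (p.2.2 _ (Or.inr ⟨i, by simpa using hi⟩))⟩

/-- The boundary map `π_{q+1}(X, A, x) → π_q(A, x)` of the pair `(X, A)`. -/
def relBoundary (q : ℕ) (A : Set X) (x : A) : RelPi q A (x : X) → π_ q A x :=
  Quotient.map (RelLoop.face q A x) (by
    rintro p p' ⟨H⟩
    refine ⟨⟨⟨⟨fun s => ⟨H (s.1, Fin.cons 0 s.2), ?_⟩, ?_⟩, ?_, ?_⟩, ?_⟩⟩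
    · exact (H.prop s.1).1 (Fin.cons 0 s.2) rfl
    · refine Continuous.subtype_mk (H.continuous.comp ?_) _
      exact continuous_fst.prodMk (Continuous.finCons continuous_const continuous_snd)
    · intro t
      exact Subtype.ext (H.apply_zero _)
    · intro t
      exact Subtype.ext (H.apply_one _)
    · rintro s t ⟨i, hi⟩
      refine Subtype.ext ?_
      have h1 : H (s, Fin.cons 0 t) = (x : X) :=
        (H.prop s).2 (Fin.cons 0 t) (Or.inr ⟨i, by simpa using hi⟩)
      have h2 : p.1 (Fin.cons 0 t) = (x : X) := p.2.2 _ (Or.inr ⟨i, by simpa using hi⟩)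
      exact h1.trans h2.symm)

/-- If `f` sends `A` to the point `y`, it sends the boundary of every relative loop to `y`. -/
theorem RelLoop.map_boundary {q : ℕ} {A : Set X} {x : X} (f : C(X, Y)) {y : Y}
    (hA : ∀ a ∈ A, f a = y) (hx : x ∈ A) {p : C(I^ (Fin (q + 1)), X)} (hp : p ∈ RelLoop q A x)
    {t : I^ (Fin (q + 1))} (ht : t ∈ Cube.boundary (Fin (q + 1))) : f (p t) = y := by
  obtain ⟨i, hi⟩ := ht
  induction i using Fin.cases with
  | zero =>
    rcases hi with h | h
    · exact hA _ (hp.1 t h)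
    · rw [hp.2 t (Or.inl h)]
      exact hA _ hx
  | succ i =>
    rw [hp.2 t (Or.inr ⟨i, hi⟩)]
    exact hA _ hx

/-- The map `π_{q+1}(X, A, x) → π_{q+1}(Y, y)` induced by a map `f` with `f(A) ⊆ {y}`. -/
def relPiMap (q : ℕ) (f : C(X, Y)) (A : Set X) (x : A) {y : Y} (hA : ∀ a ∈ A, f a = y) :
    RelPi q A (x : X) → π_ (q + 1) Y y :=
  Quotient.map
    (fun p => (⟨f.comp p.1, fun _ ht => RelLoop.map_boundary f hA x.2 p.2 ht⟩ :
      Ω^ (Fin (q + 1)) Y y))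
    (by
      rintro p p' ⟨H⟩
      refine ⟨⟨(ContinuousMap.Homotopy.refl f).comp H.toHomotopy, ?_⟩⟩
      intro s t ht
      have h1 := RelLoop.map_boundary f hA x.2 (H.prop s) ht
      have h2 := RelLoop.map_boundary f hA x.2 p.2 ht
      exact h1.trans h2.symm)

/-! ### c-quasifibrations -/

/-- The inclusion of the fibre `F_y` into the total space. -/
def fiberIncl (f : C(X, Y)) (y : Y) : C(f ⁻¹' {y}, X) :=
  ⟨Subtype.val, continuous_subtype_val⟩

/-- The maps `conn q : π_{q+1}(Y, y) → π_q(F_y, x)` are homomorphisms for `q ≥ 1` and make the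
infinite sequence
`⋯ → π_{q+1}(Y, y) → π_q(F_y, x) → π_q(X, x) → π_q(Y, y) → ⋯ → π_0(X, x) → π_0(Y, y) → 1`
exact. Since `π_0(F_y, x)` is only a pointed set, exactness at `π_1(Y, y)` contains, as for the
sequence of a fibration, that two elements have the same image in `π_0(F_y, x)` exactly when they
lie in the same coset of the image of `π_1(X, x)`. (In Mathlib's group `π_ 1`, the product `a * b`
is the class of the concatenation in which `b` is traversed first.) -/
structure IsLongExact (f : C(X, Y)) (y : Y) (x : f ⁻¹' {y})
    (conn : ∀ q : ℕ, π_ (q + 1) Y y → π_ q (f ⁻¹' {y}) x) : Prop where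
  map_mul : ∀ (q : ℕ) (a b : π_ (q + 2) Y y), conn (q + 1) (a * b) = conn (q + 1) a * conn (q + 1) b
  exact_fiber : ∀ (q : ℕ) (a : π_ q (f ⁻¹' {y}) x),
    piMap q (fiberIncl f y) (rfl : fiberIncl f y x = (x : X)) a = piBase q (x : X) ↔
      ∃ c, conn q c = a
  exact_total : ∀ (q : ℕ) (b : π_ q X (x : X)),
    piMap q f x.2 b = piBase q y ↔
      ∃ a, piMap q (fiberIncl f y) (rfl : fiberIncl f y x = (x : X)) a = b
  exact_base : ∀ (q : ℕ) (c : π_ (q + 1) Y y),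
    conn q c = piBase q x ↔ ∃ b, piMap (q + 1) f (x := (x : X)) x.2 b = c
  exact_base_coset : ∀ c c' : π_ 1 Y y,
    conn 0 c = conn 0 c' ↔ ∃ b, c' = piMap 1 f (x := (x : X)) x.2 b * c
  surjective_zero : Function.Surjective (piMap 0 f (x := (x : X)) (y := y) x.2)

/-- `f` is a c-quasifibration with respect to `S`: it is surjective, `S` is exhaustive, and for all
`y ∈ S` and `x ∈ F_y` there are connecting maps which give a long exact sequence and which are
compatible with the boundary maps of the pair `(X, F_y)`. -/
structure IsCQuasifibration (f : C(X, Y)) (S : Set Y) : Prop where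
  surjective : Function.Surjective f
  exhaustive : IsExhaustive S
  exists_conn : ∀ y ∈ S, ∀ x : f ⁻¹' {y},
    ∃ conn : ∀ q : ℕ, π_ (q + 1) Y y → π_ q (f ⁻¹' {y}) x,
      IsLongExact f y x conn ∧
        ∀ (q : ℕ) (r : RelPi q (f ⁻¹' {y}) (x : X)),
          conn q (relPiMap q f (f ⁻¹' {y}) x (fun _ ha => ha) r) = relBoundary q (f ⁻¹' {y}) x r

/-- The subset `A` of `Y` is c-distinguished (for `f`) with respect to the subset `S` of `A`. -/
def IsCDistinguished (f : C(X, Y)) (A S : Set Y) : Prop :=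
  S ⊆ A ∧ IsCQuasifibration (f.restrictPreimage A) (Subtype.val ⁻¹' S : Set A)

/-! ### Deformations -/

/-- A deformation `(H, h)` of `f : X → Y` to its restriction `f ⁻¹' A → A`. -/
structure Deformation (f : C(X, Y)) (A : Set Y) where
  /-- the homotopy on the total space -/
  H : C(X × I, X)
  /-- the homotopy on the base -/
  h : C(Y × I, Y)
  h_zero : ∀ y, h (y, 0) = y
  h_fix : ∀ y ∈ A, ∀ t, h (y, t) = y
  h_one_mem : ∀ y, h (y, 1) ∈ A
  H_zero : ∀ x, H (x, 0) = x
  H_fix : ∀ x ∈ f ⁻¹' A, ∀ t, H (x, t) = x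
  H_one_mem : ∀ x, H (x, 1) ∈ f ⁻¹' A
  comm : ∀ x, f (H (x, 1)) = h (f x, 1)

/-- The map `H_1 : f⁻¹(y) → f⁻¹(h_1(y))`. -/
def Deformation.fiberMap {f : C(X, Y)} {A : Set Y} (D : Deformation f A) (y : Y) :
    C(f ⁻¹' {y}, f ⁻¹' {D.h (y, 1)}) where
  toFun x := ⟨D.H (x, 1), by
    have hx : f x = y := x.2
    simp [D.comm, hx]⟩
  continuous_toFun := by fun_prop

end Homotopy

/-- A filtration `Y_1 ⊆ Y_2 ⊆ ⋯` of `Y` by subspaces: the union is `Y` and `Y` has the colimit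
topology. -/
structure IsSpaceFiltration {Y : Type u} [TopologicalSpace Y] (F : ℕ+ → Set Y) : Prop where
  mono : Monotone F
  iUnion_eq : ⋃ i, F i = Set.univ
  coherent : Topology.IsCoherentWith (Set.range F)

end

/-! Compare each fibre with a homotopy fibre. `hoFiber f A b` consists of the pairs (x, γ) with γ a
path in A from f(x) to b, and F_b embeds in it by constant paths; `FiberEquiv f A b` says that this
embedding is a weak equivalence. For surjective f, connecting maps as in (a), (b) exist at all
points of F_b exactly when F_b is weakly equivalent to the homotopy fibre over all of Y. One
direction is `IsCQuasifibration.fiberEquiv`: the exact sequences, together with ∂∘f_* = ∂_*,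
compress cubes of the homotopy fibre into F_b. The other is `FiberEquiv.exists_conn`: the
equivalence lifts loops of Y to relative loops of (X, F_b), and ∂ restricts such a lift to its free
face. Hence A is c-distinguished with respect to S if and only if S is an exhaustive subset of A and
`FiberEquiv f A b` holds for b in S (`isCDistinguished_iff_isGood`).

For `IsGood` three facts suffice. Deformation (`Deformation.fiberEquiv`): the pair (H_1, h_1) maps
homotopy fibres over U to homotopy fibres over Y_i, and cubes can be pulled back along it, so the
equivalence over h_1(b) together with F_b ≃ F_{h_1(b)} gives the one over b. Gluing
(`FiberEquiv.of_cover`): Y_{i+1} is covered by an open part of U_{i+1} and by Y_{i+1} - Y_i; these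
pieces and their overlap sit in good sets, and a cube in Y_{i+1}, cut into cells each inside one
piece, is lifted cell by cell. Colimit (`FiberEquiv.of_filtration`): a compact family of paths in Y
lies in some Y_i.

Weak equivalences are used in the form `WE`: a map of (I^n, ∂I^n) into the target, with its boundary
lifted, lifts up to homotopy relative to the boundary. In this form the constructions reduce to one
fact, that a cube retracts onto an open box. -/

noncomputable section

/-! ### Cubes and box filling -/

/-- A space with a distinguished closed subset `bd` which is homeomorphic to a cube and its
boundary. -/
class CubeSpace (K : Type) [TopologicalSpace K] where
  /-- the boundary of the cube -/
  boundary : Set K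
  exists_homeo : ∃ n, ∃ e : K ≃ₜ (Fin n → I), ∀ k, k ∈ boundary ↔ e k ∈ Cube.boundary (Fin n)

/-- The boundary of a cube. -/
abbrev bd (K : Type) [TopologicalSpace K] [CubeSpace K] : Set K := CubeSpace.boundary

theorem Cube.isClosed_boundary (n : ℕ) : IsClosed (Cube.boundary (Fin n)) := by
  have : Cube.boundary (Fin n) = ⋃ i, ({y | y i = 0} ∪ {y | y i = 1}) := by
    ext y; simp [Cube.boundary]
  rw [this]
  refine isClosed_iUnion_of_finite fun i => ?_
  exact (isClosed_eq (continuous_apply i) continuous_const).union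
    (isClosed_eq (continuous_apply i) continuous_const)

/-- Radial projection from the point at height 2 above the centre of the cube, with the cube
coordinates rescaled to [-1, 1] and the sup norm. -/
theorem Cube.exists_box_retraction (n : ℕ) :
    ∃ r : C(I × (Fin n → I), I × (Fin n → I)),
      (∀ p, (r p).1 = 0 ∨ (r p).2 ∈ Cube.boundary (Fin n)) ∧
      ∀ p, p.1 = 0 ∨ p.2 ∈ Cube.boundary (Fin n) → r p = p := by
  let y : I × (Fin n → I) → Fin n → ℝ := fun p i => 2 * (p.2 i : ℝ) - 1
  have hy : Continuous y := by fun_prop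
  -- Along the ray scaled by λ, a wall is met at λ = 1/‖y‖ and the floor at λ = 2/(2 - t); the first
  -- hit is at λ = 1/d.
  let d : I × (Fin n → I) → ℝ := fun p => max ‖y p‖ ((2 - (p.1 : ℝ)) / 2)
  have hd : Continuous d := by fun_prop
  have hd0 : ∀ p, 0 < d p := fun p => by
    refine lt_of_lt_of_le ?_ (le_max_right _ _)
    have := p.1.2.2
    linarith
  have hyle : ∀ p, ‖y p‖ ≤ 1 := fun p => by
    refine (pi_norm_le_iff_of_nonneg zero_le_one).2 fun i => ?_
    rw [Real.norm_eq_abs, abs_le]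
    have h1 := (p.2 i).2.1
    have h2 := (p.2 i).2.2
    constructor <;> simp only [y] <;> linarith
  have hdn : ∀ p, d p ≠ 0 := fun p => (hd0 p).ne'
  -- The projections to [0, 1] never truncate; they only save the proof of the bounds.
  refine ⟨⟨fun p => (Set.projIcc 0 1 zero_le_one (2 - (2 - (p.1 : ℝ)) / d p),
    fun i => Set.projIcc 0 1 zero_le_one ((y p i / d p + 1) / 2)), ?_⟩, fun p => ?_, fun p hp => ?_⟩
  · refine Continuous.prodMk (continuous_projIcc.comp ?_)
      (continuous_pi fun i => continuous_projIcc.comp ?_)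
    · exact continuous_const.sub ((continuous_const.sub (by fun_prop)).div hd hdn)
    · exact ((((continuous_apply i).comp hy).div hd hdn).add continuous_const).div_const _
  · simp only [ContinuousMap.coe_mk]
    rcases le_total ‖y p‖ ((2 - (p.1 : ℝ)) / 2) with h | h
    · left
      have : d p = (2 - (p.1 : ℝ)) / 2 := max_eq_right h
      rw [projIcc_eq_zero, sub_nonpos, le_div_iff₀ (hd0 p), this]
      linarith
    · right
      have hdp : d p = ‖y p‖ := max_eq_left h
      obtain ⟨i, hi⟩ : ∃ i, ‖y p‖ ≤ ‖y p i‖ := by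
        by_contra! hcon
        exact lt_irrefl _ ((pi_norm_lt_iff (hdp ▸ hd0 p)).2 hcon)
      refine ⟨i, ?_⟩
      rw [Real.norm_eq_abs (y p i), ← hdp] at hi
      rw [projIcc_eq_zero, projIcc_eq_one]
      rcases le_abs'.1 hi with h' | h'
      · left
        have : y p i / d p ≤ -1 := by rw [div_le_iff₀ (hd0 p)]; linarith
        linarith
      · right
        have : 1 ≤ y p i / d p := by rw [le_div_iff₀ (hd0 p)]; linarith
        linarith
  · have hd1 : d p = 1 := by
      rcases hp with hp | ⟨i, hi⟩
      · simp only [d, hp]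
        rw [max_eq_right] <;> simp [hyle]
      · have : ‖y p‖ = 1 := by
          refine le_antisymm (hyle p) (le_trans ?_ (norm_le_pi_norm _ i))
          rcases hi with hi | hi <;> simp only [y, hi] <;> norm_num
        simp only [d, this]
        refine max_eq_left ?_
        have := p.1.2.1
        linarith
    refine Prod.ext ?_ (funext fun i => ?_)
    · simp only [ContinuousMap.coe_mk, hd1]
      rw [show (2 - (2 - (p.1 : ℝ)) / 1) = p.1 by ring]
      exact Set.projIcc_val _ _
    · simp only [ContinuousMap.coe_mk, hd1, y]
      rw [show ((2 * (p.2 i : ℝ) - 1) / 1 + 1) / 2 = p.2 i by ring]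
      exact Set.projIcc_val _ _

instance CubeSpace.pi (n : ℕ) : CubeSpace (Fin n → I) where
  boundary := Cube.boundary (Fin n)
  exists_homeo := ⟨n, Homeomorph.refl _, fun _ => Iff.rfl⟩

/-- `Fin.cons` as a homeomorphism of cubes. -/
def cubeCons (n : ℕ) : I × (Fin n → I) ≃ₜ (Fin (n + 1) → I) where
  toFun p := Fin.cons p.1 p.2
  invFun t := (t 0, Fin.tail t)
  left_inv p := by simp
  right_inv t := by simp
  continuous_toFun := Continuous.finCons continuous_fst continuous_snd
  continuous_invFun := by unfold Fin.tail; fun_prop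

theorem cubeCons_apply (n : ℕ) (p : I × (Fin n → I)) : cubeCons n p = Fin.cons p.1 p.2 := rfl

theorem cubeCons_symm_apply (n : ℕ) (t : Fin (n + 1) → I) :
    (cubeCons n).symm t = (t 0, Fin.tail t) := rfl

theorem cubeCons_mem_boundary (n : ℕ) (p : I × (Fin n → I)) :
    cubeCons n p ∈ Cube.boundary (Fin (n + 1)) ↔
      p.1 = 0 ∨ p.1 = 1 ∨ p.2 ∈ Cube.boundary (Fin n) := by
  simp only [Cube.boundary, Set.mem_ofPred_eq, Fin.exists_fin_succ, cubeCons_apply, Fin.cons_zero,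
    Fin.cons_succ, or_assoc]

instance CubeSpace.prod (K : Type) [TopologicalSpace K] [CubeSpace K] : CubeSpace (I × K) where
  boundary := {p | p.1 = 0 ∨ p.1 = 1 ∨ p.2 ∈ bd K}
  exists_homeo := by
    obtain ⟨n, e, he⟩ := CubeSpace.exists_homeo (K := K)
    refine ⟨n + 1, ((Homeomorph.refl I).prodCongr e).trans (cubeCons n), fun k => ?_⟩
    rw [Homeomorph.trans_apply, cubeCons_mem_boundary]
    simp [he]

instance CubeSpace.unit : CubeSpace Unit where
  boundary := ∅
  exists_homeo := ⟨0, Homeomorph.homeomorphOfUnique _ _, fun k => by simp [Cube.boundary]⟩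

section
variable {K : Type} [TopologicalSpace K] [CubeSpace K]

theorem mem_bd_prod {p : I × K} : p ∈ bd (I × K) ↔ p.1 = 0 ∨ p.1 = 1 ∨ p.2 ∈ bd K := Iff.rfl

@[simp] theorem mk_mem_bd_prod {t : I} {k : K} :
    (t, k) ∈ bd (I × K) ↔ t = 0 ∨ t = 1 ∨ k ∈ bd K := Iff.rfl

theorem isClosed_bd : IsClosed (bd K) := by
  obtain ⟨n, e, he⟩ := CubeSpace.exists_homeo (K := K)
  have : bd K = e ⁻¹' Cube.boundary (Fin n) := Set.ext he
  rw [this]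
  exact (Cube.isClosed_boundary n).preimage e.continuous

theorem CubeSpace.id_homotopic_const (k₀ : K) :
    ∃ c : C(I × K, K), (∀ k, c (0, k) = k) ∧ ∀ k, c (1, k) = k₀ := by
  obtain ⟨n, e, he⟩ := CubeSpace.exists_homeo (K := K)
  have hc : Continuous fun p : I × (Fin n → I) => (fun i => Set.projIcc (0 : ℝ) 1 zero_le_one
      ((1 - (p.1 : ℝ)) * (p.2 i : ℝ) + p.1 * (e k₀ i : ℝ)) : Fin n → I) :=
    continuous_pi fun i => continuous_projIcc.comp (by fun_prop)
  refine ⟨⟨fun p => e.symm fun i => Set.projIcc (0 : ℝ) 1 zero_le_one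
      ((1 - (p.1 : ℝ)) * (e p.2 i : ℝ) + p.1 * (e k₀ i : ℝ)), e.symm.continuous.comp (hc.comp
      (continuous_fst.prodMk (e.continuous.comp continuous_snd)))⟩, fun k => ?_, fun k => ?_⟩
  · simp
  · simp

theorem exists_box_retraction (K : Type) [TopologicalSpace K] [CubeSpace K] :
    ∃ r : C(I × K, I × K), (∀ p, (r p).1 = 0 ∨ (r p).2 ∈ bd K) ∧
      ∀ p, p.1 = 0 ∨ p.2 ∈ bd K → r p = p := by
  obtain ⟨n, e, he⟩ := CubeSpace.exists_homeo (K := K)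
  obtain ⟨r, h1, h2⟩ := Cube.exists_box_retraction n
  have hE : ∀ q : I × (Fin n → I), (q.1 = 0 ∨ q.2 ∈ Cube.boundary (Fin n)) ↔
      (q.1 = 0 ∨ e.symm q.2 ∈ bd K) := fun q => by rw [he, e.apply_symm_apply]
  have hc : Continuous fun p : I × K => r (p.1, e p.2) :=
    r.continuous.comp (continuous_fst.prodMk (e.continuous.comp continuous_snd))
  refine ⟨⟨fun p => ((r (p.1, e p.2)).1, e.symm (r (p.1, e p.2)).2),
    (continuous_fst.comp hc).prodMk (e.symm.continuous.comp (continuous_snd.comp hc))⟩,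
    fun p => (hE _).1 (h1 _), fun p hp => ?_⟩
  have : r (p.1, e p.2) = (p.1, e p.2) := h2 _ (by rwa [he] at hp)
  simp [this]

/-- Gluing of functions given on the faces `τ = 0`, `τ = 1` and on a further closed set. -/
def glue {α Z : Type*} (τ : α → I) (f₀ f₁ c : α → Z) : α → Z :=
  open Classical in fun p => if τ p = 0 then f₀ p else if τ p = 1 then f₁ p else c p

section glue
variable {α Z : Type*} {τ : α → I} {f₀ f₁ c : α → Z} {p : α}

theorem glue_of_zero (h : τ p = 0) : glue τ f₀ f₁ c p = f₀ p := if_pos h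

theorem glue_of_one (h : τ p = 1) : glue τ f₀ f₁ c p = f₁ p := by
  simp [glue, h]

theorem glue_of_agree (h0 : τ p = 0 → c p = f₀ p) (h1 : τ p = 1 → c p = f₁ p) :
    glue τ f₀ f₁ c p = c p := by
  unfold glue
  split_ifs with h h'
  exacts [(h0 h).symm, (h1 h').symm, rfl]

/-- Pasting over three closed sets. The faces τ = 0 and τ = 1 are disjoint, so only their overlaps
with C need agreement. -/
theorem continuousOn_glue [TopologicalSpace α] [TopologicalSpace Z] {C : Set α} (hτ : Continuous τ) (hC : IsClosed C)
    (h0 : ContinuousOn f₀ {p | τ p = 0}) (h1 : ContinuousOn f₁ {p | τ p = 1})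
    (hc : ContinuousOn c C) (e0 : ∀ p ∈ C, τ p = 0 → c p = f₀ p)
    (e1 : ∀ p ∈ C, τ p = 1 → c p = f₁ p) :
    ContinuousOn (glue τ f₀ f₁ c) {p | τ p = 0 ∨ τ p = 1 ∨ p ∈ C} := by
  have k0 : IsClosed {p | τ p = 0} := isClosed_eq hτ continuous_const
  have k1 : IsClosed {p | τ p = 1} := isClosed_eq hτ continuous_const
  refine (h0.congr fun p hp => glue_of_zero hp).union_of_isClosed
    ((h1.congr fun p hp => glue_of_one hp).union_of_isClosed
      (hc.congr fun p hp => glue_of_agree (e0 p hp) (e1 p hp)) k1 hC) k0 (k1.union hC)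

end glue

/-! ### Extension of maps from an open box to the cube. -/

variable {Z : Type*} [TopologicalSpace Z]

/-- Maps on the open box (a face and the sides of the cube `I × K`) with values in the given
subsets extend to the cube. -/
def BoxExt (K : Type) [TopologicalSpace K] [CubeSpace K] (S : I × K → Set Z) : Prop :=
  ∀ g : I × K → Z, ContinuousOn g {p | p.1 = 0 ∨ p.2 ∈ bd K} →
    (∀ p, p.1 = 0 ∨ p.2 ∈ bd K → g p ∈ S p) →
      ∃ G : C(I × K, Z), (∀ p, p.1 = 0 ∨ p.2 ∈ bd K → G p = g p) ∧ ∀ p, G p ∈ S p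

theorem BoxExt.const (P : Set Z) : BoxExt K fun _ => P := by
  intro g hg hP
  obtain ⟨r, h1, h2⟩ := exists_box_retraction K
  refine ⟨⟨g ∘ r, ?_⟩, fun p hp => ?_, fun p => hP _ (h1 p)⟩
  · rw [← continuousOn_univ]
    exact hg.comp r.continuous.continuousOn fun p _ => h1 p
  · simp [h2 p hp]

theorem continuousOn_box {a : K → Z} {b : I × K → Z} (ha : Continuous a)
    (hb : ContinuousOn b {p | p.2 ∈ bd K}) (hab : ∀ k ∈ bd K, b (0, k) = a k) :
    ContinuousOn (glue Prod.fst (fun p => a p.2) b b) {p : I × K | p.1 = 0 ∨ p.2 ∈ bd K} := by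
  have k0 : IsClosed {p : I × K | p.1 = 0} := isClosed_eq continuous_fst continuous_const
  have k1 : IsClosed {p : I × K | p.2 ∈ bd K} := isClosed_bd.preimage continuous_snd
  refine ((ha.comp continuous_snd).continuousOn.congr fun p hp => glue_of_zero hp).union_of_isClosed
    (hb.congr ?_) k0 k1
  rintro ⟨t, k⟩ hp
  refine glue_of_agree ?_ fun _ => rfl
  rintro rfl
  exact hab k hp

/-- Floor and walls are prescribed separately; the values of `b` away from the walls are irrelevant.
In the uses below the new information is the face at 1. -/
theorem BoxExt.fill {S : I × K → Set Z} (hS : BoxExt K S) (a : C(K, Z)) (b : I × K → Z)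
    (hb : ContinuousOn b {p | p.2 ∈ bd K}) (hab : ∀ k ∈ bd K, b (0, k) = a k)
    (haP : ∀ k, a k ∈ S (0, k)) (hbP : ∀ s, ∀ k ∈ bd K, b (s, k) ∈ S (s, k)) :
    ∃ G : C(I × K, Z), (∀ k, G (0, k) = a k) ∧ (∀ s, ∀ k ∈ bd K, G (s, k) = b (s, k)) ∧
      ∀ p, G p ∈ S p := by
  have e0 : ∀ k, glue Prod.fst (fun p : I × K => a p.2) b b (0, k) = a k := fun k =>
    glue_of_zero (p := ((0 : I), k)) rfl
  have e1 : ∀ s, ∀ k ∈ bd K, glue Prod.fst (fun p : I × K => a p.2) b b (s, k) = b (s, k) := by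
    intro s k hk
    refine glue_of_agree ?_ fun _ => rfl
    rintro rfl
    exact hab k hk
  obtain ⟨G, h1, h2⟩ := hS _ (continuousOn_box a.continuous hb hab) (by
    rintro ⟨s, k⟩ (rfl | hk)
    · rw [e0]; exact haP k
    · rw [e1 s k hk]; exact hbP s k hk)
  exact ⟨G, fun k => (h1 _ (Or.inl rfl)).trans (e0 k),
    fun s k hk => (h1 _ (Or.inr hk)).trans (e1 s k hk), h2⟩

theorem exists_fill (a : C(K, Z)) (b : I × K → Z) (hb : ContinuousOn b {p | p.2 ∈ bd K})
    (hab : ∀ k ∈ bd K, b (0, k) = a k) (P : Set Z) (haP : ∀ k, a k ∈ P)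
    (hbP : ∀ s, ∀ k ∈ bd K, b (s, k) ∈ P) :
    ∃ G : C(I × K, Z), (∀ k, G (0, k) = a k) ∧ (∀ s, ∀ k ∈ bd K, G (s, k) = b (s, k)) ∧
      ∀ p, G p ∈ P :=
  (BoxExt.const P).fill a b hb hab haP hbP

theorem continuousOn_glue_snd {b₀ b₁ : I × K → Z} {c : I × (I × K) → Z}
    (h0 : Continuous b₀) (h1 : Continuous b₁)
    (hc : ContinuousOn c {p | p.2.2 ∈ bd K})
    (hc0 : ∀ s, ∀ k ∈ bd K, c (s, (0, k)) = b₀ (s, k))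
    (hc1 : ∀ s, ∀ k ∈ bd K, c (s, (1, k)) = b₁ (s, k)) :
    ContinuousOn (glue (fun p : I × (I × K) => p.2.1) (fun p => b₀ (p.1, p.2.2))
      (fun p => b₁ (p.1, p.2.2)) c) {p | p.2 ∈ bd (I × K)} := by
  refine continuousOn_glue (C := {p : I × (I × K) | p.2.2 ∈ bd K}) (by fun_prop)
    (isClosed_bd.preimage (by fun_prop)) (by fun_prop) (by fun_prop) hc ?_ ?_
  · rintro ⟨s, t, k⟩ hk rfl
    exact hc0 s k hk
  · rintro ⟨s, t, k⟩ hk rfl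
    exact hc1 s k hk

/-- Box filling with the faces of the sides given separately. -/
theorem BoxExt.fill₂ {S : I × (I × K) → Set Z} (hS : BoxExt (I × K) S) (a b₀ b₁ : C(I × K, Z))
    (c : I × (I × K) → Z) (hc : ContinuousOn c {p | p.2.2 ∈ bd K})
    (hb0 : ∀ k, b₀ (0, k) = a (0, k)) (hb1 : ∀ k, b₁ (0, k) = a (1, k))
    (hca : ∀ t, ∀ k ∈ bd K, c (0, (t, k)) = a (t, k))
    (hc0 : ∀ s, ∀ k ∈ bd K, c (s, (0, k)) = b₀ (s, k))
    (hc1 : ∀ s, ∀ k ∈ bd K, c (s, (1, k)) = b₁ (s, k))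
    (haP : ∀ p, a p ∈ S (0, p)) (hb0P : ∀ s k, b₀ (s, k) ∈ S (s, (0, k)))
    (hb1P : ∀ s k, b₁ (s, k) ∈ S (s, (1, k)))
    (hcP : ∀ s t, ∀ k ∈ bd K, c (s, (t, k)) ∈ S (s, (t, k))) :
    ∃ G : C(I × (I × K), Z), (∀ p, G (0, p) = a p) ∧ (∀ s k, G (s, (0, k)) = b₀ (s, k)) ∧
      (∀ s k, G (s, (1, k)) = b₁ (s, k)) ∧
      (∀ s t, ∀ k ∈ bd K, G (s, (t, k)) = c (s, (t, k))) ∧ ∀ p, G p ∈ S p := by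
  set b := glue (fun p : I × (I × K) => p.2.1) (fun p => b₀ (p.1, p.2.2))
      (fun p => b₁ (p.1, p.2.2)) c with hb
  have e0 : ∀ s k, b (s, (0, k)) = b₀ (s, k) := fun s k => glue_of_zero (p := (s, ((0 : I), k))) rfl
  have e1 : ∀ s k, b (s, (1, k)) = b₁ (s, k) := fun s k => glue_of_one (p := (s, ((1 : I), k))) rfl
  have e2 : ∀ s t, ∀ k ∈ bd K, b (s, (t, k)) = c (s, (t, k)) := by
    intro s t k hk
    refine glue_of_agree ?_ ?_
    · rintro rfl; exact hc0 s k hk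
    · rintro rfl; exact hc1 s k hk
  obtain ⟨G, h1, h2, h3⟩ := hS.fill a b (continuousOn_glue_snd b₀.continuous b₁.continuous hc
    hc0 hc1) (by
      rintro ⟨t, k⟩ (rfl | rfl | hk)
      · rw [e0, hb0]
      · rw [e1, hb1]
      · exact (e2 _ _ _ hk).trans (hca t k hk)) haP (by
      rintro s ⟨t, k⟩ (rfl | rfl | hk)
      · rw [e0]; exact hb0P _ _
      · rw [e1]; exact hb1P _ _
      · rw [show b (s, (t, k)) = _ from e2 _ _ _ hk]; exact hcP _ _ _ hk)
  exact ⟨G, h1, fun s k => (h2 s _ (Or.inl rfl)).trans (e0 s k),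
    fun s k => (h2 s _ (Or.inr (Or.inl rfl))).trans (e1 s k),
    fun s t k hk => (h2 s _ (Or.inr (Or.inr hk))).trans (e2 s t k hk), h3⟩

/-- Box filling with the faces of the sides given separately. -/
theorem exists_fill₂ (a b₀ b₁ : C(I × K, Z)) (c : I × (I × K) → Z)
    (hc : ContinuousOn c {p | p.2.2 ∈ bd K}) (P : Set Z)
    (hb0 : ∀ k, b₀ (0, k) = a (0, k)) (hb1 : ∀ k, b₁ (0, k) = a (1, k))
    (hca : ∀ t, ∀ k ∈ bd K, c (0, (t, k)) = a (t, k))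
    (hc0 : ∀ s, ∀ k ∈ bd K, c (s, (0, k)) = b₀ (s, k))
    (hc1 : ∀ s, ∀ k ∈ bd K, c (s, (1, k)) = b₁ (s, k))
    (haP : ∀ p, a p ∈ P) (hb0P : ∀ p, b₀ p ∈ P) (hb1P : ∀ p, b₁ p ∈ P)
    (hcP : ∀ s t, ∀ k ∈ bd K, c (s, (t, k)) ∈ P) :
    ∃ G : C(I × (I × K), Z), (∀ p, G (0, p) = a p) ∧ (∀ s k, G (s, (0, k)) = b₀ (s, k)) ∧
      (∀ s k, G (s, (1, k)) = b₁ (s, k)) ∧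
      (∀ s t, ∀ k ∈ bd K, G (s, (t, k)) = c (s, (t, k))) ∧ ∀ p, G p ∈ P :=
  (BoxExt.const P).fill₂ a b₀ b₁ c hc hb0 hb1 hca hc0 hc1 haP (fun _ _ => hb0P _)
    (fun _ _ => hb1P _) hcP

/-- Box filling with the faces of the sides given separately, for one more coordinate. -/
theorem exists_fill₃ (a b₀ b₁ c₀ c₁ : C(I × (I × K), Z)) (d : I × (I × (I × K)) → Z)
    (hd : ContinuousOn d {p | p.2.2.2 ∈ bd K}) (P : Set Z)
    (hb0 : ∀ p, b₀ (0, p) = a (0, p)) (hb1 : ∀ p, b₁ (0, p) = a (1, p))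
    (hc0 : ∀ t k, c₀ (0, (t, k)) = a (t, (0, k))) (hc1 : ∀ t k, c₁ (0, (t, k)) = a (t, (1, k)))
    (hc00 : ∀ s k, c₀ (s, (0, k)) = b₀ (s, (0, k))) (hc01 : ∀ s k, c₀ (s, (1, k)) = b₁ (s, (0, k)))
    (hc10 : ∀ s k, c₁ (s, (0, k)) = b₀ (s, (1, k))) (hc11 : ∀ s k, c₁ (s, (1, k)) = b₁ (s, (1, k)))
    (hda : ∀ t t', ∀ k ∈ bd K, d (0, (t, (t', k))) = a (t, (t', k)))
    (hdb0 : ∀ s t, ∀ k ∈ bd K, d (s, (0, (t, k))) = b₀ (s, (t, k)))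
    (hdb1 : ∀ s t, ∀ k ∈ bd K, d (s, (1, (t, k))) = b₁ (s, (t, k)))
    (hdc0 : ∀ s t, ∀ k ∈ bd K, d (s, (t, (0, k))) = c₀ (s, (t, k)))
    (hdc1 : ∀ s t, ∀ k ∈ bd K, d (s, (t, (1, k))) = c₁ (s, (t, k)))
    (haP : ∀ p, a p ∈ P) (hb0P : ∀ p, b₀ p ∈ P) (hb1P : ∀ p, b₁ p ∈ P)
    (hc0P : ∀ p, c₀ p ∈ P) (hc1P : ∀ p, c₁ p ∈ P)
    (hdP : ∀ s t t', ∀ k ∈ bd K, d (s, (t, (t', k))) ∈ P) :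
    ∃ G : C(I × (I × (I × K)), Z), (∀ p, G (0, p) = a p) ∧ (∀ s p, G (s, (0, p)) = b₀ (s, p)) ∧
      (∀ s p, G (s, (1, p)) = b₁ (s, p)) ∧ (∀ s t k, G (s, (t, (0, k))) = c₀ (s, (t, k))) ∧
      (∀ s t k, G (s, (t, (1, k))) = c₁ (s, (t, k))) ∧
      (∀ s t t', ∀ k ∈ bd K, G (s, (t, (t', k))) = d (s, (t, (t', k)))) ∧ ∀ p, G p ∈ P := by
  set c := glue (fun p : I × (I × (I × K)) => p.2.2.1) (fun p => c₀ (p.1, (p.2.1, p.2.2.2)))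
      (fun p => c₁ (p.1, (p.2.1, p.2.2.2))) d with hc
  have e0 : ∀ s t k, c (s, (t, (0, k))) = c₀ (s, (t, k)) := fun s t k =>
    glue_of_zero (p := (s, (t, ((0 : I), k)))) rfl
  have e1 : ∀ s t k, c (s, (t, (1, k))) = c₁ (s, (t, k)) := fun s t k =>
    glue_of_one (p := (s, (t, ((1 : I), k)))) rfl
  have e2 : ∀ s t t', ∀ k ∈ bd K, c (s, (t, (t', k))) = d (s, (t, (t', k))) := by
    intro s t t' k hk
    refine glue_of_agree ?_ ?_
    · rintro rfl; exact hdc0 s t k hk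
    · rintro rfl; exact hdc1 s t k hk
  have hcc : ContinuousOn c {p | p.2.2 ∈ bd (I × K)} := by
    refine continuousOn_glue (C := {p : I × (I × (I × K)) | p.2.2.2 ∈ bd K}) (by fun_prop)
      (isClosed_bd.preimage (by fun_prop)) (by fun_prop) (by fun_prop) hd ?_ ?_
    · rintro ⟨s, t, t', k⟩ hk rfl
      exact hdc0 s t k hk
    · rintro ⟨s, t, t', k⟩ hk rfl
      exact hdc1 s t k hk
  obtain ⟨G, h1, h2, h3, h4, h5⟩ := exists_fill₂ a b₀ b₁ c hcc P hb0 hb1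
    (by
      rintro t ⟨t', k⟩ (rfl | rfl | hk)
      · rw [e0, hc0]
      · rw [e1, hc1]
      · exact (e2 _ _ _ _ hk).trans (hda _ _ _ hk))
    (by
      rintro s ⟨t', k⟩ (rfl | rfl | hk)
      · rw [e0, hc00]
      · rw [e1, hc10]
      · exact (e2 _ _ _ _ hk).trans (hdb0 _ _ _ hk))
    (by
      rintro s ⟨t', k⟩ (rfl | rfl | hk)
      · rw [e0, hc01]
      · rw [e1, hc11]
      · exact (e2 _ _ _ _ hk).trans (hdb1 _ _ _ hk))
    haP hb0P hb1P
    (by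
      rintro s t ⟨t', k⟩ (rfl | rfl | hk)
      · rw [e0]; exact hc0P _
      · rw [e1]; exact hc1P _
      · rw [show c (s, (t, (t', k))) = _ from e2 _ _ _ _ hk]; exact hdP _ _ _ _ hk)
  exact ⟨G, h1, h2, h3, fun s t k => (h4 s t _ (Or.inl rfl)).trans (e0 s t k),
    fun s t k => (h4 s t _ (Or.inr (Or.inl rfl))).trans (e1 s t k),
    fun s t t' k hk => (h4 s t _ (Or.inr (Or.inr hk))).trans (e2 s t t' k hk), h5⟩

end

/-! ### Halves of the unit interval -/

/-- The embedding of the interval onto its lower half. -/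
def lowerHalf (s : I) : I := ⟨s / 2, by have := s.2.1; have := s.2.2; constructor <;> linarith⟩

/-- The embedding of the interval onto its upper half. -/
def upperHalf (s : I) : I :=
  ⟨(1 + s) / 2, by have := s.2.1; have := s.2.2; constructor <;> linarith⟩

@[fun_prop] theorem continuous_lowerHalf : Continuous lowerHalf := by unfold lowerHalf; fun_prop
@[fun_prop] theorem continuous_upperHalf : Continuous upperHalf := by unfold upperHalf; fun_prop

@[simp] theorem lowerHalf_zero : lowerHalf 0 = 0 := by ext; simp [lowerHalf]
@[simp] theorem upperHalf_one : upperHalf 1 = 1 := by ext; simp [upperHalf]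
theorem lowerHalf_one : lowerHalf 1 = upperHalf 0 := by ext; simp [lowerHalf, upperHalf]

theorem exists_half (s : I) : (∃ t, s = lowerHalf t) ∨ ∃ t, s = upperHalf t := by
  have h0 := s.2.1
  have h1 := s.2.2
  rcases le_total (s : ℝ) (1 / 2) with h | h
  · exact Or.inl ⟨⟨2 * s, by constructor <;> linarith⟩, by ext; simp [lowerHalf]⟩
  · exact Or.inr ⟨⟨2 * s - 1, by constructor <;> linarith⟩, by ext; simp [upperHalf]⟩

/-- Concatenation of maps on `I × L` in the direction of `I`. -/
theorem exists_concat {L Z : Type*} [TopologicalSpace L] [TopologicalSpace Z] (F G : C(I × L, Z))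
    (h : ∀ l, F (1, l) = G (0, l)) :
    ∃ H : C(I × L, Z), (∀ s l, H (lowerHalf s, l) = F (s, l)) ∧
      ∀ s l, H (upperHalf s, l) = G (s, l) := by
  let P : ℝ → I := Set.projIcc 0 1 zero_le_one
  have hP : Continuous P := continuous_projIcc
  refine ⟨⟨fun p => if (p.1 : ℝ) ≤ 1 / 2 then F (P (2 * p.1), p.2) else G (P (2 * p.1 - 1), p.2),
    ?_⟩, fun s l => ?_, fun s l => ?_⟩
  · refine Continuous.if_le (by fun_prop) (by fun_prop) (by fun_prop) (by fun_prop) fun p hp => ?_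
    rw [hp]
    have e1 : P (2 * (1 / 2)) = 1 := by simp [P]
    have e2 : P (2 * (1 / 2) - 1) = 0 := by simp [P]
    rw [e1, e2, h]
  · have h1 : ((lowerHalf s : I) : ℝ) ≤ 1 / 2 := by
      have := s.2.2; simp only [lowerHalf]; linarith
    have h2 : P (2 * (lowerHalf s : I)) = s := by
      simp only [lowerHalf, P]
      rw [show 2 * ((s : ℝ) / 2) = s by ring]
      exact Set.projIcc_val _ _
    simp only [ContinuousMap.coe_mk, if_pos h1, h2]
  · by_cases h1 : ((upperHalf s : I) : ℝ) ≤ 1 / 2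
    · have hs : s = 0 := by
        have := s.2.1
        simp only [upperHalf] at h1
        exact Subtype.ext (le_antisymm (show (s : ℝ) ≤ 0 by linarith) this)
      subst hs
      have h2 : P (2 * (upperHalf 0 : I)) = 1 := by simp [upperHalf, P]
      simp only [ContinuousMap.coe_mk, if_pos h1, h2, h]
    · have h2 : P (2 * (upperHalf s : I) - 1) = s := by
        simp only [upperHalf, P]
        rw [show 2 * ((1 + (s : ℝ)) / 2) - 1 = s by ring]
        exact Set.projIcc_val _ _
      simp only [ContinuousMap.coe_mk, if_neg h1, h2]

/-! ### Relative lifting up to homotopy -/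

section WE
variable {A B C : Type*} [TopologicalSpace A] [TopologicalSpace B] [TopologicalSpace C]

/-- The map `v` on the cube lifts along `g`, up to homotopy relative to the boundary, to a map
which extends `u`. -/
def LiftRel {K : Type} [TopologicalSpace K] [CubeSpace K] (g : C(A, B)) (Q : Set A) (P : Set B)
    (u : K → A) (v : C(K, B)) : Prop :=
  ∃ w : C(K, A), (∀ k, w k ∈ Q) ∧ (∀ k ∈ bd K, w k = u k) ∧
    ∃ κ : C(I × K, B), (∀ k, κ (0, k) = g (w k)) ∧ (∀ k, κ (1, k) = v k) ∧
      (∀ s, ∀ k ∈ bd K, κ (s, k) = v k) ∧ ∀ p, κ p ∈ P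

/-- The relative lifting property up to homotopy for the cube `K`. -/
def LiftProp (K : Type) [TopologicalSpace K] [CubeSpace K] (g : C(A, B)) (Q : Set A) (P : Set B) :
    Prop :=
  ∀ (u : K → A) (v : C(K, B)), ContinuousOn u (bd K) → (∀ k ∈ bd K, u k ∈ Q) → (∀ k, v k ∈ P) →
    (∀ k ∈ bd K, v k = g (u k)) → LiftRel g Q P u v

/-- A form of weak equivalences `Q → P` in terms of relative lifting up to homotopy. -/
def WE (g : C(A, B)) (Q : Set A) (P : Set B) : Prop :=
  ∀ n : ℕ, LiftProp (Fin n → I) g Q P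

theorem LiftProp.of_homeo {K K' : Type} [TopologicalSpace K] [CubeSpace K] [TopologicalSpace K']
    [CubeSpace K'] (e : K ≃ₜ K') (he : ∀ k, k ∈ bd K ↔ e k ∈ bd K') {g : C(A, B)} {Q : Set A}
    {P : Set B} (h : LiftProp K' g Q P) : LiftProp K g Q P := by
  intro u v hu huQ hvP huv
  have he' : ∀ k, k ∈ bd K' ↔ e.symm k ∈ bd K := fun k => by rw [he, e.apply_symm_apply]
  obtain ⟨w, hwQ, hw, κ, h0, h1, hb, hκP⟩ := h (u ∘ e.symm) (v.comp e.symm)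
    (hu.comp e.symm.continuous.continuousOn fun k hk => (he' k).1 hk)
    (fun k hk => huQ _ ((he' k).1 hk)) (fun k => hvP _) (fun k hk => huv _ ((he' k).1 hk))
  refine ⟨w.comp e, fun k => hwQ _, fun k hk => ?_,
    κ.comp ((ContinuousMap.id I).prodMap e), fun k => ?_, fun k => ?_, fun s k hk => ?_,
    fun p => hκP _⟩
  · simpa using hw _ ((he k).1 hk)
  · simpa using h0 (e k)
  · simpa using h1 (e k)
  · simpa using hb s _ ((he k).1 hk)

theorem WE.liftProp {g : C(A, B)} {Q : Set A} {P : Set B} (h : WE g Q P) (K : Type)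
    [TopologicalSpace K] [CubeSpace K] : LiftProp K g Q P := by
  obtain ⟨n, e, he⟩ := CubeSpace.exists_homeo (K := K)
  exact (h n).of_homeo e he

theorem WE.of_prod {g : C(A, B)} {Q : Set A} {P : Set B} (h0 : LiftProp (Fin 0 → I) g Q P)
    (h : ∀ n, LiftProp (I × (Fin n → I)) g Q P) : WE g Q P := by
  rintro (_ | n)
  · exact h0
  · refine (h n).of_homeo (cubeCons n).symm fun k => ?_
    have := cubeCons_mem_boundary n ((cubeCons n).symm k)
    rw [Homeomorph.apply_symm_apply] at this
    exact this

variable {K : Type} [TopologicalSpace K] [CubeSpace K] {g : C(A, B)} {Q : Set A} {P : Set B}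

/-- Relative lifting up to homotopy is invariant under homotopies of the lifting problem. -/
theorem LiftRel.of_homotopy (hg : ∀ z ∈ Q, g z ∈ P) {u₀ u₁ : K → A} {v₀ v₁ : C(K, B)}
    (U : I × K → A) (hU : ContinuousOn U {p | p.2 ∈ bd K}) (hUQ : ∀ s, ∀ k ∈ bd K, U (s, k) ∈ Q)
    (V : C(I × K, B)) (hVP : ∀ p, V p ∈ P) (hUV : ∀ s, ∀ k ∈ bd K, V (s, k) = g (U (s, k)))
    (hU0 : ∀ k ∈ bd K, U (0, k) = u₀ k) (hU1 : ∀ k ∈ bd K, U (1, k) = u₁ k)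
    (hV0 : ∀ k, V (0, k) = v₀ k) (hV1 : ∀ k, V (1, k) = v₁ k) (h : LiftRel g Q P u₁ v₁) :
    LiftRel g Q P u₀ v₀ := by
  obtain ⟨w, hwQ, hw, κ, h0, h1, hb, hκP⟩ := h
  have hcs : Continuous fun p : I × K => (σ p.1, p.2) := by fun_prop
  -- The lift `w` is carried back along the boundary homotopy; the end of `L` is the lift for `u₀`.
  obtain ⟨L, hL0, hL1, hLQ⟩ := exists_fill w (fun p => U (σ p.1, p.2))
    (hU.comp hcs.continuousOn fun p hp => hp) (fun k hk => by simp [hU1 k hk, hw k hk]) Q hwQ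
    (fun s k hk => hUQ _ k hk)
  -- The homotopy `κ` is carried back in the same way, between the tracks `g ∘ L` and `V` reversed.
  obtain ⟨G, hG0, hG1, hG2, hG3, hG4⟩ := exists_fill₂ κ (g.comp L) (V.comp ⟨_, hcs⟩)
    (fun p => V (σ p.1, p.2.2)) (by fun_prop) P (fun k => by simp [hL0, h0])
    (fun k => by simp [hV1, h1]) (fun t k hk => by simp [hb t k hk, hV1])
    (fun s k hk => by simp [hUV _ k hk, hL1 s k hk]) (fun s k hk => by simp) hκP
    (fun p => hg _ (hLQ p)) (fun p => hVP _) (fun s t k hk => hVP _)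
  refine ⟨L.comp ⟨fun k => (1, k), by fun_prop⟩, fun k => hLQ _, fun k hk => ?_,
    G.comp ⟨fun p => (1, p), by fun_prop⟩, fun k => ?_, fun k => ?_, fun s k hk => ?_,
    fun p => hG4 _⟩
  · simp [hL1 1 k hk, hU0 k hk]
  · simp [hG1]
  · simp [hG2, hV0]
  · simp [hG3 1 s k hk, hV0]

/-- By homotopy extension only the boundary data must be deformed; in exchange the deformed cube
`v₁` is not under control. -/
theorem LiftRel.of_boundary_homotopy (hg : ∀ z ∈ Q, g z ∈ P) {u₀ u₁ : K → A} {v₀ : C(K, B)}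
    (U : I × K → A) (hU : ContinuousOn U {p | p.2 ∈ bd K}) (hUQ : ∀ s, ∀ k ∈ bd K, U (s, k) ∈ Q)
    (hU0 : ∀ k ∈ bd K, U (0, k) = u₀ k) (hU1 : ∀ k ∈ bd K, U (1, k) = u₁ k)
    (hv0 : ∀ k ∈ bd K, v₀ k = g (u₀ k)) (hvP : ∀ k, v₀ k ∈ P)
    (h : ∀ v₁ : C(K, B), (∀ k, v₁ k ∈ P) → (∀ k ∈ bd K, v₁ k = g (u₁ k)) → LiftRel g Q P u₁ v₁) :
    LiftRel g Q P u₀ v₀ := by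
  obtain ⟨V, hV0, hV1, hVP⟩ := exists_fill v₀ (fun p => g (U p))
    (g.continuous.comp_continuousOn hU) (fun k hk => by simp [hU0 k hk, hv0 k hk]) P hvP
    (fun s k hk => hg _ (hUQ s k hk))
  refine LiftRel.of_homotopy (v₁ := V.comp ⟨fun k => (1, k), by fun_prop⟩) hg U hU hUQ V hVP hV1
    hU0 hU1 hV0 (fun _ => rfl) (h _ (fun k => hVP _) fun k hk => ?_)
  simp [hV1 1 k hk, hU1 k hk]

/-- A map on the boundary of a cube is homotopic to a map which is constant outside one face. -/
theorem exists_boundary_normalization (K : Type) [TopologicalSpace K] [CubeSpace K] (Q : Set A)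
    (u : I × K → A) (hu : ContinuousOn u (bd (I × K))) (huQ : ∀ p ∈ bd (I × K), u p ∈ Q) :
    ∃ p₀ ∈ bd (I × K), ∀ a, JoinedIn Q (u p₀) a →
      ∃ (U : I × (I × K) → A) (φ : C(K, A)), ContinuousOn U {p | p.2 ∈ bd (I × K)} ∧
        (∀ s, ∀ p ∈ bd (I × K), U (s, p) ∈ Q) ∧ (∀ p ∈ bd (I × K), U (0, p) = u p) ∧
        (∀ k, U (1, (0, k)) = φ k) ∧ (∀ k, U (1, (1, k)) = a) ∧
        (∀ t, ∀ k ∈ bd K, U (1, (t, k)) = a) := by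
  obtain ⟨n, e, he⟩ := CubeSpace.exists_homeo (K := K)
  let p₀ : I × K := (1, e.symm 0)
  have hp₀ : p₀ ∈ bd (I × K) := Or.inr (Or.inl rfl)
  -- The point `p₀` is fixed before `a`, so that `a` may later be chosen in the path component of `u
  -- p₀`.
  refine ⟨p₀, hp₀, fun a ha => ?_⟩
  obtain ⟨r, hr1, hr2⟩ := exists_box_retraction K
  -- Retraction of the cube onto the box formed by the face at 1 and the sides.
  let ρ : C(I × K, I × K) := ⟨fun p => (σ (r (σ p.1, p.2)).1, (r (σ p.1, p.2)).2), by fun_prop⟩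
  have hρ1 : ∀ p, ρ p ∈ bd (I × K) := fun p => by
    rcases hr1 (σ p.1, p.2) with h | h
    · exact Or.inr (Or.inl (by simp [ρ, h]))
    · exact Or.inr (Or.inr h)
  have hρ2 : ∀ p : I × K, p.1 = 1 ∨ p.2 ∈ bd K → ρ p = p := fun p hp => by
    have : r (σ p.1, p.2) = (σ p.1, p.2) := hr2 _ (by simpa using hp)
    simp [ρ, this]
  have huρ : Continuous fun p => u (ρ p) := by
    rw [← continuousOn_univ]
    exact hu.comp ρ.continuous.continuousOn fun p _ => hρ1 p
  obtain ⟨c, hc0, hc1⟩ := CubeSpace.id_homotopic_const p₀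
  obtain ⟨N, hN0, hN1⟩ := exists_concat (L := I × K) ⟨fun p => u (ρ (c p)), huρ.comp c.continuous⟩
    ⟨fun p => ha.somePath p.1, by fun_prop⟩ (fun l => by simp [hc1, hρ2 p₀ (Or.inl rfl)])
  have hNQ : ∀ p, N p ∈ Q := by
    rintro ⟨s, p⟩
    rcases exists_half s with ⟨t, rfl⟩ | ⟨t, rfl⟩
    · rw [hN0]; exact huQ _ (hρ1 _)
    · rw [hN1]; exact ha.somePath_mem _
  have hNs : ∀ p : I × K, p.1 = 1 ∨ p.2 ∈ bd K → N (0, p) = u p := fun p hp => by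
    have := hN0 0 p
    simpa [hc0, hρ2 p hp] using this
  have hNe : ∀ p : I × K, N (1, p) = a := fun p => by simpa using hN1 1 p
  have hu0 : Continuous fun k => u (0, k) := by
    rw [← continuousOn_univ]
    exact hu.comp (by fun_prop) fun p _ => Or.inl rfl
  -- The homotopy on the box is extended over the remaining face; its end there is `φ`.
  obtain ⟨Ψ, hΨ0, hΨ1, hΨQ⟩ := exists_fill ⟨_, hu0⟩ (fun p => N (p.1, (0, p.2))) (by fun_prop)
    (fun k hk => hNs _ (Or.inr hk)) Q (fun k => huQ _ (Or.inl rfl)) (fun s k hk => hNQ _)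
  set U := glue (fun p : I × (I × K) => p.2.1) (fun p => Ψ (p.1, p.2.2)) N N with hU
  have e0 : ∀ s k, U (s, (0, k)) = Ψ (s, k) := fun s k => glue_of_zero (p := (s, ((0 : I), k))) rfl
  have e1 : ∀ s k, U (s, (1, k)) = N (s, (1, k)) := fun s k =>
    glue_of_one (p := (s, ((1 : I), k))) rfl
  have e2 : ∀ s t, ∀ k ∈ bd K, U (s, (t, k)) = N (s, (t, k)) := by
    intro s t k hk
    refine glue_of_agree ?_ fun _ => rfl
    rintro rfl
    exact (hΨ1 s k hk).symm
  refine ⟨U, Ψ.comp ⟨fun k => (1, k), by fun_prop⟩, ?_, ?_, ?_, fun k => e0 1 k,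
    fun k => by rw [e1, hNe], fun t k hk => by rw [e2 _ _ _ hk, hNe]⟩
  · refine continuousOn_glue (C := {p : I × (I × K) | p.2.2 ∈ bd K}) (by fun_prop)
      (isClosed_bd.preimage (by fun_prop)) (by fun_prop) (by fun_prop) (by fun_prop) ?_ ?_
    · rintro ⟨s, t, k⟩ hk rfl
      exact (hΨ1 s k hk).symm
    · rintro ⟨s, t, k⟩ hk rfl
      rfl
  · rintro s ⟨t, k⟩ (rfl | rfl | hk)
    · rw [e0]; exact hΨQ _
    · rw [e1]; exact hNQ _
    · rw [e2 _ _ _ hk]; exact hNQ _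
  · rintro ⟨t, k⟩ (rfl | rfl | hk)
    · rw [e0, hΨ0]; rfl
    · rw [e1, hNs _ (Or.inl rfl)]
    · rw [e2 _ _ _ hk, hNs _ (Or.inr hk)]

theorem WE.exists_joinedIn [Nonempty A] (h : WE g Q P) {b : B} (hb : b ∈ P) :
    ∃ a ∈ Q, JoinedIn P b (g a) := by
  have a₀ := Classical.arbitrary A
  obtain ⟨w, hwQ, -, κ, h0, h1, -, hκP⟩ := h 0 (fun _ => a₀) (ContinuousMap.const _ b)
    continuousOn_const (fun k hk => by obtain ⟨i, -⟩ := hk; exact i.elim0) (fun _ => hb)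
    (fun k hk => by obtain ⟨i, -⟩ := hk; exact i.elim0)
  refine ⟨w 0, hwQ 0, JoinedIn.symm ⟨⟨⟨fun s => κ (s, 0), by fun_prop⟩, h0 0, ?_⟩, fun s => hκP _⟩⟩
  simp [h1]

/-- If `i` and `j ∘ i` are weak equivalences, then so is `j`. -/
theorem WE.of_comp [Nonempty A] {F : Set A} {Q : Set B} {P : Set C} {i : C(A, B)} {j : C(B, C)}
    (hiQ : ∀ a ∈ F, i a ∈ Q) (hjP : ∀ b ∈ Q, j b ∈ P) (hi : WE i F Q) (hji : WE (j.comp i) F P) :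
    WE j Q P := by
  refine WE.of_prod ?_ fun n => ?_
  · intro u v hu huQ hvP huv
    obtain ⟨w, hwQ, -, κ, h0, h1, -, hκP⟩ := hji 0 (fun _ => Classical.arbitrary A) v
      continuousOn_const (fun k hk => by obtain ⟨i, -⟩ := hk; exact i.elim0) hvP
      (fun k hk => by obtain ⟨i, -⟩ := hk; exact i.elim0)
    exact ⟨i.comp w, fun k => hiQ _ (hwQ k),
      fun k hk => by obtain ⟨i, -⟩ := hk; exact i.elim0, κ, h0, h1,
      fun s k hk => by obtain ⟨i, -⟩ := hk; exact i.elim0, hκP⟩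
  · intro u v hu huQ hvP huv
    obtain ⟨p₀, hp₀, hn⟩ := exists_boundary_normalization (Fin n → I) Q u hu huQ
    -- The constant part of the normalized boundary is moved into the image of `i`.
    obtain ⟨x, hxF, hx⟩ := hi.exists_joinedIn (huQ p₀ hp₀)
    obtain ⟨U, φ, hUc, hUQ, hU0, hU1, hU2, hU3⟩ := hn _ hx
    refine LiftRel.of_boundary_homotopy hjP U hUc hUQ hU0 (fun p hp => rfl) huv hvP ?_
    intro v₁ hv₁P hv₁
    -- The one nonconstant face is lifted along `i` as well. Then the whole boundary has the form `i
    -- ∘ û`, and the equivalence `j ∘ i` solves the problem.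
    obtain ⟨w, hwF, hw, κ, h0, h1, hb, hκQ⟩ := hi n (fun _ => x) φ continuousOn_const
      (fun _ _ => hxF) (fun k => by rw [← hU1]; exact hUQ 1 _ (Or.inl rfl))
      (fun k hk => by rw [← hU1, hU3 0 k hk])
    have hφ : ∀ k ∈ bd (Fin n → I), φ k = i x := fun k hk => by rw [← hU1, hU3 0 k hk]
    set U' := glue (fun p : I × (I × (Fin n → I)) => p.2.1) (fun p => κ (σ p.1, p.2.2))
      (fun _ => i x) (fun _ => i x) with hU'
    have e0 : ∀ s k, U' (s, (0, k)) = κ (σ s, k) := fun s k =>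
      glue_of_zero (p := (s, ((0 : I), k))) rfl
    have e1 : ∀ s k, U' (s, (1, k)) = i x := fun s k => glue_of_one (p := (s, ((1 : I), k))) rfl
    have e2 : ∀ s t, ∀ k ∈ bd (Fin n → I), U' (s, (t, k)) = i x := by
      intro s t k hk
      refine glue_of_agree ?_ fun _ => rfl
      rintro rfl
      rw [hb _ k hk, hφ k hk]
    set û := glue (fun p : I × (Fin n → I) => p.1) (fun p => w p.2) (fun _ => x) (fun _ => x)
      with hû
    have f0 : ∀ k, û (0, k) = w k := fun k => glue_of_zero (p := ((0 : I), k)) rfl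
    have f1 : ∀ k, û (1, k) = x := fun k => glue_of_one (p := ((1 : I), k)) rfl
    have f2 : ∀ t, ∀ k ∈ bd (Fin n → I), û (t, k) = x := by
      intro t k hk
      refine glue_of_agree ?_ fun _ => rfl
      rintro rfl
      exact (hw k hk).symm
    refine LiftRel.of_boundary_homotopy (u₁ := fun p => i (û p)) hjP U' ?_ ?_ ?_ ?_ hv₁ hv₁P ?_
    · refine continuousOn_glue (C := {p : I × (I × (Fin n → I)) | p.2.2 ∈ bd (Fin n → I)})
        (by fun_prop) (isClosed_bd.preimage (by fun_prop)) (by fun_prop) (by fun_prop)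
        (by fun_prop) ?_ ?_
      · rintro ⟨s, t, k⟩ hk rfl
        simp only [Set.mem_ofPred_eq] at hk
        simp [hb _ k hk, hφ k hk]
      · rintro ⟨s, t, k⟩ hk rfl
        rfl
    · rintro s ⟨t, k⟩ (rfl | rfl | hk)
      · rw [e0]; exact hκQ _
      · rw [e1]; exact hiQ _ hxF
      · rw [e2 _ _ _ hk]; exact hiQ _ hxF
    · rintro ⟨t, k⟩ (rfl | rfl | hk)
      · rw [e0, hU1, unitInterval.symm_zero, h1]
      · rw [e1, hU2]
      · rw [e2 _ _ _ hk, hU3 _ _ hk]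
    · rintro ⟨t, k⟩ (rfl | rfl | hk)
      · rw [e0, f0, unitInterval.symm_one, h0]
      · rw [e1, f1]
      · rw [e2 _ _ _ hk, f2 _ _ hk]
    · intro v₂ hv₂P hv₂
      obtain ⟨w', hw'F, hw', κ', h0', h1', hb', hκ'P⟩ := hji.liftProp (I × (Fin n → I)) û v₂ (by
          refine continuousOn_glue (C := {p : I × (Fin n → I) | p.2 ∈ bd (Fin n → I)})
            (by fun_prop) (isClosed_bd.preimage (by fun_prop)) (by fun_prop) (by fun_prop)
            (by fun_prop) ?_ ?_
          · rintro ⟨t, k⟩ hk rfl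
            exact (hw k hk).symm
          · rintro ⟨t, k⟩ hk rfl
            rfl)
        (by
          rintro ⟨t, k⟩ (rfl | rfl | hk)
          · rw [f0]; exact hwF k
          · rw [f1]; exact hxF
          · rw [f2 _ _ hk]; exact hxF) hv₂P hv₂
      exact ⟨i.comp w', fun k => hiQ _ (hw'F k), fun k hk => congrArg i (hw' k hk), κ', h0', h1',
        hb', hκ'P⟩

end WE

/-! ### Path lifts and homotopy fibres -/

section PathLifts
variable {X : Type u} {Y : Type v} [TopologicalSpace X] [TopologicalSpace Y]

/-- Pairs `(x, γ)` where `γ` is a path in `A` which starts at `f x`. -/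
def pathLifts (f : C(X, Y)) (A : Set Y) : Set (X × C(I, Y)) :=
  {z | z.2 0 = f z.1 ∧ ∀ s, z.2 s ∈ A}

/-- Pairs `(x, γ)` where `γ` is a path in `A` from `f x` to `b`: the homotopy fibre over `b` of the
restriction of `f` to `f ⁻¹' A → A`. -/
def hoFiber (f : C(X, Y)) (A : Set Y) (b : Y) : Set (X × C(I, Y)) :=
  {z | z ∈ pathLifts f A ∧ z.2 1 = b}

/-- The inclusion of the fibre over `b` into the homotopy fibre of `f ⁻¹' A → A` is a weak
equivalence. -/
def FiberEquiv (f : C(X, Y)) (A : Set Y) (b : Y) : Prop :=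
  WE (ContinuousMap.id (X × C(I, Y))) (hoFiber f {b} b) (hoFiber f A b)

theorem pathLifts_mono {f : C(X, Y)} {A B : Set Y} (h : B ⊆ A) : pathLifts f B ⊆ pathLifts f A :=
  fun _ hz => ⟨hz.1, fun s => h (hz.2 s)⟩

theorem hoFiber_mono {f : C(X, Y)} {A B : Set Y} (h : B ⊆ A) (b : Y) :
    hoFiber f B b ⊆ hoFiber f A b :=
  fun _ hz => ⟨pathLifts_mono h hz.1, hz.2⟩

theorem mem_hoFiber_singleton {f : C(X, Y)} {b : Y} {z : X × C(I, Y)} :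
    z ∈ hoFiber f {b} b ↔ f z.1 = b ∧ ∀ s, z.2 s = b := by
  refine ⟨fun h => ⟨h.1.1 ▸ h.1.2 0, h.1.2⟩, fun h => ⟨⟨(h.2 0).trans h.1.symm, h.2⟩, h.2 1⟩⟩

variable {L : Type*} [TopologicalSpace L]

/-- The map to `X × C(I, Y)` with given components. -/
def toPaths (N : C(L, X)) (Θ : C(I × L, Y)) : C(L, X × C(I, Y)) :=
  N.prodMk (Θ.comp ⟨Prod.swap, continuous_swap⟩).curry

@[simp] theorem toPaths_fst (N : C(L, X)) (Θ : C(I × L, Y)) (l : L) : (toPaths N Θ l).1 = N l := rfl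

@[simp] theorem toPaths_snd (N : C(L, X)) (Θ : C(I × L, Y)) (l : L) (s : I) :
    (toPaths N Θ l).2 s = Θ (s, l) := rfl

/-- The first component of a map to `X × C(I, Y)`. -/
def ptOf (v : C(L, X × C(I, Y))) : C(L, X) := ⟨fun l => (v l).1, by fun_prop⟩

/-- The uncurried second component of a map to `X × C(I, Y)`. -/
def pathOf (v : C(L, X × C(I, Y))) : C(I × L, Y) := ⟨fun p => (v p.2).2 p.1, by fun_prop⟩

@[simp] theorem ptOf_apply (v : C(L, X × C(I, Y))) (l : L) : ptOf v l = (v l).1 := rfl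

@[simp] theorem pathOf_apply (v : C(L, X × C(I, Y))) (s : I) (l : L) :
    pathOf v (s, l) = (v l).2 s := rfl

theorem toPaths_eq_iff (N : C(L, X)) (Θ : C(I × L, Y)) (l : L) (z : X × C(I, Y)) :
    toPaths N Θ l = z ↔ N l = z.1 ∧ ∀ s, Θ (s, l) = z.2 s := by
  constructor
  · rintro rfl
    simp
  · rintro ⟨h1, h2⟩
    exact Prod.ext h1 (ContinuousMap.ext h2)

variable {K : Type} [TopologicalSpace K] [CubeSpace K]

/-- The evaluation at the endpoint on path lifts has the lifting property for open boxes. -/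
theorem boxExt_pathLifts (f : C(X, Y)) (A : Set Y) (v : C(I × K, Y)) (hv : ∀ p, v p ∈ A) :
    BoxExt K fun p => {z : X × C(I, Y) | z ∈ pathLifts f A ∧ z.2 1 = v p} := by
  intro g hg hgS
  obtain ⟨r, hr1, hr2⟩ := exists_box_retraction K
  have hgr : Continuous fun p => g (r p) := by
    rw [← continuousOn_univ]
    exact hg.comp r.continuous.continuousOn fun p _ => hr1 p
  have hg0 : Continuous fun k => g (0, k) := by
    rw [← continuousOn_univ]
    exact hg.comp (by fun_prop) fun p _ => Or.inl rfl
  have hgb : ContinuousOn (fun p : I × (I × K) => (g (p.1, p.2.2)).2 p.2.1)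
      {p | p.2.2 ∈ bd K} := by
    have h1 : ContinuousOn (fun p : I × (I × K) => g (p.1, p.2.2)) {p | p.2.2 ∈ bd K} :=
      hg.comp (by fun_prop) fun p hp => Or.inr hp
    exact (ContinuousEval.continuous_eval (F := C(I, Y))).comp_continuousOn
      ((continuous_snd.comp_continuousOn h1).prodMk
        (by fun_prop : Continuous fun p : I × (I × K) => p.2.1).continuousOn)
  -- The points of X are extended through the retraction. The paths are then filled in one dimension
  -- higher, with starting points forced by the points of X and endpoints by `v`.
  obtain ⟨Θ, h0, h1, h2, h3, h4⟩ := exists_fill₂ (K := K)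
    (pathOf ⟨_, hg0⟩) (f.comp (ptOf ⟨_, hgr⟩)) v _ hgb A
    (fun k => by
      have : r ((0 : I), k) = (0, k) := hr2 _ (Or.inl rfl)
      simp [this, (hgS (0, k) (Or.inl rfl)).1.1])
    (fun k => by simp [(hgS (0, k) (Or.inl rfl)).2])
    (fun t k hk => rfl)
    (fun s k hk => by
      have : r (s, k) = (s, k) := hr2 _ (Or.inr hk)
      simp [this, (hgS (s, k) (Or.inr hk)).1.1])
    (fun s k hk => by simp [(hgS (s, k) (Or.inr hk)).2])
    (fun p => (hgS _ (Or.inl rfl)).1.2 _)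
    (fun p => by
      have := (hgS _ (hr1 p)).1
      change f (g (r p)).1 ∈ A
      rw [← this.1]
      exact this.2 0)
    hv
    (fun s t k hk => (hgS (s, k) (Or.inr hk)).1.2 _)
  refine ⟨toPaths (ptOf ⟨_, hgr⟩)
    (Θ.comp ⟨fun p => (p.2.1, (p.1, p.2.2)), by fun_prop⟩), ?_, ?_⟩
  · rintro ⟨s, k⟩ hp
    rw [toPaths_eq_iff]
    refine ⟨by simp [hr2 _ hp], fun t => ?_⟩
    rcases hp with rfl | hk
    · exact h0 _
    · exact h3 _ _ _ hk
  · rintro ⟨s, k⟩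
    refine ⟨⟨?_, fun t => ?_⟩, ?_⟩
    · exact h1 s k
    · exact h4 _
    · exact h2 s k

/-- Path lifts can be prolonged along homotopies of their endpoints. -/
theorem exists_transport (f : C(X, Y)) (e : C(L, X × C(I, Y))) (he : ∀ l, (e l).2 0 = f (e l).1)
    (k : C(I × L, Y)) (hk : ∀ l, k (0, l) = (e l).2 1) :
    ∃ T : C(I × L, X × C(I, Y)), (∀ l, T (0, l) = e l) ∧ (∀ p, (T p).2 1 = k p) ∧
      ∀ A : Set Y, ∀ l, e l ∈ pathLifts f A → (∀ s, k (s, l) ∈ A) →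
        ∀ s, T (s, l) ∈ pathLifts f A := by
  let P : ℝ → I := Set.projIcc 0 1 zero_le_one
  have hP : Continuous P := continuous_projIcc
  have hP1 : P 1 = 1 := by simp [P]
  have hP0 : P 0 = 0 := by simp [P]
  -- The old path followed by `k` up to time s, run at speed 1 + s, so that s = 0 gives back `e`
  -- exactly.
  let τ : I × (I × L) → ℝ := fun p => (1 + (p.2.1 : ℝ)) * (p.1 : ℝ)
  have hτ : Continuous τ := by fun_prop
  let Θ : I × (I × L) → Y := fun p =>
    if τ p ≤ 1 then (e p.2.2).2 (P (τ p)) else k (P (τ p - 1), p.2.2)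
  have hΘ : Continuous Θ := by
    refine Continuous.if_le (by fun_prop) (by fun_prop) hτ continuous_const fun p hp => ?_
    rw [hp, sub_self, hP1, hP0, hk]
  refine ⟨toPaths ⟨fun p => (e p.2).1, by fun_prop⟩ ⟨Θ, hΘ⟩, fun l => ?_, ?_, ?_⟩
  · rw [toPaths_eq_iff]
    refine ⟨rfl, fun s => ?_⟩
    have h1 : τ (s, (0, l)) = s := by simp [τ]
    simp only [ContinuousMap.coe_mk, Θ, h1, if_pos s.2.2]
    congr 1
    exact Set.projIcc_val _ _
  · rintro ⟨s, l⟩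
    have h1 : τ (1, (s, l)) = 1 + s := by simp [τ]
    simp only [toPaths_snd, ContinuousMap.coe_mk, Θ, h1]
    split_ifs with h
    · have hs : s = 0 := Subtype.ext (le_antisymm (show (s : ℝ) ≤ 0 by linarith) s.2.1)
      subst hs
      simp [hk, hP1]
    · have : P (1 + (s : ℝ) - 1) = s := by
        rw [add_sub_cancel_left]
        exact Set.projIcc_val _ _
      rw [this]
  · intro A l hl hA s
    refine ⟨?_, fun t => ?_⟩
    · have h1 : τ (0, (s, l)) = 0 := by simp [τ]
      simp [Θ, h1, hP0, he]
    · simp only [toPaths_snd, ContinuousMap.coe_mk, Θ]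
      split_ifs
      · exact hl.2 _
      · exact hA _

/-- Relative lifting of cubes in `A` with one face in `B` to path lifts. -/
def RelLift (f : C(X, Y)) (B A : Set Y) : Prop :=
  ∀ (K : Type) [TopologicalSpace K] [CubeSpace K] (v : C(I × K, Y)) (u : I × K → X × C(I, Y)),
    ContinuousOn u {p | p.1 = 0 ∨ p.2 ∈ bd K} → (∀ p, v p ∈ A) → (∀ k, v (1, k) ∈ B) →
    (∀ p, p.1 = 0 ∨ p.2 ∈ bd K → u p ∈ pathLifts f A ∧ (u p).2 1 = v p) →
    (∀ k ∈ bd K, u (1, k) ∈ pathLifts f B) →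
    ∃ w : C(I × K, X × C(I, Y)), (∀ p, p.1 = 0 ∨ p.2 ∈ bd K → w p = u p) ∧
      (∀ p, w p ∈ pathLifts f A ∧ (w p).2 1 = v p) ∧ ∀ k, w (1, k) ∈ pathLifts f B

/-- A lift over A exists because evaluation of path lifts at the endpoint is a fibration. Only its
face at 1 must be pushed into B; after transport to a single endpoint z this is a compression
problem for homotopy fibres over z. -/
theorem relLift_of_WE (f : C(X, Y)) {B A : Set Y} (hBA : B ⊆ A)
    (h : ∀ y ∈ B, ∃ z, JoinedIn B y z ∧
      WE (ContinuousMap.id (X × C(I, Y))) (hoFiber f B z) (hoFiber f A z)) :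
    RelLift f B A := by
  intro K _ _ v u hu hvA hvB huA huB
  obtain ⟨w₀, hw0, hw0A⟩ := boxExt_pathLifts f A v hvA u hu huA
  let e : C(K, X × C(I, Y)) := w₀.comp ⟨fun k => (1, k), by fun_prop⟩
  have heA : ∀ k, e k ∈ pathLifts f A := fun k => (hw0A _).1
  have hev : ∀ k, (e k).2 1 = v (1, k) := fun k => (hw0A _).2
  have heB : ∀ k ∈ bd K, e k ∈ pathLifts f B := fun k hk => by
    rw [show e k = u (1, k) from hw0 _ (Or.inr hk)]; exact huB k hk
  obtain ⟨n, ε, -⟩ := CubeSpace.exists_homeo (K := K)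
  let k₀ : K := ε.symm 0
  obtain ⟨c, hc0, hc1⟩ := CubeSpace.id_homotopic_const k₀
  obtain ⟨z, hz, hWE⟩ := h _ (hvB k₀)
  -- A homotopy inside B from the face v(1, ·) to the constant z: contract the cube to `k₀`, then
  -- follow a path to z.
  obtain ⟨k, hk0, hk1⟩ := exists_concat (L := K) ⟨fun p => v (1, c p), by fun_prop⟩
    ⟨fun p => hz.somePath p.1, by fun_prop⟩ (fun l => by simp [hc1])
  have hkB : ∀ p, k p ∈ B := by
    rintro ⟨s, p⟩
    rcases exists_half s with ⟨t, rfl⟩ | ⟨t, rfl⟩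
    · rw [hk0]; exact hvB _
    · rw [hk1]; exact hz.somePath_mem _
  have hks : ∀ l, k (0, l) = v (1, l) := fun l => by simpa [hc0] using hk0 0 l
  have hke : ∀ l, k (1, l) = z := fun l => by simpa using hk1 1 l
  obtain ⟨T, hT0, hTk, hTA⟩ := exists_transport f e (fun l => (heA l).1) k
    (fun l => by rw [hks, hev])
  have hTA' : ∀ p, T p ∈ pathLifts f A := fun p => hTA A p.2 (heA _) (fun s => hBA (hkB _)) p.1
  have hTB : ∀ s, ∀ l ∈ bd K, T (s, l) ∈ pathLifts f B := fun s l hl =>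
    hTA B l (heB l hl) (fun s => hkB _) s
  obtain ⟨w, hwB, hw, κ, hκ0, hκ1, hκb, hκA⟩ := hWE.liftProp K (fun l => T (1, l))
    (T.comp ⟨fun l => (1, l), by fun_prop⟩) (by fun_prop)
    (fun l hl => ⟨hTB 1 l hl, (hTk _).trans (hke l)⟩)
    (fun l => ⟨hTA' _, (hTk _).trans (hke l)⟩) (fun l _ => rfl)
  -- The compressed face is transported back from z to v(1, ·), now within B.
  obtain ⟨T', hT'0, hT'b, hT'B⟩ := (boxExt_pathLifts (K := K) f B
    (k.comp ⟨fun p => (σ p.1, p.2), by fun_prop⟩) (fun p => hkB _)).fill w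
      (fun p => T (σ p.1, p.2)) (by fun_prop) (fun l hl => by simp [hw l hl])
      (fun l => ⟨(hwB l).1, by simp [(hwB l).2, hke]⟩)
      (fun s l hl => ⟨hTB _ l hl, hTk _⟩)
  -- Transporting the homotopy `κ` back too yields, over v(1, ·), a homotopy between the new and the
  -- old face.
  obtain ⟨R, hR0, hR1, hR2, hRb, hRA⟩ := (boxExt_pathLifts (K := I × K) f A
    (k.comp ⟨fun p => (σ p.1, p.2.2), by fun_prop⟩) (fun p => hBA (hkB _))).fill₂ κ T'
      (T.comp ⟨fun p => (σ p.1, p.2), by fun_prop⟩) (fun p => T (σ p.1, p.2.2)) (by fun_prop)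
      (fun l => by simp [hT'0, hκ0]) (fun l => by simp [hκ1])
      (fun t l hl => by simp [hκb t l hl]) (fun s l hl => by simp [hT'b s l hl])
      (fun s l hl => rfl) (fun p => ⟨(hκA p).1, by simp [(hκA p).2, hke]⟩)
      (fun s l => ⟨pathLifts_mono hBA (hT'B _).1, (hT'B _).2⟩)
      (fun s l => ⟨hTA' _, hTk _⟩) (fun s t l hl => ⟨hTA' _, hTk _⟩)
  -- That homotopy is inserted as a collar at the face 1 of `w₀`, without changing the rest of the
  -- box.
  obtain ⟨G, hG0, hG1, hG2, hGb, hGA⟩ := (boxExt_pathLifts (K := I × K) f A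
    (v.comp ⟨fun p => p.2, by fun_prop⟩) (fun p => hvA _)).fill₂ w₀
      (w₀.comp ⟨fun p => (0, p.2), by fun_prop⟩)
      (R.comp ⟨fun p => (1, (σ p.1, p.2)), by fun_prop⟩) (fun p => w₀ p.2) (by fun_prop)
      (fun l => rfl) (fun l => by simp [hR2, hT0, e]) (fun t l hl => rfl) (fun s l hl => rfl)
      (fun s l hl => by simp [hRb 1 (σ s) l hl, hT0, e]) (fun p => hw0A p)
      (fun s l => hw0A _)
      (fun s l => ⟨(hRA _).1, by simp [(hRA (1, (σ s, l))).2, hks]⟩)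
      (fun s t l hl => hw0A _)
  refine ⟨G.comp ⟨fun p => (1, p), by fun_prop⟩, ?_, fun p => hGA _, fun l => ?_⟩
  · rintro ⟨t, l⟩ hp
    rw [← hw0 _ hp]
    rcases hp with rfl | hl
    · exact hG1 1 l
    · exact hGb 1 t l hl
  · have : G (1, (1, l)) = R (1, (0, l)) := by simp [hG2]
    simp only [ContinuousMap.comp_apply, ContinuousMap.coe_mk, this, hR1]
    exact (hT'B _).1

/-- The notion of a c-distinguished subset in terms of homotopy fibres. -/
structure IsGood (f : C(X, Y)) (A S : Set Y) : Prop where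
  subset : S ⊆ A
  exhaustive : ∀ y ∈ A, ∃ z ∈ S, JoinedIn A y z
  fiberEquiv : ∀ b ∈ S, FiberEquiv f A b

theorem IsGood.relLift {f : C(X, Y)} {A B S S' : Set Y} (hB : IsGood f B S') (hA : IsGood f A S)
    (hBA : B ⊆ A) (hS : S' ⊆ S) : RelLift f B A := by
  intro K _ _ v u
  obtain ⟨n, ε, -⟩ := CubeSpace.exists_homeo (K := K)
  have : Nonempty (X × C(I, Y)) := ⟨u (0, ε.symm 0)⟩
  refine relLift_of_WE f hBA (fun y hy => ?_) K v u
  obtain ⟨z, hz, hyz⟩ := hB.exhaustive y hy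
  -- Two out of three for the inclusions of the fibre over z into the homotopy fibres over B and
  -- over A.
  refine ⟨z, hyz, WE.of_comp (i := ContinuousMap.id (X × C(I, Y)))
    (fun a ha => hoFiber_mono (by simpa using hB.subset hz) z ha) (fun a ha => hoFiber_mono hBA z ha)
    (hB.fiberEquiv z hz) (hA.fiberEquiv z (hS hz))⟩

theorem FiberEquiv.relLift {f : C(X, Y)} {A : Set Y} {b : Y} (hb : b ∈ A) (h : FiberEquiv f A b) :
    RelLift f {b} A :=
  relLift_of_WE f (by simpa using hb) fun y hy => ⟨b, by
    obtain rfl : y = b := hy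
    exact JoinedIn.refl rfl, h⟩

end PathLifts

/-! ### Subdivision of cubes -/

instance CubeSpace.prodCube (K K' : Type) [TopologicalSpace K] [CubeSpace K] [TopologicalSpace K']
    [CubeSpace K'] : CubeSpace (K × K') where
  boundary := {p | p.1 ∈ bd K ∨ p.2 ∈ bd K'}
  exists_homeo := by
    obtain ⟨n, e, he⟩ := CubeSpace.exists_homeo (K := K)
    obtain ⟨m, e', he'⟩ := CubeSpace.exists_homeo (K := K')
    refine ⟨n + m, (e.prodCongr e').trans (Fin.appendHomeomorph n m), fun p => ?_⟩
    simp only [Set.mem_ofPred_eq, he, he', Cube.boundary, Homeomorph.trans_apply]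
    constructor
    · rintro (⟨i, hi⟩ | ⟨i, hi⟩)
      · exact ⟨Fin.castAdd m i, by simpa using hi⟩
      · exact ⟨Fin.natAdd n i, by simpa using hi⟩
    · rintro ⟨i, hi⟩
      induction i using Fin.addCases with
      | left i => exact Or.inl ⟨i, by simpa using hi⟩
      | right i => exact Or.inr ⟨i, by simpa using hi⟩

/-- The smallest cell of the dyadic subdivision of depth `p` of the interval which contains a
point. -/
def dyadicCell : ℕ → I → Set I
  | 0, r => {t | (r = 0 → t = 0) ∧ (r = 1 → t = 1)}
  | p + 1, r => {t | (∀ r', r = lowerHalf r' → t ∈ lowerHalf '' dyadicCell p r') ∧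
      ∀ r', r = upperHalf r' → t ∈ upperHalf '' dyadicCell p r'}

theorem lowerHalf_injective : Function.Injective lowerHalf := fun a b h => by
  have := congrArg Subtype.val h
  simp only [lowerHalf] at this
  exact Subtype.ext (by linarith)

theorem upperHalf_injective : Function.Injective upperHalf := fun a b h => by
  have := congrArg Subtype.val h
  simp only [upperHalf] at this
  exact Subtype.ext (by linarith)

theorem lowerHalf_eq_upperHalf {a b : I} (h : lowerHalf a = upperHalf b) : a = 1 ∧ b = 0 := by
  have := congrArg Subtype.val h
  simp only [lowerHalf, upperHalf] at this
  have h1 := a.2.2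
  have h2 := b.2.1
  exact ⟨Subtype.ext (le_antisymm h1 (show (1 : ℝ) ≤ a by linarith)),
    Subtype.ext (le_antisymm (show (b : ℝ) ≤ 0 by linarith) h2)⟩

/-- This makes the two clauses of the recursion agree at the midpoint, the only point lying in both
halves. -/
theorem dyadicCell_zero_one (p : ℕ) : dyadicCell p 0 = {0} ∧ dyadicCell p 1 = {1} := by
  induction p with
  | zero => constructor <;> ext t <;> simp [dyadicCell]
  | succ p ih =>
    constructor
    · ext t
      constructor
      · rintro ⟨h, -⟩
        have := h 0 lowerHalf_zero.symm
        rw [ih.1] at this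
        simpa using this
      · rintro rfl
        refine ⟨fun r' hr => ?_, fun r' hr => ?_⟩
        · rw [← lowerHalf_zero] at hr
          rw [← lowerHalf_injective hr, ih.1]
          simp
        · rw [← lowerHalf_zero] at hr
          exact absurd (lowerHalf_eq_upperHalf hr).1 (by simp)
    · ext t
      constructor
      · rintro ⟨-, h⟩
        have := h 1 upperHalf_one.symm
        rw [ih.2] at this
        simpa using this
      · rintro rfl
        refine ⟨fun r' hr => ?_, fun r' hr => ?_⟩
        · rw [← upperHalf_one] at hr
          exact absurd (lowerHalf_eq_upperHalf hr.symm).2 (by simp)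
        · rw [← upperHalf_one] at hr
          rw [← upperHalf_injective hr, ih.2]
          simp

theorem dyadicCell_lowerHalf (p : ℕ) (r : I) :
    dyadicCell (p + 1) (lowerHalf r) = lowerHalf '' dyadicCell p r := by
  ext t
  refine ⟨fun h => h.1 r rfl, fun h => ⟨fun r' hr => ?_, fun r' hr => ?_⟩⟩
  · rwa [← lowerHalf_injective hr]
  · obtain ⟨rfl, rfl⟩ := lowerHalf_eq_upperHalf hr
    rw [(dyadicCell_zero_one p).2] at h
    rw [(dyadicCell_zero_one p).1]
    simpa [lowerHalf_one] using h

theorem dyadicCell_upperHalf (p : ℕ) (r : I) :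
    dyadicCell (p + 1) (upperHalf r) = upperHalf '' dyadicCell p r := by
  ext t
  refine ⟨fun h => h.2 r rfl, fun h => ⟨fun r' hr => ?_, fun r' hr => ?_⟩⟩
  · obtain ⟨rfl, rfl⟩ := lowerHalf_eq_upperHalf hr.symm
    rw [(dyadicCell_zero_one p).1] at h
    rw [(dyadicCell_zero_one p).2]
    simpa [lowerHalf_one] using h
  · rwa [← upperHalf_injective hr]

theorem mem_dyadicCell_self (p : ℕ) (r : I) : r ∈ dyadicCell p r := by
  induction p generalizing r with
  | zero => exact ⟨id, id⟩
  | succ p ih =>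
    rcases exists_half r with ⟨t, rfl⟩ | ⟨t, rfl⟩
    · rw [dyadicCell_lowerHalf]; exact ⟨t, ih t, rfl⟩
    · rw [dyadicCell_upperHalf]; exact ⟨t, ih t, rfl⟩

theorem dist_le_of_mem_dyadicCell (p : ℕ) {r t : I} (h : t ∈ dyadicCell p r) :
    dist t r ≤ (1 / 2) ^ p := by
  induction p generalizing r t with
  | zero =>
    rw [Subtype.dist_eq, Real.dist_eq, pow_zero, abs_le]
    have := t.2.1; have := t.2.2; have := r.2.1; have := r.2.2
    constructor <;> linarith
  | succ p ih =>
    have key : ∀ a b : I, dist a b ≤ (1 / 2) ^ p → |(a : ℝ) - b| / 2 ≤ (1 / 2) ^ (p + 1) := by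
      intro a b hab
      rw [Subtype.dist_eq, Real.dist_eq] at hab
      rw [pow_succ]
      linarith
    rcases exists_half r with ⟨r, rfl⟩ | ⟨r, rfl⟩
    · rw [dyadicCell_lowerHalf] at h
      obtain ⟨t, ht, rfl⟩ := h
      refine le_trans (le_of_eq ?_) (key t r (ih ht))
      rw [Subtype.dist_eq, Real.dist_eq]
      simp only [lowerHalf]
      rw [← sub_div, abs_div, abs_two]
    · rw [dyadicCell_upperHalf] at h
      obtain ⟨t, ht, rfl⟩ := h
      refine le_trans (le_of_eq ?_) (key t r (ih ht))
      rw [Subtype.dist_eq, Real.dist_eq]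
      simp only [upperHalf]
      rw [← sub_div, abs_div, abs_two, add_sub_add_left_eq_sub]

/-! ### Cutting box extension problems along a coordinate. -/

section BoxExt
variable {Z : Type*} [TopologicalSpace Z] {K : Type} [TopologicalSpace K] [CubeSpace K]

theorem BoxExt.of_homeo {K' : Type} [TopologicalSpace K'] [CubeSpace K'] (e : K ≃ₜ K')
    (he : ∀ k, k ∈ bd K ↔ e k ∈ bd K') {S : I × K' → Set Z}
    (h : BoxExt K fun p => S (p.1, e p.2)) : BoxExt K' S := by
  have he' : ∀ k, k ∈ bd K' ↔ e.symm k ∈ bd K := fun k => by rw [he, e.apply_symm_apply]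
  intro g hg hgS
  have hc : Continuous fun p : I × K => ((p.1, e p.2) : I × K') :=
    continuous_fst.prodMk (e.continuous.comp continuous_snd)
  have hc' : Continuous fun p : I × K' => ((p.1, e.symm p.2) : I × K) :=
    continuous_fst.prodMk (e.symm.continuous.comp continuous_snd)
  obtain ⟨G, hG, hGS⟩ := h (fun p => g (p.1, e p.2))
    (hg.comp hc.continuousOn fun p hp => by
      rcases hp with hp | hp
      exacts [Or.inl hp, Or.inr ((he _).1 hp)])
    (fun p hp => hgS _ (by rwa [he] at hp))
  refine ⟨G.comp ⟨_, hc'⟩, fun p hp => ?_, fun p => ?_⟩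
  · have := hG (p.1, e.symm p.2) (by rwa [he'] at hp)
    simpa using this
  · simpa using hGS (p.1, e.symm p.2)

/-- In the filling direction the halves are filled one after the other, the top of the first being
the floor of the second. -/
theorem BoxExt.split_fst {S : I × K → Set Z} (h₁ : BoxExt K fun p => S (lowerHalf p.1, p.2))
    (h₂ : BoxExt K fun p => S (upperHalf p.1, p.2)) : BoxExt K S := by
  intro g hg hgS
  have hg0 : Continuous fun k => g (0, k) := by
    rw [← continuousOn_univ]
    exact hg.comp (by fun_prop) fun p _ => Or.inl rfl
  obtain ⟨G₁, h10, h1b, h1S⟩ := h₁.fill ⟨_, hg0⟩ (fun p => g (lowerHalf p.1, p.2))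
    (hg.comp (by fun_prop) fun p hp => Or.inr hp) (fun k hk => by simp)
    (fun k => by simpa using hgS _ (Or.inl rfl)) (fun s k hk => hgS _ (Or.inr hk))
  obtain ⟨G₂, h20, h2b, h2S⟩ := h₂.fill (G₁.comp ⟨fun k => (1, k), by fun_prop⟩)
    (fun p => g (upperHalf p.1, p.2))
    (hg.comp (by fun_prop) fun p hp => Or.inr hp)
    (fun k hk => by simp [h1b 1 k hk, lowerHalf_one])
    (fun k => by simpa [lowerHalf_one] using h1S (1, k)) (fun s k hk => hgS _ (Or.inr hk))
  obtain ⟨H, hH1, hH2⟩ := exists_concat G₁ G₂ (fun k => by simp [h20])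
  refine ⟨H, ?_, ?_⟩
  · rintro ⟨s, k⟩ (rfl | hk)
    · have := hH1 0 k
      rw [lowerHalf_zero] at this
      rw [this, h10]
      rfl
    · rcases exists_half s with ⟨t, rfl⟩ | ⟨t, rfl⟩
      · rw [hH1, h1b t k hk]
      · rw [hH2, h2b t k hk]
  · rintro ⟨s, k⟩
    rcases exists_half s with ⟨t, rfl⟩ | ⟨t, rfl⟩
    · rw [hH1]; exact h1S (t, k)
    · rw [hH2]; exact h2S (t, k)

/-- In a side direction the wall between the halves is filled beforehand; it then serves as a side
face of both. -/
theorem BoxExt.split_snd {S : I × (I × K) → Set Z}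
    (h₀ : BoxExt K fun p => S (p.1, (lowerHalf 1, p.2)))
    (h₁ : BoxExt (I × K) fun p => S (p.1, (lowerHalf p.2.1, p.2.2)))
    (h₂ : BoxExt (I × K) fun p => S (p.1, (upperHalf p.2.1, p.2.2))) : BoxExt (I × K) S := by
  intro g hg hgS
  have c1 : ∀ φ : I → I, Continuous φ → Continuous fun p : I × K => g (0, (φ p.1, p.2)) := by
    intro φ hφ
    rw [← continuousOn_univ]
    exact hg.comp (by fun_prop) fun p _ => Or.inl rfl
  have c2 : ∀ t : I, t = 0 ∨ t = 1 → Continuous fun p : I × K => g (p.1, (t, p.2)) := by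
    intro t ht
    rw [← continuousOn_univ]
    exact hg.comp (by fun_prop) fun p _ => Or.inr (or_assoc.1 (Or.inl ht))
  have c3 : ∀ φ : I → I, Continuous φ →
      ContinuousOn (fun p : I × (I × K) => g (p.1, (φ p.2.1, p.2.2))) {p | p.2.2 ∈ bd K} := by
    intro φ hφ
    exact hg.comp (by fun_prop) fun p hp => Or.inr (Or.inr (Or.inr hp))
  have m0 : ∀ p, g (0, p) ∈ S (0, p) := fun p => hgS _ (Or.inl rfl)
  have mb : ∀ s t, ∀ k ∈ bd K, g (s, (t, k)) ∈ S (s, (t, k)) := fun s t k hk =>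
    hgS _ (Or.inr (Or.inr (Or.inr hk)))
  obtain ⟨M, hM0, hMb, hMS⟩ := h₀.fill
    (⟨fun k => g (0, (lowerHalf 1, k)), (c1 (fun _ => lowerHalf 1) continuous_const).comp
      (by fun_prop : Continuous fun k : K => ((0 : I), k))⟩)
    (fun p => g (p.1, (lowerHalf 1, p.2)))
    (hg.comp (by fun_prop) fun p hp => Or.inr (Or.inr (Or.inr hp)))
    (fun k hk => rfl) (fun k => m0 _) (fun s k hk => mb _ _ _ hk)
  obtain ⟨G₁, a1, a2, a3, a4, a5⟩ := h₁.fill₂ ⟨_, c1 lowerHalf continuous_lowerHalf⟩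
    ⟨_, c2 0 (Or.inl rfl)⟩ M _ (c3 lowerHalf continuous_lowerHalf) (fun k => by simp)
    (fun k => by simp [hM0]) (fun t k hk => rfl) (fun s k hk => by simp)
    (fun s k hk => (hMb s k hk).symm) (fun p => m0 _)
    (fun s k => by simpa using hgS _ (Or.inr (Or.inl rfl))) (fun s k => hMS (s, k))
    (fun s t k hk => mb _ _ _ hk)
  obtain ⟨G₂, b1, b2, b3, b4, b5⟩ := h₂.fill₂ ⟨_, c1 upperHalf continuous_upperHalf⟩
    M ⟨_, c2 1 (Or.inr rfl)⟩ _ (c3 upperHalf continuous_upperHalf)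
    (fun k => by simp [hM0, lowerHalf_one])
    (fun k => by simp) (fun t k hk => rfl)
    (fun s k hk => by simpa [lowerHalf_one] using (hMb s k hk).symm)
    (fun s k hk => by simp) (fun p => m0 _)
    (fun s k => by simpa [lowerHalf_one] using hMS (s, k))
    (fun s k => by simpa using hgS _ (Or.inr (Or.inr (Or.inl rfl))))
    (fun s t k hk => mb _ _ _ hk)
  obtain ⟨H, hH1, hH2⟩ := exists_concat (L := I × K)
    (G₁.comp ⟨fun p => (p.2.1, (p.1, p.2.2)), by fun_prop⟩)
    (G₂.comp ⟨fun p => (p.2.1, (p.1, p.2.2)), by fun_prop⟩) (fun l => by simp [a3, b2])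
  refine ⟨H.comp ⟨fun p => (p.2.1, (p.1, p.2.2)), by fun_prop⟩, ?_, ?_⟩
  · rintro ⟨s, t, k⟩ hp
    simp only [ContinuousMap.comp_apply, ContinuousMap.coe_mk]
    rcases exists_half t with ⟨t, rfl⟩ | ⟨t, rfl⟩
    · rw [hH1]
      simp only [ContinuousMap.comp_apply, ContinuousMap.coe_mk]
      rcases hp with rfl | hp | hp | hk
      · rw [a1]; rfl
      · have : t = 0 := lowerHalf_injective (by simpa using hp)
        subst this
        rw [a2]; simp
      · rw [← upperHalf_one] at hp
        exact absurd (lowerHalf_eq_upperHalf hp).2 (by simp)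
      · rw [a4 _ _ _ hk]
    · rw [hH2]
      simp only [ContinuousMap.comp_apply, ContinuousMap.coe_mk]
      rcases hp with rfl | hp | hp | hk
      · rw [b1]; rfl
      · rw [← lowerHalf_zero] at hp
        exact absurd (lowerHalf_eq_upperHalf hp.symm).1 (by simp)
      · have : t = 1 := upperHalf_injective (by simpa using hp)
        subst this
        rw [b3]; simp
      · rw [b4 _ _ _ hk]
  · rintro ⟨s, t, k⟩
    simp only [ContinuousMap.comp_apply, ContinuousMap.coe_mk]
    rcases exists_half t with ⟨t, rfl⟩ | ⟨t, rfl⟩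
    · rw [hH1]; exact a5 (s, (t, k))
    · rw [hH2]; exact b5 (s, (t, k))

end BoxExt

/-! ### Lifting over a subdivided cube -/

section Subdivision
variable {X : Type u} {Y : Type v} [TopologicalSpace X] [TopologicalSpace Y]

/-- The points of the cell of the dyadic subdivision of the cube, of the given depths, which
contains `q` in its interior. -/
def dyadicCells {m : ℕ} (p : Fin m → ℕ) (q : Fin m → I) : Set (Fin m → I) :=
  {q' | ∀ i, q' i ∈ dyadicCell (p i) (q i)}

/-- A rule which assigns to subsets of a family of small sets larger subsets for which relative
lifting is possible. -/
structure LiftRule (f : C(X, Y)) (small : Set Y → Prop) (N : Set Y → Set Y) : Prop where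
  small_mono : ∀ {Q Q' : Set Y}, Q' ⊆ Q → small Q → small Q'
  mono : ∀ {Q Q' : Set Y}, Q' ⊆ Q → small Q → N Q' ⊆ N Q
  subset : ∀ {Q : Set Y}, small Q → Q ⊆ N Q
  relLift : ∀ {Q Q' : Set Y}, Q' ⊆ Q → small Q → RelLift f (N Q') (N Q)

variable {f : C(X, Y)} {small : Set Y → Prop} {N : Set Y → Set Y}

/-- A single cell: `RelLift` handles the interior and the end face, where a smaller set is
prescribed. Over `bd K` the map is given, so there `s` may be any smaller set; this leaves room for
the smaller cells met on the boundary. -/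
theorem LiftRule.boxExt_of_small (hN : LiftRule f small N) {K : Type} [TopologicalSpace K]
    [CubeSpace K] (v : C(I × K, Y)) (s : I × K → Set Y) (hs : small (Set.range v))
    (h1 : ∀ τ, ∀ k, k ∉ bd K → s (τ, k) = N (v '' (dyadicCell 0 τ ×ˢ Set.univ)))
    (h2 : ∀ τ, ∀ k ∈ bd K, s (τ, k) ⊆ N (v '' (dyadicCell 0 τ ×ˢ Set.univ))) :
    BoxExt K fun p => {z : X × C(I, Y) | z ∈ pathLifts f (s p) ∧ z.2 1 = v p} := by
  have hsub : ∀ p, s p ⊆ N (v '' (dyadicCell 0 p.1 ×ˢ Set.univ)) := by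
    rintro ⟨τ, k⟩
    by_cases hk : k ∈ bd K
    · exact h2 τ k hk
    · exact (h1 τ k hk).le
  have hsub' : ∀ p, s p ⊆ N (Set.range v) := fun p =>
    (hsub p).trans (hN.mono (Set.image_subset_range _ _) hs)
  intro g hg hgS
  obtain ⟨w, hw, hwA, hwB⟩ := hN.relLift
    (Set.image_subset_range v (dyadicCell 0 1 ×ˢ Set.univ)) hs K v g hg
    (fun p => hN.subset hs ⟨p, rfl⟩)
    (fun k => hN.subset (hN.small_mono (Set.image_subset_range _ _) hs)
      ⟨(1, k), ⟨mem_dyadicCell_self 0 1, trivial⟩, rfl⟩)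
    (fun p hp => ⟨pathLifts_mono (hsub' p) (hgS p hp).1, (hgS p hp).2⟩)
    (fun k hk => pathLifts_mono (hsub (1, k)) (hgS _ (Or.inr hk)).1)
  refine ⟨w, hw, fun p => ?_⟩
  by_cases hp : p.1 = 0 ∨ p.2 ∈ bd K
  · rw [hw p hp]; exact hgS p hp
  · refine ⟨?_, (hwA p).2⟩
    obtain ⟨τ, k⟩ := p
    simp only [not_or] at hp
    rw [h1 τ k hp.2]
    by_cases hτ : τ = 1
    · subst hτ; exact hwB k
    · have : dyadicCell 0 τ = Set.univ := by
        ext t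
        simp [dyadicCell, hp.1, hτ]
      rw [this, Set.univ_prod_univ, Set.image_univ]
      exact (hwA _).1

/-- Rearrangement of the coordinates of a cube. -/
def shuffleHomeo (m : ℕ) (K : Type) [TopologicalSpace K] :
    (Fin m → I) × (I × K) ≃ₜ (Fin (m + 1) → I) × K where
  toFun p := (Fin.cons p.2.1 p.1, p.2.2)
  invFun p := (Fin.tail p.1, (p.1 0, p.2))
  left_inv p := by simp
  right_inv p := by simp
  continuous_toFun := (Continuous.finCons (by fun_prop) (by fun_prop)).prodMk (by fun_prop)
  continuous_invFun := by unfold Fin.tail; fun_prop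

/-- Rearrangement of the coordinates of a cube. -/
def shuffleHomeo' (m : ℕ) (K : Type) [TopologicalSpace K] :
    I × ((Fin m → I) × K) ≃ₜ (Fin (m + 1) → I) × K where
  toFun p := (Fin.cons p.1 p.2.1, p.2.2)
  invFun p := (p.1 0, (Fin.tail p.1, p.2))
  left_inv p := by simp
  right_inv p := by simp
  continuous_toFun := (Continuous.finCons (by fun_prop) (by fun_prop)).prodMk (by fun_prop)
  continuous_invFun := by unfold Fin.tail; fun_prop

theorem mem_bd_prodCube {K K' : Type} [TopologicalSpace K] [CubeSpace K] [TopologicalSpace K']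
    [CubeSpace K'] {p : K × K'} : p ∈ bd (K × K') ↔ p.1 ∈ bd K ∨ p.2 ∈ bd K' := Iff.rfl

theorem mem_bd_pi {m : ℕ} {q : Fin m → I} : q ∈ bd (Fin m → I) ↔ ∃ i, q i = 0 ∨ q i = 1 := Iff.rfl

theorem cons_mem_bd_pi {m : ℕ} {t : I} {q : Fin m → I} :
    (Fin.cons t q : Fin (m + 1) → I) ∈ bd (Fin (m + 1) → I) ↔
      t = 0 ∨ t = 1 ∨ q ∈ bd (Fin m → I) :=
  cubeCons_mem_boundary m (t, q)

theorem mem_dyadicCells_succ {m : ℕ} {p : Fin (m + 1) → ℕ} {q q' : Fin (m + 1) → I} :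
    q' ∈ dyadicCells p q ↔ q' 0 ∈ dyadicCell (p 0) (q 0) ∧
      Fin.tail q' ∈ dyadicCells (Fin.tail p) (Fin.tail q) := by
  simp only [dyadicCells, Set.mem_ofPred_eq, Fin.forall_fin_succ, Fin.tail]

/-- Induction on the number of subdivided coordinates and on the depth of the first. Positive depth
is halved by `BoxExt.split_snd`; a coordinate of depth zero is absorbed into `K`. The cells then
recorded ignore that coordinate, so at its ends they are too large, which is why only an inclusion
is required over `bd K`. -/
theorem LiftRule.boxExt_of_cells (hN : LiftRule f small N) (m : ℕ) :
    ∀ (p : Fin m → ℕ) (K : Type) [TopologicalSpace K] [CubeSpace K]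
      (v : C(I × ((Fin m → I) × K), Y)) (s : I × ((Fin m → I) × K) → Set Y),
      (∀ q, small (v '' (Set.univ ×ˢ (dyadicCells p q ×ˢ Set.univ)))) →
      (∀ τ q, ∀ k, k ∉ bd K →
        s (τ, (q, k)) = N (v '' (dyadicCell 0 τ ×ˢ (dyadicCells p q ×ˢ Set.univ)))) →
      (∀ τ q, ∀ k ∈ bd K,
        s (τ, (q, k)) ⊆ N (v '' (dyadicCell 0 τ ×ˢ (dyadicCells p q ×ˢ Set.univ)))) →
      BoxExt ((Fin m → I) × K)
        fun p => {z : X × C(I, Y) | z ∈ pathLifts f (s p) ∧ z.2 1 = v p} := by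
  induction m with
  | zero =>
    intro p K _ _ v s hs h1 h2
    have hc : ∀ q, dyadicCells p q = Set.univ := fun q => by
      ext q'
      simp [dyadicCells]
    refine hN.boxExt_of_small v s ?_ ?_ ?_
    · have := hs 0
      rwa [hc, Set.univ_prod_univ, Set.univ_prod_univ, Set.image_univ] at this
    · rintro τ ⟨q, k⟩ hk
      rw [h1 τ q k (fun h => hk (Or.inr h)), hc, Set.univ_prod_univ]
    · rintro τ ⟨q, k⟩ hk
      have hk' : k ∈ bd K := by
        rcases hk with ⟨i, -⟩ | hk
        exacts [i.elim0, hk]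
      have := h2 τ q k hk'
      rwa [hc, Set.univ_prod_univ] at this
  | succ m ih =>
    intro p
    obtain ⟨P, hP⟩ : ∃ P, P = p 0 := ⟨_, rfl⟩
    induction P generalizing p with
    | zero =>
      intro K _ _ v s hs h1 h2
      have hsub : ∀ (T : Set I) (t : I) (q : Fin m → I),
          v '' (T ×ˢ (dyadicCells p (Fin.cons t q) ×ˢ Set.univ)) ⊆
            v.comp ⟨fun x => (x.1, shuffleHomeo m K x.2), by fun_prop⟩ ''
              (T ×ˢ (dyadicCells (Fin.tail p) q ×ˢ Set.univ)) := by
        rintro T t q _ ⟨⟨a, b, c⟩, ⟨ha, hb, -⟩, rfl⟩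
        refine ⟨(a, (Fin.tail b, (b 0, c))), ⟨ha, ?_, trivial⟩, ?_⟩
        · simpa using (mem_dyadicCells_succ.1 hb).2
        · simp [shuffleHomeo]
      have heq : ∀ (T : Set I) (t : I) (q : Fin m → I), t ≠ 0 → t ≠ 1 →
          v '' (T ×ˢ (dyadicCells p (Fin.cons t q) ×ˢ Set.univ)) =
            v.comp ⟨fun x => (x.1, shuffleHomeo m K x.2), by fun_prop⟩ ''
              (T ×ˢ (dyadicCells (Fin.tail p) q ×ˢ Set.univ)) := by
        intro T t q ht0 ht1
        refine (hsub T t q).antisymm ?_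
        rintro _ ⟨⟨a, b, c, d⟩, ⟨ha, hb, -⟩, rfl⟩
        refine ⟨(a, (Fin.cons c b, d)), ⟨ha, ?_, trivial⟩, rfl⟩
        refine mem_dyadicCells_succ.2 ⟨?_, by simpa using hb⟩
        rw [← hP]
        simp [dyadicCell, ht0, ht1]
      have hsm : ∀ q, small (v.comp ⟨fun x => (x.1, shuffleHomeo m K x.2), by fun_prop⟩ ''
          (Set.univ ×ˢ (dyadicCells (Fin.tail p) q ×ˢ (Set.univ : Set (I × K))))) := fun q => by
        -- At depth zero any interior point has the whole interval as its cell.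
        rw [← heq _ ⟨1 / 2, by norm_num, by norm_num⟩ q
          (fun h => by simpa using congrArg Subtype.val h)
          (fun h => by have := congrArg Subtype.val h; norm_num at this)]
        exact hs _
      refine BoxExt.of_homeo (shuffleHomeo m K) ?_ (ih (Fin.tail p) (I × K)
        (v.comp ⟨fun x => (x.1, shuffleHomeo m K x.2), by fun_prop⟩)
        (fun x => s (x.1, shuffleHomeo m K x.2)) hsm ?_ ?_)
      · rintro ⟨q, t, k⟩
        change _ ↔ (Fin.cons t q, k) ∈ bd ((Fin (m + 1) → I) × K)
        rw [mem_bd_prodCube, mem_bd_prodCube, cons_mem_bd_pi, mk_mem_bd_prod]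
        tauto
      · rintro τ q ⟨t, k⟩ hk
        simp only [mk_mem_bd_prod, not_or] at hk
        exact (h1 τ _ k hk.2.2).trans (congrArg N (heq _ t q hk.1 hk.2.1))
      · rintro τ q ⟨t, k⟩ hk
        have hle : s (τ, (Fin.cons t q, k)) ⊆
            N (v '' (dyadicCell 0 τ ×ˢ (dyadicCells p (Fin.cons t q) ×ˢ Set.univ))) := by
          by_cases hk' : k ∈ bd K
          · exact h2 _ _ _ hk'
          · exact (h1 _ _ _ hk').le
        refine hle.trans (hN.mono (hsub _ t q) (hN.small_mono ?_ (hsm q)))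
        exact Set.image_mono (Set.prod_mono (Set.subset_univ _) le_rfl)
    | succ P ihP =>
      intro K _ _ v s hs h1 h2
      let e : I → C(I × ((Fin m → I) × K), I × ((Fin (m + 1) → I) × K)) := fun t =>
        ⟨fun x => (x.1, shuffleHomeo' m K (t, x.2)), by fun_prop⟩
      let e' : C(I, I) → C(I × ((Fin (m + 1) → I) × K), I × ((Fin (m + 1) → I) × K)) := fun φ =>
        ⟨fun x => (x.1, shuffleHomeo' m K (φ (x.2.1 0), (Fin.tail x.2.1, x.2.2))), by
          unfold Fin.tail; fun_prop⟩
      have key : ∀ (T : Set I) (q : Fin m → I),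
          v '' (T ×ˢ (dyadicCells p (Fin.cons (lowerHalf 1) q) ×ˢ Set.univ)) =
            v.comp (e (lowerHalf 1)) '' (T ×ˢ (dyadicCells (Fin.tail p) q ×ˢ Set.univ)) := by
        intro T q
        ext y
        constructor
        · rintro ⟨⟨a, b, c⟩, ⟨ha, hb, -⟩, rfl⟩
          have hb' := mem_dyadicCells_succ.1 hb
          simp only [← hP, Fin.cons_zero, Fin.tail_cons, dyadicCell_lowerHalf,
            (dyadicCell_zero_one P).2, Set.image_singleton, Set.mem_singleton_iff] at hb'
          refine ⟨(a, (Fin.tail b, c)), ⟨ha, hb'.2, trivial⟩, ?_⟩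
          simp only [e, shuffleHomeo', ContinuousMap.comp_apply, ContinuousMap.coe_mk,
            Homeomorph.homeomorph_mk_coe, Equiv.coe_fn_mk, ← hb'.1, Fin.cons_self_tail]
        · rintro ⟨⟨a, b, c⟩, ⟨ha, hb, -⟩, rfl⟩
          refine ⟨(a, (Fin.cons (lowerHalf 1) b, c)), ⟨ha, ?_, trivial⟩, rfl⟩
          refine mem_dyadicCells_succ.2 ⟨?_, by simpa using hb⟩
          exact mem_dyadicCell_self _ _
      -- Within either half the first coordinate is subdivided one level less.
      let p' : Fin (m + 1) → ℕ := Fin.cons P (Fin.tail p)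
      have key' : ∀ φ : C(I, I), (∀ r, dyadicCell (P + 1) (φ r) = φ '' dyadicCell P r) →
          ∀ (T : Set I) (q : Fin (m + 1) → I),
          v '' (T ×ˢ (dyadicCells p (Fin.cons (φ (q 0)) (Fin.tail q)) ×ˢ Set.univ)) =
            v.comp (e' φ) '' (T ×ˢ (dyadicCells p' q ×ˢ Set.univ)) := by
        intro φ hφ T q
        ext y
        constructor
        · rintro ⟨⟨a, b, c⟩, ⟨ha, hb, -⟩, rfl⟩
          have hb' := mem_dyadicCells_succ.1 hb
          simp only [← hP, Fin.cons_zero, Fin.tail_cons, hφ] at hb'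
          obtain ⟨⟨r, hr, hrb⟩, hb2⟩ := hb'
          refine ⟨(a, (Fin.cons r (Fin.tail b), c)), ⟨ha, ?_, trivial⟩, ?_⟩
          · exact mem_dyadicCells_succ.2 ⟨by simpa [p'] using hr, by simpa [p'] using hb2⟩
          · simp only [e', shuffleHomeo', ContinuousMap.comp_apply, ContinuousMap.coe_mk,
              Homeomorph.homeomorph_mk_coe, Equiv.coe_fn_mk, Fin.cons_zero, Fin.tail_cons, hrb,
              Fin.cons_self_tail]
        · rintro ⟨⟨a, b, c⟩, ⟨ha, hb, -⟩, rfl⟩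
          have hb' := mem_dyadicCells_succ.1 hb
          refine ⟨(a, (Fin.cons (φ (b 0)) (Fin.tail b), c)), ⟨ha, ?_, trivial⟩, rfl⟩
          refine mem_dyadicCells_succ.2 ⟨?_, by simpa [p'] using hb'.2⟩
          rw [← hP]
          simp only [Fin.cons_zero, hφ]
          exact ⟨b 0, by simpa [p'] using hb'.1, rfl⟩
      have half : ∀ φ : C(I, I), (∀ r, dyadicCell (P + 1) (φ r) = φ '' dyadicCell P r) →
          BoxExt ((Fin (m + 1) → I) × K) fun x =>
            {z : X × C(I, Y) | z ∈ pathLifts f (s (e' φ x)) ∧ z.2 1 = v (e' φ x)} := by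
        intro φ hφ
        refine ihP p' rfl K (v.comp (e' φ)) (fun x => s (e' φ x)) ?_ ?_ ?_
        · intro q
          rw [← key' φ hφ]
          exact hs _
        · intro τ q k hk
          rw [← key' φ hφ]
          exact h1 _ _ _ hk
        · intro τ q k hk
          rw [← key' φ hφ]
          exact h2 _ _ _ hk
      have toProd : ∀ φ : C(I, I), (∀ r, dyadicCell (P + 1) (φ r) = φ '' dyadicCell P r) →
          BoxExt (I × ((Fin m → I) × K)) fun x => {z : X × C(I, Y) |
            z ∈ pathLifts f (s (x.1, shuffleHomeo' m K (φ x.2.1, x.2.2))) ∧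
              z.2 1 = v (x.1, shuffleHomeo' m K (φ x.2.1, x.2.2))} := by
        intro φ hφ
        refine BoxExt.of_homeo (shuffleHomeo' m K).symm ?_ (half φ hφ)
        intro x
        obtain ⟨⟨t, q, k⟩, rfl⟩ := (shuffleHomeo' m K).surjective x
        rw [Homeomorph.symm_apply_apply]
        change (Fin.cons t q, k) ∈ bd ((Fin (m + 1) → I) × K) ↔ _
        rw [mem_bd_prodCube, cons_mem_bd_pi, mk_mem_bd_prod, mem_bd_prodCube]
        tauto
      refine BoxExt.of_homeo (shuffleHomeo' m K) ?_ (BoxExt.split_snd ?_ ?_ ?_)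
      · rintro ⟨t, q, k⟩
        change _ ↔ (Fin.cons t q, k) ∈ bd ((Fin (m + 1) → I) × K)
        rw [mem_bd_prodCube, cons_mem_bd_pi, mk_mem_bd_prod, mem_bd_prodCube]
        tauto
      · refine ih (Fin.tail p) K (v.comp (e (lowerHalf 1))) (fun x => s (e (lowerHalf 1) x))
          ?_ ?_ ?_
        · intro q
          rw [← key]
          exact hs _
        · intro τ q k hk
          rw [← key]
          exact h1 _ _ _ hk
        · intro τ q k hk
          rw [← key]
          exact h2 _ _ _ hk
      · exact toProd ⟨lowerHalf, continuous_lowerHalf⟩ (dyadicCell_lowerHalf P)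
      · exact toProd ⟨upperHalf, continuous_upperHalf⟩ (dyadicCell_upperHalf P)

/-- Subdivision of the filling direction as well, by repeated use of `BoxExt.split_fst`. The factor
`Unit` is the initial, trivial unsubdivided cube. -/
theorem LiftRule.boxExt_of_cells_fst (hN : LiftRule f small N) {m : ℕ} (p : Fin m → ℕ) (P : ℕ) :
    ∀ (v : C(I × ((Fin m → I) × Unit), Y)),
      (∀ τ q, small (v '' (dyadicCell P τ ×ˢ (dyadicCells p q ×ˢ Set.univ)))) →
      BoxExt ((Fin m → I) × Unit) fun x => {z : X × C(I, Y) | z ∈ pathLifts f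
          (N (v '' (dyadicCell P x.1 ×ˢ (dyadicCells p x.2.1 ×ˢ Set.univ)))) ∧ z.2 1 = v x} := by
  induction P with
  | zero =>
    intro v hs
    refine hN.boxExt_of_cells m p Unit v _ (fun q => ?_) (fun τ q k _ => rfl)
      (fun τ q k _ => le_rfl)
    have : dyadicCell 0 ⟨1 / 2, by norm_num, by norm_num⟩ = Set.univ := by
      ext t
      simp only [dyadicCell, Set.mem_ofPred_eq, Set.mem_univ, iff_true]
      exact ⟨fun h => by simpa using congrArg Subtype.val h,
        fun h => by have := congrArg Subtype.val h; norm_num at this⟩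
    rw [← this]
    exact hs _ q
  | succ P ih =>
    intro v hs
    let e : C(I, I) → C(I × ((Fin m → I) × Unit), I × ((Fin m → I) × Unit)) := fun φ =>
      ⟨fun x => (φ x.1, x.2), by fun_prop⟩
    have key : ∀ φ : C(I, I), (∀ r, dyadicCell (P + 1) (φ r) = φ '' dyadicCell P r) →
        ∀ τ q, v '' (dyadicCell (P + 1) (φ τ) ×ˢ (dyadicCells p q ×ˢ Set.univ)) =
          v.comp (e φ) '' (dyadicCell P τ ×ˢ (dyadicCells p q ×ˢ Set.univ)) := by
      intro φ hφ τ q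
      rw [hφ]
      ext y
      constructor
      · rintro ⟨⟨_, b⟩, ⟨⟨a, ha, rfl⟩, hb⟩, rfl⟩
        exact ⟨(a, b), ⟨ha, hb⟩, rfl⟩
      · rintro ⟨⟨a, b⟩, ⟨ha, hb⟩, rfl⟩
        exact ⟨(φ a, b), ⟨⟨a, ha, rfl⟩, hb⟩, rfl⟩
    have half : ∀ φ : C(I, I), (∀ r, dyadicCell (P + 1) (φ r) = φ '' dyadicCell P r) →
        BoxExt ((Fin m → I) × Unit) fun x => {z : X × C(I, Y) | z ∈ pathLifts f
          (N (v '' (dyadicCell (P + 1) (φ x.1) ×ˢ (dyadicCells p x.2.1 ×ˢ Set.univ)))) ∧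
            z.2 1 = v (φ x.1, x.2)} := by
      intro φ hφ
      simp only [key φ hφ]
      refine ih (v.comp (e φ)) fun τ q => ?_
      rw [← key φ hφ]
      exact hs _ _
    exact BoxExt.split_fst (half ⟨lowerHalf, continuous_lowerHalf⟩ (dyadicCell_lowerHalf P))
      (half ⟨upperHalf, continuous_upperHalf⟩ (dyadicCell_upperHalf P))

end Subdivision

/-! ### Gluing over an open cover -/

section Cover
variable {X : Type u} {Y : Type v} [TopologicalSpace X] [TopologicalSpace Y] {f : C(X, Y)}

/-- The constant path lift over `W`. -/
def constPaths {L : Type*} [TopologicalSpace L] (f : C(X, Y)) (W : C(L, X)) :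
    C(L, X × C(I, Y)) :=
  toPaths W ⟨fun p => f (W p.2), by fun_prop⟩

theorem constPaths_fst {L : Type*} [TopologicalSpace L] (W : C(L, X)) (l : L) :
    (constPaths f W l).1 = W l := rfl

theorem constPaths_snd {L : Type*} [TopologicalSpace L] (W : C(L, X)) (l : L) (s : I) :
    (constPaths f W l).2 s = f (W l) := rfl

/-- Lifting of cubes with one face at `b` implies that the fibre over `b` is weakly equivalent to
the homotopy fibre. -/
theorem FiberEquiv.of_lift {T : Set Y} {b : Y} (h : ∀ (n : ℕ) (W : C(Fin n → I, X))
      (G : C(I × (Fin n → I), Y)), (∀ k, G (0, k) = f (W k)) → (∀ k, G (1, k) = b) →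
      (∀ p, G p ∈ T) → (∀ s, ∀ k ∈ bd (Fin n → I), G (s, k) = b) →
      ∃ V : C(I × (Fin n → I), X × C(I, Y)), (∀ p, V p ∈ pathLifts f T ∧ (V p).2 1 = G p) ∧
        (∀ k, V (0, k) = constPaths f W k) ∧
        (∀ s, ∀ k ∈ bd (Fin n → I), V (s, k) = constPaths f W k) ∧
        ∀ k, V (1, k) ∈ hoFiber f {b} b) : FiberEquiv f T b := by
  intro n u v hu huQ hvP huv
  have hvb : ∀ k ∈ bd (Fin n → I), f (v k).1 = b ∧ ∀ s, (v k).2 s = b := fun k hk =>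
    mem_hoFiber_singleton.1 (by rw [huv k hk]; exact huQ k hk)
  have hv0 : ∀ k, (v k).2 0 = f (v k).1 := fun k => (hvP k).1.1
  obtain ⟨V, hVG, hV0, hVb, hV1⟩ := h n (ptOf v) (pathOf v) (fun k => hv0 k)
    (fun k => (hvP k).2) (fun p => (hvP _).1.2 _) (fun s k hk => (hvb k hk).2 s)
  have hV1' : ∀ k, f (V (1, k)).1 = b ∧ ∀ s, (V (1, k)).2 s = b := fun k =>
    mem_hoFiber_singleton.1 (hV1 k)
  -- The floor is the part of the path of v(k) from time a onwards; the wall at path time 0 runs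
  -- back along the path of V(a, k). The top face is thus a path from the image of the point of V(a,
  -- k) to b, a concatenation of the two, equal to the original path at a = 0 and constant at a = 1.
  obtain ⟨Θ, a1, a2, a3, a4, a5, a6, a7⟩ := exists_fill₃ (K := Fin n → I)
    ⟨fun p => (v p.2.2).2 (max p.1 p.2.1), by fun_prop⟩
    ⟨fun p => (v p.2.2).2 p.2.1, by fun_prop⟩
    (ContinuousMap.const _ b)
    ⟨fun p => (V p.2).2 (σ p.1), by fun_prop⟩
    (ContinuousMap.const _ b) (fun _ => b) continuousOn_const T
    (fun p => by simp) (fun p => by simp [max_eq_left unitInterval.le_one', (hvP _).2])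
    (fun t k => by simp [(hVG _).2])
    (fun t k => by simp [max_eq_right unitInterval.le_one', (hvP _).2])
    (fun s k => by simp [hV0, constPaths_snd, hv0])
    (fun s k => by simp [(hV1' k).2])
    (fun s k => by simp [(hvP _).2]) (fun s k => rfl)
    (fun t t' k hk => by simp [(hvb k hk).2])
    (fun s t k hk => by simp [(hvb k hk).2]) (fun s t k hk => rfl)
    (fun s t k hk => by simp [hVb _ k hk, constPaths_snd, (hvb k hk).1]) (fun s t k hk => rfl)
    (fun p => (hvP _).1.2 _) (fun p => (hvP _).1.2 _)
    (fun p => by rw [ContinuousMap.const_apply, ← (hvP 0).2]; exact (hvP _).1.2 _)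
    (fun p => (hVG _).1.2 _)
    (fun p => by rw [ContinuousMap.const_apply, ← (hvP 0).2]; exact (hvP _).1.2 _)
    (fun s t t' k hk => by rw [← (hvP 0).2]; exact (hvP _).1.2 _)
  let κ : C(I × (Fin n → I), X × C(I, Y)) :=
    toPaths ⟨fun p => (V (σ p.1, p.2)).1, by fun_prop⟩
      ⟨fun p => Θ (1, (σ p.2.1, (p.1, p.2.2))), by fun_prop⟩
  have hκb : ∀ s, ∀ k ∈ bd (Fin n → I), κ (s, k) = v k := by
    intro s k hk
    rw [toPaths_eq_iff]
    refine ⟨by simp [hVb _ k hk, constPaths_fst], fun t => ?_⟩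
    simp [a6 _ _ _ k hk, (hvb k hk).2]
  refine ⟨κ.comp ⟨fun k => (0, k), by fun_prop⟩, fun k => ?_, fun k hk => ?_, κ, fun k => rfl,
    fun k => ?_, hκb, fun p => ?_⟩
  · rw [mem_hoFiber_singleton]
    refine ⟨by simpa [κ] using (hV1' k).1, fun s => by simp [κ, a3]⟩
  · simp [hκb 0 k hk, huv k hk]
  · rw [toPaths_eq_iff]
    refine ⟨by simp [hV0, constPaths_fst], fun s => by simp [a2]⟩
  · refine ⟨⟨?_, fun s => a7 _⟩, ?_⟩
    · have : Θ (1, (σ p.1, (0, p.2))) = (V (σ p.1, p.2)).2 0 := by simp [a4]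
      exact this.trans (hVG _).1.1
    · exact a5 _ _ _

/-- A subset is good if it is covered by two relatively open subsets `W`, `V` such that `V`,
`W ∩ V` and some set which contains `W` are good. -/
theorem FiberEquiv.of_cover {T W V U S O₁ O₂ : Set Y} (hV : IsGood f V (S ∩ V))
    (hU : IsGood f U (S ∩ U)) (hWV : IsGood f (W ∩ V) (S ∩ (W ∩ V))) (hWU : W ⊆ U)
    (hT : T ⊆ W ∪ V) (hUT : U ⊆ T) (hVT : V ⊆ T) (hO₁ : IsOpen O₁) (hO₂ : IsOpen O₂)
    (hW₁ : O₁ ∩ T ⊆ W) (hW₁' : W ⊆ O₁) (hV₂ : O₂ ∩ T ⊆ V) (hV₂' : V ⊆ O₂) {b : Y}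
    (hbS : b ∈ S) : FiberEquiv f T b := by
  classical
  -- A monotone choice of a good set around each small set. `W` itself is not assumed good, hence
  -- `U` for sets that lie only in `W`.
  let N : Set Y → Set Y := fun Q => if Q ⊆ V then (if Q ⊆ W then W ∩ V else V) else U
  let small : Set Y → Prop := fun Q => Q ⊆ W ∨ Q ⊆ V
  have hNT : ∀ Q, N Q ⊆ T := by
    intro Q
    simp only [N]
    split_ifs
    exacts [Set.inter_subset_right.trans hVT, hVT, hUT]
  have hNgood : ∀ Q, IsGood f (N Q) (S ∩ N Q) := by
    intro Q
    simp only [N]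
    split_ifs
    exacts [hWV, hV, hU]
  have hNmono : ∀ {Q Q' : Set Y}, Q' ⊆ Q → small Q → N Q' ⊆ N Q := by
    intro Q Q' hQ hs
    simp only [N]
    by_cases h1 : Q ⊆ V
    · rw [if_pos h1, if_pos (hQ.trans h1)]
      by_cases h2 : Q ⊆ W
      · rw [if_pos h2, if_pos (hQ.trans h2)]
      · rw [if_neg h2]
        split_ifs
        exacts [Set.inter_subset_right, le_rfl]
    · have h2 : Q ⊆ W := hs.resolve_right h1
      rw [if_neg h1, if_pos (hQ.trans h2)]
      split_ifs
      exacts [Set.inter_subset_left.trans hWU, le_rfl]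
  have hN : LiftRule f small N := by
    refine ⟨fun h => Or.imp h.trans h.trans, hNmono, ?_, fun h hs => ?_⟩
    · intro Q hs
      simp only [N]
      split_ifs with h1 h2
      exacts [Set.subset_inter h2 h1, h1, (hs.resolve_right h1).trans hWU]
    · exact (hNgood _).relLift (hNgood _) (hNmono h hs)
        (Set.inter_subset_inter_right _ (hNmono h hs))
  refine FiberEquiv.of_lift fun n W₀ G hG0 hG1 hGT hGb => ?_
  have hcov : (Set.univ : Set (I × (Fin n → I))) ⊆ ⋃ i : Bool, G ⁻¹' (if i then O₁ else O₂) := by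
    intro p _
    rw [Set.mem_iUnion]
    rcases hT (hGT p) with h | h
    exacts [⟨true, hW₁' h⟩, ⟨false, hV₂' h⟩]
  -- A Lebesgue number gives a depth `P` at which every cell is mapped into one of the two open
  -- sets.
  obtain ⟨δ, hδ, hball⟩ := lebesgue_number_lemma_of_metric isCompact_univ
    (fun i : Bool => by
      cases i
      · exact hO₂.preimage G.continuous
      · exact hO₁.preimage G.continuous) hcov
  obtain ⟨P, hP⟩ := exists_pow_lt_of_lt_one hδ (by norm_num : (1 / 2 : ℝ) < 1)
  let E : (Fin n → I) × Unit ≃ₜ (Fin n → I) := Homeomorph.prodPUnit _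
  have hE : ∀ k, k ∈ bd ((Fin n → I) × Unit) ↔ E k ∈ bd (Fin n → I) := fun k => by
    rw [mem_bd_prodCube]
    exact or_iff_left (fun h : k.2 ∈ (∅ : Set Unit) => h)
  let v : C(I × ((Fin n → I) × Unit), Y) := G.comp ⟨fun p => (p.1, p.2.1), by fun_prop⟩
  have hsm : ∀ τ (q : Fin n → I),
      small (v '' (dyadicCell P τ ×ˢ (dyadicCells (fun _ => P) q ×ˢ Set.univ))) := by
    intro τ q
    obtain ⟨i, hi⟩ := hball (τ, q) trivial
    have hsub : ∀ y ∈ v '' (dyadicCell P τ ×ˢ (dyadicCells (fun _ => P) q ×ˢ Set.univ)),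
        y ∈ T ∧ y ∈ (if i then O₁ else O₂ : Set Y) := by
      rintro _ ⟨⟨a, c, d⟩, ⟨ha, hc, -⟩, rfl⟩
      refine ⟨hGT _, hi (?_ : dist (a, c) (τ, q) < δ)⟩
      refine lt_of_le_of_lt (max_le (dist_le_of_mem_dyadicCell P ha) ?_) hP
      exact (dist_pi_le_iff (by positivity)).2 fun j => dist_le_of_mem_dyadicCell P (hc j)
    cases i
    · exact Or.inr fun y hy => hV₂ ⟨(hsub y hy).2, (hsub y hy).1⟩
    · exact Or.inl fun y hy => hW₁ ⟨(hsub y hy).2, (hsub y hy).1⟩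
  have hbox := BoxExt.of_homeo E hE (S := fun x => {z : X × C(I, Y) | z ∈ pathLifts f
      (N (v '' (dyadicCell P x.1 ×ˢ (dyadicCells (fun _ => P) x.2 ×ˢ Set.univ)))) ∧ z.2 1 = G x})
    (hN.boxExt_of_cells_fst (fun _ => P) P v hsm)
  have hGbox : ∀ p : I × (Fin n → I), p.1 = 0 ∨ p.2 ∈ bd (Fin n → I) → G p = f (W₀ p.2) := by
    rintro ⟨s, k⟩ (rfl | hk)
    · exact hG0 k
    · rw [← hG0, hGb _ k hk, hGb _ k hk]
  obtain ⟨V₁, h1, h2⟩ := hbox (fun p => constPaths f W₀ p.2) (by fun_prop) (by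
    intro p hp
    refine ⟨⟨rfl, fun s => ?_⟩, ?_⟩
    · rw [constPaths_snd, ← hGbox p hp]
      refine hN.subset (hsm _ _) ⟨(p.1, (p.2, ())), ⟨mem_dyadicCell_self _ _,
        fun i => mem_dyadicCell_self _ _, trivial⟩, rfl⟩
    · rw [constPaths_snd, hGbox p hp])
  have hA : ∀ q : Fin n → I,
      v '' (dyadicCell P 1 ×ˢ (dyadicCells (fun _ => P) q ×ˢ Set.univ)) = {b} := by
    intro q
    ext y
    constructor
    · rintro ⟨⟨a, c, d⟩, ⟨ha, hc, -⟩, rfl⟩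
      rw [(dyadicCell_zero_one P).2] at ha
      obtain rfl : a = 1 := ha
      exact hG1 c
    · rintro rfl
      exact ⟨(1, (q, ())), ⟨mem_dyadicCell_self _ _, fun i => mem_dyadicCell_self _ _, trivial⟩,
        hG1 q⟩
  have hb : b ∈ N {b} := by
    have : small {b} := hA 0 ▸ hsm 1 0
    exact hN.subset this rfl
  have hV₁N : ∀ k, V₁ (1, k) ∈ hoFiber f (N {b}) b := fun k => by
    have := h2 (1, k)
    simp only [Set.mem_ofPred_eq, hA, hG1] at this
    exact this
  -- The cells of the end face are mapped to `{b}`, so there the lift lies over the good set `N {b}`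
  -- and can be compressed into the fibre; `R` attaches this compression as a collar.
  obtain ⟨w, hwF, hw, κ, hκ0, hκ1, hκb, hκN⟩ := ((hNgood {b}).fiberEquiv b ⟨hbS, hb⟩).liftProp
    (Fin n → I) (fun k => V₁ (1, k)) (V₁.comp ⟨fun k => (1, k), by fun_prop⟩) (by fun_prop)
    (fun k hk => by
      rw [h1 _ (Or.inr hk), mem_hoFiber_singleton]
      have : f (W₀ k) = b := by rw [← hG0, hGb _ k hk]
      exact ⟨this, fun s => this⟩)
    hV₁N (fun k _ => rfl)
  obtain ⟨R, r0, r1, r2, rb, rT⟩ := (boxExt_pathLifts (K := I × (Fin n → I)) f T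
    (G.comp ⟨fun p => p.2, by fun_prop⟩) (fun p => hGT _)).fill₂ V₁
      (V₁.comp ⟨fun p => (0, p.2), by fun_prop⟩)
      (κ.comp ⟨fun p => (σ p.1, p.2), by fun_prop⟩) (fun p => V₁ p.2) (by fun_prop)
      (fun k => rfl) (fun k => by simp [hκ1]) (fun t k hk => rfl) (fun s k hk => rfl)
      (fun s k hk => by simp [hκb _ k hk])
      (fun p => ⟨pathLifts_mono (hNT _) (h2 p).1, (h2 p).2⟩)
      (fun s k => ⟨pathLifts_mono (hNT _) (h2 _).1, (h2 _).2⟩)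
      (fun s k => ⟨pathLifts_mono (hNT _) (hκN _).1, by
        simp only [ContinuousMap.comp_apply, ContinuousMap.coe_mk, hG1]; exact (hκN _).2⟩)
      (fun s t k hk => ⟨pathLifts_mono (hNT _) (h2 _).1, (h2 _).2⟩)
  refine ⟨R.comp ⟨fun p => (1, p), by fun_prop⟩, fun p => rT _, fun k => ?_, fun s k hk => ?_,
    fun k => ?_⟩
  · exact (r1 1 k).trans (h1 _ (Or.inl rfl))
  · exact (rb 1 s k hk).trans (h1 _ (Or.inr hk))
  · have : R (1, (1, k)) = w k := by simp [r2, hκ0]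
    simp only [ContinuousMap.comp_apply, ContinuousMap.coe_mk, this]
    exact hwF k

end Cover

/-! ### Weak equivalences in terms of homotopy groups -/

section HomotopyGroups
variable {X : Type*} {Y : Type*} [TopologicalSpace X] [TopologicalSpace Y]

theorem genLoop_homotopic_iff {n : ℕ} {x : X} {p q : Ω^ (Fin n) X x} :
    GenLoop.Homotopic p q ↔ ∃ κ : C(I × (Fin n → I), X), (∀ k, κ (0, k) = p k) ∧
      (∀ k, κ (1, k) = q k) ∧ ∀ s, ∀ k ∈ bd (Fin n → I), κ (s, k) = x := by
  constructor
  · rintro ⟨H⟩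
    exact ⟨H.toContinuousMap, fun k => H.apply_zero k, fun k => H.apply_one k,
      fun s k hk => (H.eq_fst s hk).trans (p.2 k hk)⟩
  · rintro ⟨κ, h0, h1, hb⟩
    exact ⟨⟨⟨κ, h0, h1⟩, fun s k hk => (hb s k hk).trans (p.2 k hk).symm⟩⟩

/-- The class of a generalized loop. -/
def piMk {n : ℕ} {x : X} (p : Ω^ (Fin n) X x) : π_ n X x :=
  Quotient.mk (GenLoop.Homotopic.setoid (Fin n) x) p

theorem piMk_eq_iff {n : ℕ} {x : X} {p q : Ω^ (Fin n) X x} :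
    piMk p = piMk q ↔ ∃ κ : C(I × (Fin n → I), X), (∀ k, κ (0, k) = p k) ∧
      (∀ k, κ (1, k) = q k) ∧ ∀ s, ∀ k ∈ bd (Fin n → I), κ (s, k) = x :=
  ⟨fun h => genLoop_homotopic_iff.1 (Quotient.exact h),
    fun h => Quotient.sound (genLoop_homotopic_iff.2 h)⟩

theorem piMk_surjective {n : ℕ} {x : X} (a : π_ n X x) : ∃ p, piMk p = a :=
  Quotient.exists_rep a

theorem piMap_piMk {n : ℕ} (f : C(X, Y)) {x : X} {y : Y} (h : f x = y) (p : Ω^ (Fin n) X x) :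
    piMap n f h (piMk p) = piMk (genLoopMap n f h p) := rfl

theorem genLoopMap_apply {n : ℕ} (f : C(X, Y)) {x : X} {y : Y} (h : f x = y)
    (p : Ω^ (Fin n) X x) (t) : genLoopMap n f h p t = f (p t) := rfl

theorem piBase_eq (n : ℕ) (x : X) : piBase n x = piMk GenLoop.const := rfl

/-- The generalized loop given by a map on `I × I^n`. -/
def loopOfProd {n : ℕ} {x : X} (d : C(I × (Fin n → I), X))
    (hd : ∀ p ∈ bd (I × (Fin n → I)), d p = x) : Ω^ (Fin (n + 1)) X x :=
  ⟨d.comp (cubeCons n).symm, fun k hk => hd _ (by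
    have := cubeCons_mem_boundary n ((cubeCons n).symm k)
    rw [Homeomorph.apply_symm_apply] at this
    exact this.1 hk)⟩

theorem loopOfProd_cons {n : ℕ} {x : X} (d : C(I × (Fin n → I), X))
    (hd : ∀ p ∈ bd (I × (Fin n → I)), d p = x) (s : I) (k : Fin n → I) :
    loopOfProd d hd (Fin.cons s k) = d (s, k) := by
  change d ((cubeCons n).symm (Fin.cons s k)) = _
  rw [cubeCons_symm_apply]
  simp

theorem GenLoop.cons_eq {n : ℕ} {x : X} (p : Ω^ (Fin (n + 1)) X x) {s : I} {k : Fin n → I}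
    (h : s = 0 ∨ s = 1 ∨ k ∈ bd (Fin n → I)) : p (Fin.cons s k) = x :=
  p.2 _ ((cubeCons_mem_boundary n (s, k)).2 h)

/-- A generalized loop of dimension `n + 1` as a map on `I × I^n`. -/
def GenLoop.toProd {n : ℕ} {x : X} (p : Ω^ (Fin (n + 1)) X x) : C(I × (Fin n → I), X) :=
  p.1.comp (cubeCons n)

@[simp] theorem GenLoop.toProd_apply {n : ℕ} {x : X} (p : Ω^ (Fin (n + 1)) X x) (s : I)
    (k : Fin n → I) : GenLoop.toProd p (s, k) = p (Fin.cons s k) := rfl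

/-- A map which induces bijections on all homotopy sets has the relative lifting property up to
homotopy. -/
theorem IsWeakEquivalence.we [Nonempty X] {g : C(X, Y)} (hg : IsWeakEquivalence g) :
    WE g Set.univ Set.univ := by
  refine WE.of_prod ?_ fun n => ?_
  · intro u v hu huQ hvP huv
    have hbd : ∀ k, k ∉ bd (Fin 0 → I) := fun k ⟨i, _⟩ => i.elim0
    obtain ⟨a, ha⟩ := (hg.2 0 (Classical.arbitrary X)).2
      (piMk ⟨v, fun k hk => absurd hk (hbd k)⟩)
    obtain ⟨p, rfl⟩ := piMk_surjective a
    obtain ⟨κ, h0, h1, -⟩ := piMk_eq_iff.1 ha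
    exact ⟨p.1, fun _ => trivial, fun k hk => absurd hk (hbd k), κ, h0, h1,
      fun s k hk => absurd hk (hbd k), fun _ => trivial⟩
  · intro u v hu huQ hvP huv
    obtain ⟨p₀, hp₀, hn⟩ := exists_boundary_normalization (Fin n → I) Set.univ u hu huQ
    obtain ⟨U, φ, hUc, hUQ, hU0, hU1, hU2, hU3⟩ := hn (u p₀) (JoinedIn.refl trivial)
    set a := u p₀
    refine LiftRel.of_boundary_homotopy (fun _ _ => Set.mem_univ _) U hUc hUQ hU0 (fun p hp => rfl) huv hvP
      ?_
    intro v₁ hv₁P hv₁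
    have hφ : ∀ k ∈ bd (Fin n → I), φ k = a := fun k hk => by rw [← hU1, hU3 0 k hk]
    have hv0 : ∀ k, v₁ (0, k) = g (φ k) := fun k => by
      rw [← hU1]; exact hv₁ _ (Or.inl rfl)
    have hv1 : ∀ k, v₁ (1, k) = g a := fun k => by
      rw [← hU2 k]; exact hv₁ _ (Or.inr (Or.inl rfl))
    have hvb : ∀ t, ∀ k ∈ bd (Fin n → I), v₁ (t, k) = g a := fun t k hk => by
      rw [← hU3 t k hk]; exact hv₁ _ (Or.inr (Or.inr hk))
    let pφ : Ω^ (Fin n) X a := ⟨φ, hφ⟩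
    -- The cube `v₁` is a nullhomotopy of `g ∘ φ`, so injectivity on π_n makes `φ` nullhomotopic, by
    -- `w₀`.
    have hnull : piMap n g (rfl : g a = g a) (piMk pφ) =
        piMap n g (rfl : g a = g a) (piMk GenLoop.const) := by
      rw [piMap_piMk, piMap_piMk, piMk_eq_iff]
      exact ⟨v₁, hv0, hv1, hvb⟩
    obtain ⟨w₀, w00, w01, w0b⟩ := piMk_eq_iff.1 ((hg.2 n a).1 hnull)
    -- The top face of `D` is the difference of the nullhomotopies `g ∘ w₀` and `v₁`, a loop which
    -- surjectivity on π_{n+1} realizes by some `e`.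
    obtain ⟨D, d0, d1, d2, db, -⟩ := exists_fill₂ (K := Fin n → I)
      ⟨fun p => g (φ p.2), by fun_prop⟩ (g.comp w₀) v₁ (fun _ => g a) continuousOn_const Set.univ
      (fun k => congrArg g (w00 k)) (fun k => by simp [hv0]) (fun t k hk => by simp [hφ k hk])
      (fun s k hk => by simp [w0b _ k hk]) (fun s k hk => by simp [hvb _ k hk])
      (fun _ => trivial) (fun _ => trivial) (fun _ => trivial) (fun _ _ _ _ => trivial)
    have hd : ∀ p ∈ bd (I × (Fin n → I)), D (1, p) = g a := by
      rintro ⟨s, k⟩ (rfl | rfl | hk)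
      · rw [d1]; simp [w01]
      · rw [d2, hv1]
      · rw [db _ _ _ hk]
    obtain ⟨e', he'⟩ := (hg.2 (n + 1) a).2
      (piMk (loopOfProd (D.comp ⟨fun p => (1, p), by fun_prop⟩) hd))
    obtain ⟨e, rfl⟩ := piMk_surjective e'
    rw [piMap_piMk, piMk_eq_iff] at he'
    obtain ⟨Λ, l0, l1, lb⟩ := he'
    have l0' : ∀ s k, Λ (0, Fin.cons s k) = g (e (Fin.cons s k)) := fun s k => l0 _
    have l1' : ∀ s k, Λ (1, Fin.cons s k) = D (1, (s, k)) := fun s k => by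
      rw [l1, loopOfProd_cons]; rfl
    have lb' : ∀ r s k, s = 0 ∨ s = 1 ∨ k ∈ bd (Fin n → I) → Λ (r, Fin.cons s k) = g a :=
      fun r s k h => lb r _ ((cubeCons_mem_boundary n (s, k)).2 h)
    -- The nullhomotopy `w₀` corrected by the loop `e`; its top face is the required lift.
    obtain ⟨E, e0, e1, e2, eb, -⟩ := exists_fill₂ (K := Fin n → I) w₀
      ⟨fun p => φ p.2, by fun_prop⟩ (GenLoop.toProd e) (fun _ => a) continuousOn_const Set.univ
      (fun k => (w00 k).symm)
      (fun k => (GenLoop.cons_eq e (Or.inl rfl)).trans (w01 k).symm)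
      (fun t k hk => by simp [w0b t k hk]) (fun s k hk => by simp [hφ k hk])
      (fun s k hk => (GenLoop.cons_eq e (Or.inr (Or.inr hk))).symm)
      (fun _ => trivial) (fun _ => trivial) (fun _ => trivial) (fun _ _ _ _ => trivial)
    obtain ⟨G, g0, g1, g2, g3, g4, gb, -⟩ := exists_fill₃ (K := Fin n → I)
      ⟨fun p => g (w₀ p.2), by fun_prop⟩ (g.comp E)
      ⟨fun p => D (p.2.1, (p.1, p.2.2)), by fun_prop⟩
      ⟨fun p => g (φ p.2.2), by fun_prop⟩
      (Λ.comp ⟨fun p => (p.2.1, Fin.cons p.1 p.2.2),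
        (by fun_prop : Continuous fun p : I × (I × (Fin n → I)) => p.2.1).prodMk
          (Continuous.finCons (by fun_prop) (by fun_prop))⟩)
      (fun _ => g a) continuousOn_const Set.univ
      (fun p => by simp [e0]) (fun p => by simp [d1]) (fun t k => (congrArg g (w00 k)).symm)
      (fun t k => by
        simp only [ContinuousMap.comp_apply, ContinuousMap.coe_mk, w01]
        exact lb' _ _ _ (Or.inl rfl))
      (fun s k => by simp [e1]) (fun s k => by simp [d0])
      (fun s k => by simp [e2, l0'])
      (fun s k => by simp [l1'])
      (fun t t' k hk => by simp [w0b _ k hk]) (fun s t k hk => by simp [eb _ _ _ hk])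
      (fun s t k hk => by simp [db _ _ _ hk]) (fun s t k hk => by simp [hφ k hk])
      (fun s t k hk => (lb' _ _ _ (Or.inr (Or.inr hk))).symm)
      (fun _ => trivial) (fun _ => trivial) (fun _ => trivial) (fun _ => trivial)
      (fun _ => trivial) (fun _ _ _ _ _ => trivial)
    refine ⟨E.comp ⟨fun p => (1, p), by fun_prop⟩, fun _ => trivial, ?_,
      G.comp ⟨fun p => (1, p), by fun_prop⟩, fun k => g1 1 k, fun k => ?_, ?_, fun _ => trivial⟩
    · rintro ⟨t, k⟩ (rfl | rfl | hk)
      · exact (e1 1 k).trans (hU1 k).symm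
      · exact ((e2 1 k).trans (GenLoop.cons_eq e (Or.inr (Or.inl rfl)))).trans (hU2 k).symm
      · exact (eb 1 t k hk).trans (hU3 t k hk).symm
    · exact (g2 1 k).trans (d2 _ _)
    · rintro r ⟨t, k⟩ (rfl | rfl | hk)
      · exact (g3 1 r k).trans (hv0 k).symm
      · exact ((g4 1 r k).trans (lb' _ _ _ (Or.inr (Or.inl rfl)))).trans (hv1 k).symm
      · exact (gb 1 r t k hk).trans (hvb t k hk).symm

end HomotopyGroups

/-! ### Change of the ambient space -/

theorem WE.id_iff_of_isInducing {Z Z' : Type*} [TopologicalSpace Z] [TopologicalSpace Z']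
    {ι : Z' → Z} (hι : Topology.IsInducing ι) {F P : Set Z} (hF : F ⊆ Set.range ι)
    (hP : P ⊆ Set.range ι) (hinj : Function.Injective ι) :
    WE (ContinuousMap.id Z') (ι ⁻¹' F) (ι ⁻¹' P) ↔ WE (ContinuousMap.id Z) F P := by
  have lift : ∀ {L : Type} [TopologicalSpace L] (v : C(L, Z)), (∀ l, v l ∈ Set.range ι) →
      ∃ v' : C(L, Z'), ∀ l, ι (v' l) = v l := by
    intro L _ v hv
    choose v' hv' using hv
    exact ⟨⟨v', hι.continuous_iff.2 (by
      rw [show ι ∘ v' = v from funext hv']; exact v.continuous)⟩, hv'⟩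
  let j : C(Z', Z) := ⟨ι, hι.continuous⟩
  constructor
  · intro h n u v hu huQ hvP huv
    obtain ⟨v', hv'⟩ := lift v fun k => hP (hvP k)
    obtain ⟨w, hwF, hw, κ, h0, h1, hb, hκP⟩ := h n v' v' v'.continuous.continuousOn
      (fun k hk => by rw [Set.mem_preimage, hv', huv k hk]; exact huQ k hk)
      (fun k => by rw [Set.mem_preimage, hv']; exact hvP k) (fun k _ => rfl)
    refine ⟨j.comp w, hwF, fun k hk => ?_, j.comp κ, fun k => ?_, fun k => ?_, fun s k hk => ?_,
      hκP⟩
    · exact ((congrArg ι (hw k hk)).trans (hv' k)).trans (huv k hk)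
    · exact congrArg ι (h0 k)
    · exact (congrArg ι (h1 k)).trans (hv' k)
    · exact (congrArg ι (hb s k hk)).trans (hv' k)
  · intro h n u v hu huQ hvP huv
    obtain ⟨w, hwF, hw, κ, h0, h1, hb, hκP⟩ := h n (fun k => ι (u k)) (j.comp v)
      (hι.continuous.comp_continuousOn hu) huQ hvP (fun k hk => congrArg ι (huv k hk))
    obtain ⟨w', hw'⟩ := lift w fun k => hF (hwF k)
    obtain ⟨κ', hκ'⟩ := lift κ fun p => hP (hκP p)
    refine ⟨w', fun k => by rw [Set.mem_preimage, hw']; exact hwF k, fun k hk => hinj ?_, κ',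
      fun k => hinj ?_, fun k => hinj ?_, fun s k hk => hinj ?_,
      fun p => by rw [Set.mem_preimage, hκ']; exact hκP p⟩
    · rw [hw', hw k hk]
    · rw [hκ', h0]; exact (hw' k).symm
    · rw [hκ', h1]; rfl
    · rw [hκ', hb s k hk]; rfl

section Transfer
variable {X : Type u} {Y : Type v} [TopologicalSpace X] [TopologicalSpace Y]

/-- A path lift in A ⊆ U has its path in U and therefore its point over U, so both sides concern the
same homotopy fibres. -/
theorem fiberEquiv_restrictPreimage_iff (f : C(X, Y)) {U A : Set Y} (hAU : A ⊆ U) (b : U) :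
    FiberEquiv (f.restrictPreimage U) (Subtype.val ⁻¹' A) b ↔
      FiberEquiv f A (b : Y) := by
  let ιY : C(U, Y) := ⟨Subtype.val, continuous_subtype_val⟩
  let ι : (f ⁻¹' U) × C(I, U) → X × C(I, Y) := Prod.map Subtype.val fun γ => ιY.comp γ
  have hind : Topology.IsInducing ι :=
    Topology.IsInducing.subtypeVal.prodMap (ContinuousMap.isInducing_postcomp ιY Topology.IsInducing.subtypeVal)
  have hinj : Function.Injective ι := by
    rintro ⟨x, γ⟩ ⟨x', γ'⟩ h
    have h1 := congrArg Prod.fst h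
    have h2 := congrArg Prod.snd h
    refine Prod.ext (Subtype.ext h1) (ContinuousMap.ext fun s => Subtype.ext ?_)
    exact congrArg (fun γ : C(I, Y) => γ s) h2
  have hrange : ∀ B ⊆ U, hoFiber f B b ⊆ Set.range ι := by
    rintro B hB ⟨x, γ⟩ ⟨⟨h1, h2⟩, h3⟩
    refine ⟨(⟨x, ?_⟩, ⟨fun s => ⟨γ s, hB (h2 s)⟩, by fun_prop⟩), rfl⟩
    have := h2 0
    rw [h1] at this
    exact hB this
  have hpre : ∀ B, ι ⁻¹' hoFiber f B b =
      hoFiber (f.restrictPreimage U) (Subtype.val ⁻¹' B : Set U) b := by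
    intro B
    ext ⟨x, γ⟩
    constructor
    · rintro ⟨⟨h1, h2⟩, h3⟩
      exact ⟨⟨Subtype.ext h1, h2⟩, Subtype.ext h3⟩
    · rintro ⟨⟨h1, h2⟩, h3⟩
      exact ⟨⟨congrArg Subtype.val h1, h2⟩, congrArg Subtype.val h3⟩
  have hsing : (Subtype.val ⁻¹' {(b : Y)} : Set U) = {b} := by
    ext y
    simp [Subtype.ext_iff]
  have := WE.id_iff_of_isInducing hind (hrange {(b : Y)} (by simp)) (hrange A hAU) hinj
  rwa [hpre, hpre, hsing] at this

end Transfer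

/-! ### Deformations -/

/-- The end of a deformation retraction which stays in the whole space. -/
theorem WE.of_deformation {Z : Type*} [TopologicalSpace Z] (H : C(Z × I, Z)) {A : Set Z}
    (H0 : ∀ z, H (z, 0) = z) (HA : ∀ z ∈ A, ∀ t, H (z, t) = z) (H1 : ∀ z, H (z, 1) ∈ A) :
    WE (H.comp ⟨fun z => (z, 1), by fun_prop⟩) Set.univ A := by
  intro n u v hu _ hvA huv
  have hr : ∀ z, H (H (z, 1), 1) = H (z, 1) := fun z => HA _ (H1 z) 1
  have huv : ∀ k ∈ bd (Fin n → I), v k = H (u k, 1) := huv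
  -- With r = H_1, the image under r of the track from z to r(z) is a loop that need not be null.
  -- `M` is the track followed by the inverse of that loop; under r it becomes a loop times its
  -- inverse, which `Q` contracts within `A`.
  obtain ⟨M, hM0, hM1⟩ := exists_concat (L := Z) ⟨fun p => H (p.2, p.1), by fun_prop⟩
    ⟨fun p => H (H (p.2, σ p.1), 1), by fun_prop⟩ (fun z => by simp [hr])
  obtain ⟨Q, hQ0, hQ1⟩ := exists_concat (L := I × Z)
    ⟨fun p => H (H (p.2.2, p.1 * σ p.2.1), 1), by fun_prop⟩
    ⟨fun p => H (H (p.2.2, σ p.1 * σ p.2.1), 1), by fun_prop⟩ (fun z => by simp)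
  simp only [ContinuousMap.coe_mk] at hM0 hM1 hQ0 hQ1
  have M0 : ∀ z, M (0, z) = z := fun z => by rw [← lowerHalf_zero, hM0, H0]
  have M1 : ∀ z, M (1, z) = H (z, 1) := fun z => by rw [← upperHalf_one, hM1]; simp [H0]
  have Q0 : ∀ a z, Q (0, (a, z)) = H (z, 1) := fun a z => by
    rw [← lowerHalf_zero, hQ0]; simp [H0]
  have Q1 : ∀ a z, Q (1, (a, z)) = H (z, 1) := fun a z => by
    rw [← upperHalf_one, hQ1]; simp [H0]
  have QA : ∀ p, Q p ∈ A := by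
    rintro ⟨s, p⟩
    obtain ⟨t, rfl⟩ | ⟨t, rfl⟩ := exists_half s
    · rw [hQ0]; exact H1 _
    · rw [hQ1]; exact H1 _
  have QM : ∀ s z, Q (s, (0, z)) = H (M (s, z), 1) := by
    intro s z
    obtain ⟨t, rfl⟩ | ⟨t, rfl⟩ := exists_half s
    · rw [hQ0, hM0]; simp
    · rw [hQ1, hM1]; simp [hr]
  have Q2 : ∀ s z, Q (s, (1, z)) = H (z, 1) := by
    intro s z
    obtain ⟨t, rfl⟩ | ⟨t, rfl⟩ := exists_half s
    · rw [hQ0]; simp [H0]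
    · rw [hQ1]; simp [H0]
  have hu' : ContinuousOn (fun p : I × (Fin n → I) => u p.2) {p | p.2 ∈ bd (Fin n → I)} :=
    hu.comp continuous_snd.continuousOn fun p hp => hp
  -- Running `M` backwards on the boundary deforms `v` into a map that extends `u`.
  obtain ⟨L, L0, L1, -⟩ := exists_fill v (fun p => M (σ p.1, u p.2))
    (M.continuous.comp_continuousOn
      ((by fun_prop : Continuous fun p : I × (Fin n → I) => σ p.1).continuousOn.prodMk hu'))
    (fun k hk => by simp [M1, huv k hk]) Set.univ (fun _ => trivial) fun _ _ _ => trivial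
  have hu'' : ContinuousOn (fun p : I × (I × (Fin n → I)) => u p.2.2)
      {p | p.2.2 ∈ bd (Fin n → I)} :=
    hu.comp (by fun_prop) fun p hp => hp
  have hL1 : ∀ k ∈ bd (Fin n → I), L (1, k) = u k := fun k hk => by simp [L1 _ k hk, M0]
  -- The homotopy r ∘ L moves the boundary along r ∘ M; `Q` turns it into a homotopy relative to the
  -- boundary.
  obtain ⟨G, g0, g1, g2, g3, gA⟩ := exists_fill₂ (K := Fin n → I)
    (H.comp ⟨fun p => (L p, 1), by fun_prop⟩) ⟨fun p => v p.2, by fun_prop⟩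
    ⟨fun p => H (L (1, p.2), 1), by fun_prop⟩ (fun p => Q (σ p.2.1, (p.1, u p.2.2)))
    (Q.continuous.comp_continuousOn
      ((by fun_prop : Continuous fun p : I × (I × (Fin n → I)) => σ p.2.1).continuousOn.prodMk
        (continuous_fst.continuousOn.prodMk hu''))) A
    (fun k => by simp [L0, HA _ (hvA k)]) (fun k => rfl)
    (fun t k hk => by simp [QM, L1 t k hk]) (fun s k hk => by simp [Q1, huv k hk])
    (fun s k hk => by simp [Q0, hL1 k hk]) (fun p => H1 _) (fun p => hvA _) (fun p => H1 _)
    (fun _ _ _ _ => QA _)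
  refine ⟨L.comp ⟨fun k => (1, k), by fun_prop⟩, fun _ => trivial, hL1,
    G.comp ⟨fun p => (1, (σ p.1, p.2)), by fun_prop⟩, fun k => ?_, fun k => ?_, fun s k hk => ?_,
    fun p => gA _⟩
  · simp [g2]
  · simp [g1]
  · simp [g3 _ _ k hk, Q2, huv k hk]

namespace Deformation
variable {X : Type u} {Y : Type v} [TopologicalSpace X] [TopologicalSpace Y] {f : C(X, Y)}
  {A : Set Y} (D : Deformation f A)

variable {K : Type} [TopologicalSpace K] [CubeSpace K]

/-- Since f ∘ H_t and h_t ∘ f are related only at t = 1, the deformation does not act on path lifts.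
Points and paths are therefore extended separately: points by compression along H_1, then paths by
compression along h_1 on a cube with the path parameter as extra coordinate. -/
theorem exists_extension {b : Y} (u : K → X × C(I, Y)) (hu : ContinuousOn u (bd K))
    (huF : ∀ k ∈ bd K, u k ∈ hoFiber f Set.univ b) (Φ : C(K, X × C(I, Y)))
    (hΦ : ∀ k, Φ k ∈ hoFiber f A (D.h (b, 1)))
    (hu1 : ∀ k ∈ bd K, (Φ k).1 = D.H ((u k).1, 1))
    (hu2 : ∀ k ∈ bd K, ∀ s, (Φ k).2 s = D.h ((u k).2 s, 1)) :
    ∃ w : C(K, X × C(I, Y)), (∀ k, w k ∈ hoFiber f Set.univ b) ∧ ∀ k ∈ bd K, w k = u k := by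
  obtain ⟨W, -, hW, κ, κ0, κ1, κb, κA⟩ :=
    (WE.of_deformation D.H D.H_zero D.H_fix D.H_one_mem).liftProp K (fun k => (u k).1) (ptOf Φ)
      (continuous_fst.comp_continuousOn hu) (fun _ _ => trivial)
      (fun k => by rw [Set.mem_preimage, ptOf_apply, ← (hΦ k).1.1]; exact (hΦ k).1.2 0) hu1
  have hev : ContinuousOn (fun p : I × K => (u p.2).2 p.1) {p | p.2 ∈ bd K} :=
    (ContinuousEval.continuous_eval (F := C(I, Y))).comp_continuousOn
      ((continuous_snd.comp_continuousOn (hu.comp continuous_snd.continuousOn fun p hp => hp)).prodMk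
        continuous_fst.continuousOn)
  have hev' : ContinuousOn (fun p : I × (I × K) => (u p.2.2).2 p.2.1) {p | p.2.2 ∈ bd K} :=
    hev.comp (by fun_prop : Continuous fun p : I × (I × K) => p.2).continuousOn fun p hp => hp
  have hf1 : ∀ k ∈ bd K, D.h ((u k).2 0, 1) = f (Φ k).1 := fun k hk => by
    rw [(huF k hk).1.1, ← D.comm, hu1 k hk]
  -- The starting points of the paths of `Φ` are moved along f ∘ κ to f(H_1 W), to span the
  -- h_1-image of the boundary prescribed for the new paths.
  obtain ⟨G, g0, g1, g2, g3, gA⟩ := exists_fill₂ (pathOf Φ)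
    (f.comp (κ.comp ⟨fun p => (σ p.1, p.2), by fun_prop⟩)) (ContinuousMap.const _ (D.h (b, 1)))
    (fun p => D.h ((u p.2.2).2 p.2.1, 1))
    (D.h.continuous.comp_continuousOn (hev'.prodMk continuousOn_const)) A
    (fun k => by simp [κ1, (hΦ k).1.1]) (fun k => by simp [(hΦ k).2])
    (fun t k hk => by simp [hu2 k hk]) (fun s k hk => by simp [κb _ k hk, hf1 k hk])
    (fun s k hk => by simp [(huF k hk).2]) (fun p => (hΦ _).1.2 _) (fun p => κA _)
    (fun p => D.h_one_mem _) (fun _ _ _ _ => D.h_one_mem _)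
  let B : I × K → Y := glue Prod.fst (fun p => f (W p.2)) (fun _ => b) fun p => (u p.2).2 p.1
  have e0 : ∀ k ∈ bd K, (u k).2 0 = f (W k) := fun k hk => by rw [hW k hk, (huF k hk).1.1]
  have B0 : ∀ k, B (0, k) = f (W k) := fun k => glue_of_zero (p := ((0 : I), k)) rfl
  have B1 : ∀ k, B (1, k) = b := fun k => glue_of_one (p := ((1 : I), k)) rfl
  have Bb : ∀ s, ∀ k ∈ bd K, B (s, k) = (u k).2 s := fun s k hk =>
    glue_of_agree (p := (s, k)) (by rintro rfl; exact e0 k hk) (by rintro rfl; exact (huF k hk).2)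
  have hBc : ContinuousOn B (bd (I × K)) :=
    continuousOn_glue continuous_fst (isClosed_bd.preimage continuous_snd) (by fun_prop)
      continuousOn_const hev (by rintro ⟨s, k⟩ hk rfl; exact e0 k hk)
      (by rintro ⟨s, k⟩ hk rfl; exact (huF k hk).2)
  obtain ⟨Γ, -, hΓ, -⟩ := (WE.of_deformation D.h D.h_zero D.h_fix D.h_one_mem).liftProp (I × K) B
    (G.comp ⟨fun p => (1, p), by fun_prop⟩) hBc (fun _ _ => trivial) (fun p => gA _) (by
      rintro ⟨s, k⟩ (rfl | rfl | hk)
      · simp [g1, B0, κ0, D.comm]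
      · simp [g2, B1]
      · simp [g3 _ _ k hk, Bb _ k hk])
  refine ⟨toPaths W Γ, fun k => ⟨⟨?_, fun _ => trivial⟩, ?_⟩, fun k hk => ?_⟩
  · simp [hΓ (0, k) (Or.inl rfl), B0]
  · simp [hΓ (1, k) (Or.inr (Or.inl rfl)), B1]
  · rw [toPaths_eq_iff]
    exact ⟨hW k hk, fun s => (hΓ (s, k) (Or.inr (Or.inr hk))).trans (Bb s k hk)⟩

/-- Over a point `b` at which the end of a deformation to `A` is an equivalence of fibres, the
fibre is equivalent to the homotopy fibre if this holds over the image of `b` in `A`. -/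
theorem fiberEquiv {b : Y} (hA : FiberEquiv f A (D.h (b, 1)))
    (hb : WE (D.H.comp ⟨fun x => (x, 1), by fun_prop⟩) (f ⁻¹' {b}) (f ⁻¹' {D.h (b, 1)})) :
    FiberEquiv f Set.univ b := by
  intro n u v hu huF hvF huv
  have huv : ∀ k ∈ bd (Fin n → I), v k = u k := huv
  let v' : C(Fin n → I, X × C(I, Y)) := toPaths (D.H.comp ⟨fun k => (ptOf v k, 1), by fun_prop⟩)
    (D.h.comp ⟨fun p => (pathOf v p, 1), by fun_prop⟩)
  have v'1 : ∀ k, (v' k).1 = D.H ((v k).1, 1) := fun k => rfl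
  have v'2 : ∀ k s, (v' k).2 s = D.h ((v k).2 s, 1) := fun k s => rfl
  have huc : ∀ k ∈ bd (Fin n → I), f (u k).1 = b ∧ ∀ s, (u k).2 s = b := fun k hk =>
    mem_hoFiber_singleton.1 (huF k hk)
  -- The image of `v` under (H_1, h_1) is compressed into the fibre over h_1(b), and the result is
  -- lifted to `w` in the fibre over b.
  obtain ⟨w', hw'F, hw', κ, κ0, κ1, κb, κF⟩ := hA.liftProp (Fin n → I) v' v'
    v'.continuous.continuousOn
    (fun k hk => by
      rw [mem_hoFiber_singleton, v'1, huv k hk, D.comm, (huc k hk).1]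
      refine ⟨rfl, fun s => ?_⟩
      rw [v'2, huv k hk, (huc k hk).2])
    (fun k => by
      refine ⟨⟨?_, fun s => D.h_one_mem _⟩, ?_⟩
      · rw [v'1, v'2, D.comm, (hvF k).1.1]
      · rw [v'2, (hvF k).2]) (fun _ _ => rfl)
  have w'c : ∀ k, f (w' k).1 = D.h (b, 1) ∧ ∀ s, (w' k).2 s = D.h (b, 1) := fun k =>
    mem_hoFiber_singleton.1 (hw'F k)
  obtain ⟨w, hwF, hw, μ, μ0, μ1, μb, μF⟩ := hb.liftProp (Fin n → I) (fun k => (u k).1) (ptOf w')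
    (continuous_fst.comp_continuousOn hu) (fun k hk => (huc k hk).1) (fun k => (w'c k).1)
    (fun k hk => by
      rw [ptOf_apply, hw' k hk, v'1, huv k hk]; rfl)
  obtain ⟨Φ, Φ0, Φ1⟩ := exists_concat (toPaths μ (ContinuousMap.const _ (D.h (b, 1)))) κ
    (fun k => by
      rw [toPaths_eq_iff, κ0]
      exact ⟨μ1 k, fun s => ((w'c k).2 s).symm⟩)
  have hμF : ∀ p, toPaths μ (ContinuousMap.const _ (D.h (b, 1))) p ∈
      hoFiber f {D.h (b, 1)} (D.h (b, 1)) := fun p => by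
    rw [mem_hoFiber_singleton]
    exact ⟨μF p, fun _ => rfl⟩
  have hbA : ({D.h (b, 1)} : Set Y) ⊆ A := by simpa using D.h_one_mem b
  have ΦF : ∀ p, Φ p ∈ hoFiber f A (D.h (b, 1)) := by
    rintro ⟨s, k⟩
    obtain ⟨t, rfl⟩ | ⟨t, rfl⟩ := exists_half s
    · rw [Φ0]; exact hoFiber_mono hbA _ (hμF _)
    · rw [Φ1]; exact κF _
  have Φz : ∀ k, (Φ (0, k)).1 = D.H (w k, 1) ∧ ∀ s, (Φ (0, k)).2 s = D.h (b, 1) := fun k => by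
    rw [← lowerHalf_zero, Φ0]
    exact ⟨μ0 k, fun s => rfl⟩
  have Φe : ∀ k, Φ (1, k) = v' k := fun k => by
    rw [← upperHalf_one, Φ1, κ1]
  have Φb : ∀ r, ∀ k ∈ bd (Fin n → I), Φ (r, k) = v' k := by
    intro s k hk
    obtain ⟨t, rfl⟩ | ⟨t, rfl⟩ := exists_half s
    · rw [Φ0, ← hw' k hk, toPaths_eq_iff]
      exact ⟨μb t k hk, fun s => ((w'c k).2 s).symm⟩
    · rw [Φ1, κb t k hk]
  let c : C(Fin n → I, X × C(I, Y)) := toPaths w (ContinuousMap.const _ b)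
  have hcv : ∀ k ∈ bd (Fin n → I), v k = c k := fun k hk => by
    rw [huv k hk, eq_comm, toPaths_eq_iff]
    exact ⟨hw k hk, fun s => ((huc k hk).2 s).symm⟩
  have hcF : ∀ k, c k ∈ hoFiber f {b} b := fun k =>
    mem_hoFiber_singleton.2 ⟨hwF k, fun _ => rfl⟩
  let B : I × (Fin n → I) → X × C(I, Y) :=
    glue Prod.fst (fun p => c p.2) (fun p => v p.2) fun p => v p.2
  have B0 : ∀ k, B (0, k) = c k := fun k => glue_of_zero (p := ((0 : I), k)) rfl
  have B1 : ∀ k, B (1, k) = v k := fun k => glue_of_one (p := ((1 : I), k)) rfl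
  have Bb : ∀ s, ∀ k ∈ bd (Fin n → I), B (s, k) = v k := fun s k hk =>
    glue_of_agree (p := (s, k)) (by rintro rfl; exact hcv k hk) fun _ => rfl
  have hBc : ContinuousOn B (bd (I × (Fin n → I))) :=
    continuousOn_glue continuous_fst (isClosed_bd.preimage continuous_snd) (by fun_prop)
      (by fun_prop) (by fun_prop) (by rintro ⟨s, k⟩ hk rfl; exact hcv k hk) (fun _ _ _ => rfl)
  -- Both compressions concatenate to a homotopy `Φ` from the image of `c` to that of `v`; the
  -- extension property lifts it to one from `c` to `v`.
  obtain ⟨Ψ, ΨF, hΨ⟩ := D.exists_extension (K := I × (Fin n → I)) B hBc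
    (by
      rintro ⟨s, k⟩ (rfl | rfl | hk)
      · rw [B0]; exact hoFiber_mono (Set.subset_univ _) _ (hcF k)
      · rw [B1]; exact hvF k
      · rw [Bb s k hk]; exact hvF k) Φ ΦF
    (by
      rintro ⟨s, k⟩ (rfl | rfl | hk)
      · rw [B0]; exact (Φz k).1
      · rw [B1, Φe, v'1]
      · rw [Bb s k hk, Φb s k hk, v'1])
    (by
      rintro ⟨s, k⟩ (rfl | rfl | hk) t
      · rw [B0]; exact (Φz k).2 t
      · rw [B1, Φe, v'2]
      · rw [Bb s k hk, Φb s k hk, v'2])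
  refine ⟨c, hcF, fun k hk => (hcv k hk).symm.trans (huv k hk), Ψ, fun k => ?_, fun k => ?_,
    fun s k hk => ?_, ΨF⟩
  · rw [hΨ _ (Or.inl rfl), B0]; rfl
  · rw [hΨ _ (Or.inr (Or.inl rfl)), B1]
  · rw [hΨ _ (Or.inr (Or.inr hk)), Bb s k hk]

theorem we_fiber {b : Y} (hb : IsWeakEquivalence (D.fiberMap b))
    (hne : (f ⁻¹' {b}).Nonempty) :
    WE (D.H.comp ⟨fun x => (x, 1), by fun_prop⟩) (f ⁻¹' {b}) (f ⁻¹' {D.h (b, 1)}) := by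
  have : Nonempty (f ⁻¹' {b}) := hne.to_subtype
  intro n u v hu huF hvF huv
  have hb' := hb.we
  obtain ⟨x₀, hx₀⟩ := hne
  -- Off the boundary `u` may leave the fibre; the default `x₀` there is never used.
  let u' : (Fin n → I) → f ⁻¹' {b} := fun k => open Classical in
    if h : u k ∈ f ⁻¹' {b} then ⟨u k, h⟩ else ⟨x₀, hx₀⟩
  have hu' : ∀ k ∈ bd (Fin n → I), (u' k : X) = u k := fun k hk => by
    simp only [u', dif_pos (huF k hk)]
  obtain ⟨w, -, hw, κ, κ0, κ1, κb, -⟩ := hb' n u'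
    ⟨fun k => ⟨v k, hvF k⟩, by fun_prop⟩
    (Topology.IsInducing.subtypeVal.continuousOn_iff.2 (hu.congr hu')) (fun _ _ => trivial)
    (fun _ => trivial) (fun k hk => Subtype.ext (by
      change v k = D.H (u' k, 1)
      rw [hu' k hk]; exact huv k hk))
  refine ⟨⟨fun k => w k, by fun_prop⟩, fun k => (w k).2, fun k hk => ?_,
    ⟨fun p => κ p, by fun_prop⟩, fun k => ?_, fun k => ?_, fun s k hk => ?_, fun p => (κ p).2⟩
  · exact (congrArg Subtype.val (hw k hk)).trans (hu' k hk)
  · exact congrArg Subtype.val (κ0 k)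
  · exact congrArg Subtype.val (κ1 k)
  · exact congrArg Subtype.val (κb s k hk)

end Deformation

/-! ### Products in homotopy groups -/

section Products
variable {X : Type*} [TopologicalSpace X]

theorem transAt_update_lower {N : Type*} [DecidableEq N] {x : X} (i : N) (p q : Ω^ N X x)
    (t : N → I) (s : I) (h : t i = lowerHalf s) :
    GenLoop.transAt i p q t = p (Function.update t i s) := by
  have h1 : (t i : ℝ) ≤ 1 / 2 := by
    have := s.2.2
    rw [h]; simp only [lowerHalf]; linarith
  have h2 : Set.projIcc (0 : ℝ) 1 zero_le_one (2 * (t i : ℝ)) = s := by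
    rw [h]
    have : 2 * ((lowerHalf s : I) : ℝ) = s := by simp only [lowerHalf]; ring
    rw [this, Set.projIcc_val]
  simp only [GenLoop.transAt, GenLoop.coe_copy, if_pos h1, h2]

theorem transAt_update_upper {N : Type*} [DecidableEq N] {x : X} (i : N) (p q : Ω^ N X x)
    (t : N → I) (s : I) (h : t i = upperHalf s) :
    GenLoop.transAt i p q t = q (Function.update t i s) := by
  by_cases hs : s = 0
  · subst hs
    rw [transAt_update_lower i p q t 1 (by rw [h, lowerHalf_one])]
    exact (p.2 _ ⟨i, Or.inr (Function.update_self ..)⟩).trans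
      (q.2 _ ⟨i, Or.inl (Function.update_self ..)⟩).symm
  have h1 : ¬ (t i : ℝ) ≤ 1 / 2 := by
    have h0 := lt_of_le_of_ne s.2.1 fun h => hs (Subtype.ext h.symm)
    rw [h]; simp only [upperHalf]; linarith
  have h2 : Set.projIcc (0 : ℝ) 1 zero_le_one (2 * (t i : ℝ) - 1) = s := by
    rw [h]
    have : 2 * ((upperHalf s : I) : ℝ) - 1 = s := by simp only [upperHalf]; ring
    rw [this, Set.projIcc_val]
  simp only [GenLoop.transAt, GenLoop.coe_copy, if_neg h1, h2]

/-- A loop which is a concatenation in the direction `i` represents the product. -/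
theorem piMk_mul_piMk {n : ℕ} {x : X} (i : Fin (n + 1)) {p q r : Ω^ (Fin (n + 1)) X x}
    (h0 : ∀ t s, t i = lowerHalf s → r t = q (Function.update t i s))
    (h1 : ∀ t s, t i = upperHalf s → r t = p (Function.update t i s)) :
    piMk p * piMk q = piMk r := by
  have : r = GenLoop.transAt i q p := by
    refine GenLoop.ext _ _ fun t => ?_
    obtain ⟨s, hs⟩ | ⟨s, hs⟩ := exists_half (t i)
    · rw [transAt_update_lower i q p t s hs, h0 t s hs]
    · rw [transAt_update_upper i q p t s hs, h1 t s hs]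
  rw [this]
  exact HomotopyGroup.mul_spec

theorem piMk_mul_piMk_zero {n : ℕ} {x : X} {p q r : Ω^ (Fin (n + 1)) X x}
    (h0 : ∀ s k, r (Fin.cons (lowerHalf s) k) = q (Fin.cons s k))
    (h1 : ∀ s k, r (Fin.cons (upperHalf s) k) = p (Fin.cons s k)) :
    piMk p * piMk q = piMk r := by
  refine piMk_mul_piMk 0 (fun t s hs => ?_) fun t s hs => ?_
  · rw [← Fin.cons_self_tail t, Fin.update_cons_zero, hs, h0]
  · rw [← Fin.cons_self_tail t, Fin.update_cons_zero, hs, h1]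

/-- Relative loops cannot be multiplied in their first coordinate, which ends at the free face, so
products are also needed in the second. -/
theorem piMk_mul_piMk_one {n : ℕ} {x : X} {p q r : Ω^ (Fin (n + 2)) X x}
    (h0 : ∀ a s k, r (Fin.cons a (Fin.cons (lowerHalf s) k)) = q (Fin.cons a (Fin.cons s k)))
    (h1 : ∀ a s k, r (Fin.cons a (Fin.cons (upperHalf s) k)) = p (Fin.cons a (Fin.cons s k))) :
    piMk p * piMk q = piMk r := by
  have key : ∀ (a b : I) (k : Fin n → I) (s : I), Function.update
      (Fin.cons a (Fin.cons b k : Fin (n + 1) → I) : Fin (n + 2) → I) 1 s =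
        Fin.cons a (Fin.cons s k) := fun a b k s => by
    rw [show (1 : Fin (n + 2)) = Fin.succ 0 from rfl, ← Fin.cons_update, Fin.update_cons_zero]
  have hd : ∀ t : Fin (n + 2) → I, t = Fin.cons (t 0) (Fin.cons (t 1) (Fin.tail (Fin.tail t))) :=
    fun t => by
      conv_lhs => rw [← Fin.cons_self_tail t, ← Fin.cons_self_tail (Fin.tail t)]
      rfl
  refine piMk_mul_piMk 1 (fun t s hs => ?_) fun t s hs => ?_
  · rw [hd t, key, hs, h0]
  · rw [hd t, key, hs, h1]

theorem piBase_eq_one (n : ℕ) (x : X) : piBase (n + 1) x = 1 := rfl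

end Products

theorem LiftRel.of_homeo {A B : Type*} [TopologicalSpace A] [TopologicalSpace B] {K K' : Type}
    [TopologicalSpace K] [CubeSpace K] [TopologicalSpace K']
    [CubeSpace K'] (e : K ≃ₜ K') (he : ∀ k, k ∈ bd K ↔ e k ∈ bd K') {g : C(A, B)} {Q : Set A}
    {P : Set B} {u : K' → A} {v : C(K', B)} (h : LiftRel g Q P u v) :
    LiftRel g Q P (u ∘ e) (v.comp e) := by
  obtain ⟨w, hwQ, hw, κ, h0, h1, hb, hκP⟩ := h
  refine ⟨w.comp e, fun k => hwQ _, fun k hk => ?_,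
    κ.comp ((ContinuousMap.id I).prodMap e), fun k => ?_, fun k => ?_, fun s k hk => ?_,
    fun p => hκP _⟩
  · simpa using hw _ ((he k).1 hk)
  · simpa using h0 (e k)
  · simpa using h1 (e k)
  · simpa using hb s _ ((he k).1 hk)

theorem LiftRel.of_mem {A : Type*} [TopologicalSpace A] {K : Type} [TopologicalSpace K]
    [CubeSpace K] {Q P : Set A} (hQP : Q ⊆ P) {u : K → A} {v : C(K, A)} (hv : ∀ k, v k ∈ Q)
    (huv : ∀ k ∈ bd K, v k = u k) : LiftRel (ContinuousMap.id A) Q P u v :=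
  ⟨v, hv, huv, v.comp ⟨Prod.snd, by fun_prop⟩, fun _ => rfl, fun _ => rfl, fun _ _ _ => rfl,
    fun _ => hQP (hv _)⟩

/-! ### The fibres of a c-quasifibration -/

namespace IsLongExact
variable {X : Type u} {Y : Type v} [TopologicalSpace X] [TopologicalSpace Y] {f : C(X, Y)}
  {y : Y} {x : f ⁻¹' {y}} {conn : ∀ q : ℕ, π_ (q + 1) Y y → π_ q (f ⁻¹' {y}) x}

theorem conn_base (h : IsLongExact f y x conn) (n : ℕ) : conn n (piBase (n + 1) y) = piBase n x :=
  (h.exact_base n _).2 ⟨piBase (n + 1) (x : X), congrArg piMk (GenLoop.ext _ _ fun _ => x.2)⟩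

/-- The coset form of exactness at the base in every degree: it is a separate clause for π_1, and
follows from the homomorphism property above. -/
theorem exists_mul_of_conn_eq (h : IsLongExact f y x conn) (n : ℕ) (c d : π_ (n + 1) Y y)
    (hcd : conn n d = conn n c) : ∃ b, c = piMap (n + 1) f (x := (x : X)) x.2 b * d := by
  cases n with
  | zero => exact (h.exact_base_coset d c).1 hcd
  | succ n =>
    have h1 : conn (n + 1) (c * d⁻¹) = piBase (n + 1) x := by
      have h2 := h.map_mul n (c * d⁻¹) d
      rw [inv_mul_cancel_right, hcd] at h2
      rw [piBase_eq_one]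
      exact (mul_eq_right.1 h2.symm)
    obtain ⟨b, hb⟩ := (h.exact_base (n + 1) _).1 h1
    exact ⟨b, by rw [hb, inv_mul_cancel_right]⟩

end IsLongExact

/-! ### Relative loops as maps on I × I^n. -/

section RelLoops
variable {X : Type u} {Y : Type v} [TopologicalSpace X] [TopologicalSpace Y]

/-- The relative loop given by a map on `I × I^n`. -/
def relLoopOfProd {n : ℕ} {A : Set X} {x : X} (d : C(I × (Fin n → I), X))
    (h0 : ∀ k, d (0, k) ∈ A) (h1 : ∀ k, d (1, k) = x)
    (hb : ∀ s, ∀ k ∈ bd (Fin n → I), d (s, k) = x) : RelLoop n A x :=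
  ⟨d.comp (cubeCons n).symm, fun t ht => by
    change d ((cubeCons n).symm t) ∈ A
    rw [cubeCons_symm_apply, ht]; exact h0 _, fun t ht => by
    change d ((cubeCons n).symm t) = x
    rw [cubeCons_symm_apply]
    rcases ht with ht | ht
    · rw [ht]; exact h1 _
    · exact hb _ _ ht⟩

theorem relLoopOfProd_cons {n : ℕ} {A : Set X} {x : X} (d : C(I × (Fin n → I), X))
    (h0 : ∀ k, d (0, k) ∈ A) (h1 : ∀ k, d (1, k) = x)
    (hb : ∀ s, ∀ k ∈ bd (Fin n → I), d (s, k) = x) (s : I) (k : Fin n → I) :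
    (relLoopOfProd d h0 h1 hb).1 (Fin.cons s k) = d (s, k) := by
  change d ((cubeCons n).symm (Fin.cons s k)) = _
  rw [cubeCons_symm_apply]
  simp

/-- The class of a relative loop. -/
def relMk {n : ℕ} {A : Set X} {x : X} (p : RelLoop n A x) : RelPi n A x :=
  Quotient.mk (RelLoop.setoid n A x) p

theorem relMk_surjective {n : ℕ} {A : Set X} {x : X} (r : RelPi n A x) : ∃ p, relMk p = r :=
  Quotient.exists_rep r

/-- The image of a relative loop under a map which sends the subspace to a point. -/
def RelLoop.map {n : ℕ} (f : C(X, Y)) {A : Set X} (x : A) {y : Y} (hA : ∀ a ∈ A, f a = y)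
    (p : RelLoop n A (x : X)) : Ω^ (Fin (n + 1)) Y y :=
  ⟨f.comp p.1, fun _ ht => RelLoop.map_boundary f hA x.2 p.2 ht⟩

theorem RelLoop.map_apply {n : ℕ} (f : C(X, Y)) {A : Set X} (x : A) {y : Y} (hA : ∀ a ∈ A, f a = y)
    (p : RelLoop n A (x : X)) (t) : RelLoop.map f x hA p t = f (p.1 t) := rfl

theorem RelLoop.face_apply {n : ℕ} {A : Set X} {x : A} (p : RelLoop n A (x : X)) (t) :
    ((RelLoop.face n A x p t : A) : X) = p.1 (Fin.cons 0 t) := rfl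

theorem RelLoop.cons_eq {n : ℕ} {A : Set X} {x : X} (p : RelLoop n A x) {s : I} {k : Fin n → I}
    (h : s = 1 ∨ k ∈ bd (Fin n → I)) : p.1 (Fin.cons s k) = x :=
  p.2.2 _ (h.imp id fun ⟨i, hi⟩ => ⟨i, by simpa using hi⟩)

end RelLoops

/-! ### The fibres of a c-quasifibration are equivalent to the homotopy fibres -/

section FiberEquivOfExact
variable {X : Type u} {Y : Type v} [TopologicalSpace X] [TopologicalSpace Y] {f : C(X, Y)}
  {y : Y}

theorem mem_hoFiber_univ {b : Y} {z : X × C(I, Y)} :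
    z ∈ hoFiber f Set.univ b ↔ z.2 0 = f z.1 ∧ z.2 1 = b :=
  ⟨fun h => ⟨h.1.1, h.2⟩, fun h => ⟨⟨h.1, fun _ => trivial⟩, h.2⟩⟩

theorem hoFiber_singleton_subset :
    ∀ z ∈ hoFiber f {y} y, ContinuousMap.id _ z ∈ hoFiber f Set.univ y :=
  fun _ hz => hoFiber_mono (Set.subset_univ _) _ hz

theorem apply_of_mem_fiber (f : C(X, Y)) (y : Y) : ∀ a ∈ f ⁻¹' {y}, f a = y := fun _ ha => ha

/-- The connecting map moves a loop in the base into the fibre. -/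
theorem liftRel_of_loop {x : f ⁻¹' {y}} {conn : ∀ q : ℕ, π_ (q + 1) Y y → π_ q (f ⁻¹' {y}) x}
    (h : IsLongExact f y x conn) (hc : ∀ (q : ℕ) (r : RelPi q (f ⁻¹' {y}) (x : X)),
      conn q (relPiMap q f (f ⁻¹' {y}) x (fun _ ha => ha) r) = relBoundary q (f ⁻¹' {y}) x r)
    {n : ℕ} (G : C(I × (Fin n → I), Y)) (hG : ∀ p ∈ bd (I × (Fin n → I)), G p = y)
    (u : (Fin n → I) → X × C(I, Y)) (v : C(Fin n → I, X × C(I, Y)))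
    (hu : ∀ k ∈ bd (Fin n → I), u k = ((x : X), ContinuousMap.const I y))
    (hv : ∀ k, v k = toPaths (ContinuousMap.const _ (x : X)) G k) :
    LiftRel (ContinuousMap.id _) (hoFiber f {y} y) (hoFiber f Set.univ y) u v := by
  have hx : f x = y := x.2
  -- Path lifts start at x at time 0, whereas relative loops reach x at time 1; hence the reversal.
  let c := loopOfProd (G.comp ⟨fun p => (σ p.1, p.2), by fun_prop⟩) (x := y) (by
    rintro ⟨s, k⟩ (rfl | rfl | hk)
    · exact hG _ (Or.inr (Or.inl (by simp)))
    · exact hG _ (Or.inl (by simp))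
    · exact hG _ (Or.inr (Or.inr hk)))
  have hcG : ∀ s k, c (Fin.cons s k) = G (σ s, k) := fun s k => loopOfProd_cons _ _ s k
  obtain ⟨p, hp⟩ := piMk_surjective (conn n (piMk c))
  -- The boundary class of `c` dies in X, and a nullhomotopy is a relative loop `r` with this
  -- boundary. Compatibility with the boundary map of the pair shows that f ∘ r and `c` have the
  -- same image under `conn`, so they differ by a loop `b` of X.
  have hnull := (h.exact_fiber n (piMk p)).2 ⟨_, hp.symm⟩
  obtain ⟨N, N0, N1, Nb⟩ := piMk_eq_iff.1 hnull
  have N0' : ∀ k, N (0, k) = p k := N0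
  have N1' : ∀ k, N (1, k) = x := N1
  let r := relLoopOfProd (A := f ⁻¹' {y}) (x := (x : X)) N (fun k => by rw [N0']; exact (p k).2) N1' Nb
  have hr : ∀ s k, r.1 (Fin.cons s k) = N (s, k) := fun s k => relLoopOfProd_cons _ _ _ _ s k
  have hface : relBoundary n (f ⁻¹' {y}) x (relMk r) = piMk p := by
    exact congrArg piMk (GenLoop.ext _ _ fun k => Subtype.ext ((hr 0 k).trans (N0' k)))
  have hconn : conn n (piMk (RelLoop.map f x (apply_of_mem_fiber f y) r)) = conn n (piMk c) := by
    rw [← hp, ← hface]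
    exact hc n (relMk r)
  obtain ⟨b', hb⟩ := h.exists_mul_of_conn_eq n _ _ hconn
  obtain ⟨b, rfl⟩ := piMk_surjective b'
  obtain ⟨R, R0, R1⟩ := exists_concat N (GenLoop.toProd b) (fun k => by
    rw [N1', GenLoop.toProd_apply, GenLoop.cons_eq b (Or.inl rfl)])
  have hRF : ∀ k, f (R (0, k)) = y := fun k => by
    rw [← lowerHalf_zero, R0, N0']; exact (p k).2
  have hRx : ∀ k, R (1, k) = x := fun k => by
    rw [← upperHalf_one, R1, GenLoop.toProd_apply, GenLoop.cons_eq b (Or.inr (Or.inl rfl))]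
  have hRb : ∀ s, ∀ k ∈ bd (Fin n → I), R (s, k) = x := by
    intro s k hk
    obtain ⟨t, rfl⟩ | ⟨t, rfl⟩ := exists_half s
    · rw [R0]; exact Nb t k hk
    · rw [R1, GenLoop.toProd_apply, GenLoop.cons_eq b (Or.inr (Or.inr hk))]
  let fR := loopOfProd (f.comp R) (x := y) (by
    rintro ⟨s, k⟩ (rfl | rfl | hk)
    · exact hRF k
    · exact (congrArg f (hRx k)).trans hx
    · exact (congrArg f (hRb s k hk)).trans hx)
  have hfR : ∀ s k, fR (Fin.cons s k) = f (R (s, k)) := fun s k => loopOfProd_cons _ _ s k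
  have hprod : piMk (genLoopMap (n + 1) f (x := (x : X)) hx b) *
      piMk (RelLoop.map f x (apply_of_mem_fiber f y) r) = piMk fR :=
    piMk_mul_piMk_zero (fun s k => by rw [hfR, R0, RelLoop.map_apply, hr])
      (fun s k => by rw [hfR, R1, genLoopMap_apply, GenLoop.toProd_apply])
  have hfc : piMk fR = piMk c := by rw [← hprod, hb]; rfl
  obtain ⟨Θ, Θ0, Θ1, Θb⟩ := piMk_eq_iff.1 hfc
  have Θb' : ∀ θ s k, s = 0 ∨ s = 1 ∨ k ∈ bd (Fin n → I) → Θ (θ, Fin.cons s k) = y :=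
    fun θ s k h => Θb θ _ ((cubeCons_mem_boundary n (s, k)).2 h)
  have Θ0' : ∀ s k, Θ (0, Fin.cons s k) = f (R (s, k)) := fun s k => (Θ0 _).trans (hfR s k)
  have Θ1' : ∀ s k, Θ (1, Fin.cons s k) = G (σ s, k) := fun s k => (Θ1 _).trans (hcG s k)
  have hcons : Continuous fun p : I × (I × (Fin n → I)) =>
      (σ p.2.1, (Fin.cons (σ p.1) p.2.2 : Fin (n + 1) → I)) :=
    (by fun_prop : Continuous fun p : I × (I × (Fin n → I)) => σ p.2.1).prodMk
      (Continuous.finCons (by fun_prop) (by fun_prop))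
  have hpt : ((x : X), ContinuousMap.const I y) ∈ hoFiber f {y} y :=
    mem_hoFiber_singleton.2 ⟨hx, fun _ => rfl⟩
  have hub : ∀ k ∈ bd (Fin n → I), u k ∈ hoFiber f {y} y := fun k hk => by rw [hu k hk]; exact hpt
  have huc : ContinuousOn (fun p : I × (Fin n → I) => u p.2) {p | p.2 ∈ bd (Fin n → I)} :=
    (continuousOn_const (c := ((x : X), ContinuousMap.const I y))).congr fun p hp => hu _ hp
  let V₁ : C(I × (Fin n → I), X × C(I, Y)) :=
    toPaths (ContinuousMap.const _ (x : X)) (Θ.comp ⟨_, hcons⟩)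
  have hV₁ : ∀ θ k s, (V₁ (θ, k)).2 s = Θ (σ θ, Fin.cons (σ s) k) := fun _ _ _ => rfl
  -- With the point kept at x, the loop `G` is first replaced by f ∘ R reversed, where `R` is `r`
  -- followed by `b`.
  refine LiftRel.of_homotopy (v₁ := toPaths (ContinuousMap.const _ (x : X))
    ((f.comp R).comp ⟨fun p => (σ p.1, p.2), by fun_prop⟩)) (u₁ := u) hoFiber_singleton_subset
    (fun p => u p.2) huc (fun _ => hub) V₁ (fun p => ?_) (fun s k hk => ?_) (fun _ _ => rfl)
    (fun _ _ => rfl) (fun k => ?_) (fun k => ?_) ?_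
  · rw [mem_hoFiber_univ, hV₁, hV₁, Θb' _ _ _ (by simp), Θb' _ _ _ (by simp)]
    exact ⟨hx.symm, rfl⟩
  · rw [hu k hk]
    refine Prod.ext rfl (ContinuousMap.ext fun t => ?_)
    rw [hV₁, Θb' _ _ _ (Or.inr (Or.inr hk))]; rfl
  · rw [hv, eq_comm, toPaths_eq_iff]
    refine ⟨rfl, fun s => ?_⟩
    rw [hV₁]; simp [Θ1']
  · rw [eq_comm, toPaths_eq_iff]
    refine ⟨rfl, fun s => ?_⟩
    rw [hV₁]; simp [Θ0']
  -- The point then slides along `R` into the fibre while its path shrinks to a constant.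
  · let V₂ : C(I × (Fin n → I), X × C(I, Y)) := toPaths ⟨fun p => R (σ p.1, p.2), by fun_prop⟩
      ⟨fun p => f (R (σ p.2.1 * σ p.1, p.2.2)), by fun_prop⟩
    have hV₂ : ∀ r k s, (V₂ (r, k)).2 s = f (R (σ r * σ s, k)) := fun _ _ _ => rfl
    have hV₂' : ∀ r k, (V₂ (r, k)).1 = R (σ r, k) := fun _ _ => rfl
    refine LiftRel.of_homotopy (v₁ := V₂.comp ⟨fun k => (1, k), by fun_prop⟩)
      (u₁ := u) hoFiber_singleton_subset
      (fun p => u p.2) huc (fun _ => hub) V₂ (fun p => ?_) (fun s k hk => ?_) (fun _ _ => rfl)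
      (fun _ _ => rfl) (fun k => ?_) (fun k => rfl) ?_
    · rw [mem_hoFiber_univ, hV₂, hV₂, hV₂']
      simp [hRF]
    · rw [hu k hk]
      refine Prod.ext (hRb _ k hk) (ContinuousMap.ext fun t => ?_)
      rw [hV₂, hRb _ k hk]; exact hx
    · rw [eq_comm, toPaths_eq_iff]
      refine ⟨?_, fun s => ?_⟩
      · rw [hV₂']; simp [hRx]
      · rw [hV₂]; simp
    · have hk1 : ∀ k, (V₂.comp ⟨fun k => (1, k), by fun_prop⟩) k = V₂ (1, k) := fun _ => rfl
      refine LiftRel.of_mem (hoFiber_mono (Set.subset_univ _) _) (fun k => ?_) fun k hk => ?_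
      · rw [hk1, mem_hoFiber_singleton, hV₂']
        refine ⟨by simp [hRF], fun s => ?_⟩
        rw [hV₂]; simp [hRF]
      · rw [hu k hk]
        refine Prod.ext (hRb _ k hk) (ContinuousMap.ext fun t => ?_)
        rw [hk1, hV₂, hRb _ k hk]; exact hx

theorem IsCQuasifibration.fiberEquiv {S : Set Y} (hf : IsCQuasifibration f S) (hy : y ∈ S) :
    FiberEquiv f Set.univ y := by
  refine WE.of_prod ?_ fun n => ?_
  · intro u v hu huF hvF huv
    have hbd : ∀ k, k ∉ bd (Fin 0 → I) := fun k ⟨i, _⟩ => i.elim0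
    obtain ⟨x₀, hx₀⟩ := hf.surjective y
    obtain ⟨conn, h, hc⟩ := hf.exists_conn y hy ⟨x₀, hx₀⟩
    have hv := fun k => mem_hoFiber_univ.1 (hvF k)
    -- Exactness at π_0(X) joins the point of `v` to the fibre. What remains is a loop based at the
    -- point reached there, so the exact sequence at this new base point `x` is used.
    obtain ⟨a, ha⟩ := (h.exact_total 0 (piMk ⟨ptOf v, fun k hk => absurd hk (hbd k)⟩)).1
      (piMk_eq_iff.2 ⟨pathOf v, fun k => (hv k).1, fun k => (hv k).2,
        fun s k hk => absurd hk (hbd k)⟩)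
    obtain ⟨p, rfl⟩ := piMk_surjective a
    obtain ⟨N, N0, N1, -⟩ := piMk_eq_iff.1 ha
    have N0' : ∀ k, N (0, k) = p k := N0
    have N1' : ∀ k, N (1, k) = (v k).1 := N1
    obtain ⟨G, g0, g1, g2, -⟩ := exists_fill₂ (K := Fin 0 → I) (pathOf v)
      ⟨fun q => f (N (σ q.1, q.2)), by fun_prop⟩ (ContinuousMap.const _ y) (fun _ => y)
      continuousOn_const Set.univ (fun k => by simp [N1', (hv k).1])
      (fun k => by simp [(hv k).2]) (fun t k hk => absurd hk (hbd k))
      (fun t k hk => absurd hk (hbd k)) (fun t k hk => absurd hk (hbd k)) (fun _ => trivial)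
      (fun _ => trivial) (fun _ => trivial) (fun _ _ _ _ => trivial)
    have hpF : ∀ k, f (p k) = y := fun k => (p k).2
    let x : f ⁻¹' {y} := p 0
    obtain ⟨conn', h', hc'⟩ := hf.exists_conn y hy x
    have hp : ∀ k, p k = x := fun k => congrArg p (Subsingleton.elim _ _)
    let V : C(I × (Fin 0 → I), X × C(I, Y)) := toPaths ⟨fun q => N (σ q.1, q.2), by fun_prop⟩
      ⟨fun q => G (q.2.1, (q.1, q.2.2)), by fun_prop⟩
    have hV : ∀ θ k s, (V (θ, k)).2 s = G (θ, (s, k)) := fun _ _ _ => rfl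
    have hV' : ∀ θ k, (V (θ, k)).1 = N (σ θ, k) := fun _ _ => rfl
    refine LiftRel.of_homotopy (u₁ := u) (v₁ := V.comp ⟨fun k => (1, k), by fun_prop⟩)
      hoFiber_singleton_subset (fun p => u p.2)
      (fun q hq => absurd hq (hbd _)) (fun s k hk => absurd hk (hbd k)) V (fun q => ?_)
      (fun s k hk => absurd hk (hbd k)) (fun _ _ => rfl) (fun _ _ => rfl) (fun k => ?_)
      (fun _ => rfl) ?_
    · rw [mem_hoFiber_univ, hV, hV, hV', g1, g2]
      exact ⟨rfl, rfl⟩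
    · refine Prod.ext ?_ (ContinuousMap.ext fun s => ?_)
      · rw [hV']; simp [N1']
      · rw [hV]; simp [g0]
    · refine liftRel_of_loop h' hc' (G.comp ⟨fun q => (1, q), by fun_prop⟩) ?_ u _
        (fun k hk => absurd hk (hbd k)) fun k => ?_
      · rintro ⟨s, k⟩ (rfl | rfl | hk)
        · simp [g1, N0', hpF]
        · simp [g2]
        · exact absurd hk (hbd k)
      · rw [eq_comm, toPaths_eq_iff]
        refine ⟨?_, fun s => rfl⟩
        change _ = (V (1, k)).1
        rw [hV']
        simp [N0', hp k]
  · intro u v hu huF hvF huv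
    have huv : ∀ k ∈ bd (I × (Fin n → I)), v k = u k := huv
    obtain ⟨p₀, hp₀, hn⟩ := exists_boundary_normalization (Fin n → I) _ u hu huF
    obtain ⟨U, φ, hUc, hUF, hU0, hU1, hU2, hU3⟩ := hn (u p₀) (JoinedIn.refl (huF _ hp₀))
    obtain ⟨hx, hx'⟩ := mem_hoFiber_singleton.1 (huF _ hp₀)
    let x : f ⁻¹' {y} := ⟨(u p₀).1, hx⟩
    obtain ⟨conn, h, hc⟩ := hf.exists_conn y hy x
    let a : X × C(I, Y) := ((x : X), ContinuousMap.const I y)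
    have hua : u p₀ = a := Prod.ext rfl (ContinuousMap.ext hx')
    have haF : a ∈ hoFiber f {y} y := hua ▸ huF _ hp₀
    rw [hua] at hU2 hU3
    refine LiftRel.of_boundary_homotopy hoFiber_singleton_subset U hUc hUF hU0
      (u₁ := fun p => U (1, p)) (fun p hp => rfl) huv hvF fun v₁ hv₁F hv₁ => ?_
    have hv₁ : ∀ p ∈ bd (I × (Fin n → I)), v₁ p = U (1, p) := hv₁
    have hv₁u := fun p => mem_hoFiber_univ.1 (hv₁F p)
    have hv₁F' : ∀ p ∈ bd (I × (Fin n → I)), f (v₁ p).1 = y ∧ ∀ s, (v₁ p).2 s = y := fun p hp =>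
      mem_hoFiber_singleton.1 (by rw [hv₁ p hp]; exact hUF 1 p hp)
    have hv1 : ∀ k, v₁ (1, k) = a := fun k => (hv₁ _ (Or.inr (Or.inl rfl))).trans (hU2 k)
    have hvb : ∀ t, ∀ k ∈ bd (Fin n → I), v₁ (t, k) = a := fun t k hk =>
      (hv₁ _ (Or.inr (Or.inr hk))).trans (hU3 t k hk)
    -- The points of `v₁` form a relative loop and its paths a nullhomotopy of the image in Y. Hence
    -- the free face is null in the fibre, and the boundary can be made constant.
    let r := relLoopOfProd (A := f ⁻¹' {y}) (x := (x : X)) (ptOf v₁)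
      (fun k => (hv₁F' (0, k) (Or.inl rfl)).1) (fun k => by simp [hv1, a])
      (fun s k hk => by simp [hvb s k hk, a])
    have hr : ∀ s k, r.1 (Fin.cons s k) = (v₁ (s, k)).1 := fun s k =>
      relLoopOfProd_cons _ _ _ _ s k
    have hnull : piMk (RelLoop.map f x (apply_of_mem_fiber f y) r) = piBase (n + 1) y := by
      rw [piBase_eq, piMk_eq_iff]
      refine ⟨⟨fun p => (v₁ ((cubeCons n).symm p.2)).2 p.1, by fun_prop⟩, fun k => ?_, fun k => ?_,
        fun s k hk => ?_⟩
      · exact (hv₁u _).1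
      · exact (hv₁u _).2
      · refine (hv₁F' _ ?_).2 s
        have := cubeCons_mem_boundary n ((cubeCons n).symm k)
        rw [Homeomorph.apply_symm_apply] at this
        exact this.1 hk
    have hface : piMk (RelLoop.face n (f ⁻¹' {y}) x r) = piBase n x := by
      rw [← h.conn_base, ← hnull]
      exact (hc n (relMk r)).symm
    obtain ⟨N, N0, N1, Nb⟩ := piMk_eq_iff.1 hface
    have N0' : ∀ k, (N (0, k) : X) = (v₁ (0, k)).1 := fun k => by rw [N0]; exact hr 0 k
    have N1' : ∀ k, N (1, k) = x := N1
    let N' : C(I × (Fin n → I), X × C(I, Y)) :=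
      ⟨fun p => ((N p : X), ContinuousMap.const I y), by fun_prop⟩
    have hN'F : ∀ p, N' p ∈ hoFiber f {y} y := fun p =>
      mem_hoFiber_singleton.2 ⟨(N p).2, fun _ => rfl⟩
    have hN'1 : ∀ k, N' (1, k) = a := fun k => by simp [N', N1', a]
    have hN'b : ∀ s, ∀ k ∈ bd (Fin n → I), N' (s, k) = a := fun s k hk => by
      simp [N', Nb s k hk, a]
    let U' : I × (I × (Fin n → I)) → X × C(I, Y) :=
      glue (fun p => p.2.1) (fun p => N' (p.1, p.2.2)) (fun _ => a) fun _ => a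
    have e0 : ∀ s k, U' (s, (0, k)) = N' (s, k) := fun s k =>
      glue_of_zero (p := (s, ((0 : I), k))) rfl
    have e1 : ∀ s k, U' (s, (1, k)) = a := fun s k => glue_of_one (p := (s, ((1 : I), k))) rfl
    have eb : ∀ s t, ∀ k ∈ bd (Fin n → I), U' (s, (t, k)) = a := fun s t k hk =>
      glue_of_agree (p := (s, (t, k))) (by rintro rfl; exact (hN'b s k hk).symm) fun _ => rfl
    have hU'c : ContinuousOn U' {p | p.2 ∈ bd (I × (Fin n → I))} :=
      continuousOn_glue (C := {p : I × (I × (Fin n → I)) | p.2.2 ∈ bd (Fin n → I)}) (by fun_prop)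
        (isClosed_bd.preimage (by fun_prop)) (by fun_prop) continuousOn_const continuousOn_const
        (by rintro ⟨s, t, k⟩ hk rfl; exact (hN'b s k hk).symm) (fun _ _ _ => rfl)
    have hU'F : ∀ s, ∀ p ∈ bd (I × (Fin n → I)), U' (s, p) ∈ hoFiber f {y} y := by
      rintro s ⟨t, k⟩ (rfl | rfl | hk)
      · rw [e0]; exact hN'F _
      · rw [e1]; exact haF
      · rw [eb s t k hk]; exact haF
    refine LiftRel.of_boundary_homotopy hoFiber_singleton_subset U' hU'c hU'F ?_
      (u₁ := fun _ => a) ?_ hv₁ hv₁F fun v₂ hv₂F hv₂ => ?_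
    · rintro ⟨t, k⟩ (rfl | rfl | hk)
      · rw [e0, ← hv₁ (0, k) (Or.inl rfl)]
        exact Prod.ext (N0' k)
          (ContinuousMap.ext fun s => ((hv₁F' (0, k) (Or.inl rfl)).2 s).symm)
      · rw [e1, hU2]
      · rw [eb _ _ _ hk, hU3 _ _ hk]
    · rintro ⟨t, k⟩ (rfl | rfl | hk)
      · rw [e0, hN'1]
      · rw [e1]
      · rw [eb _ _ _ hk]
    have hv₂ : ∀ p ∈ bd (I × (Fin n → I)), v₂ p = a := hv₂
    have hv₂u := fun p => mem_hoFiber_univ.1 (hv₂F p)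
    let w := loopOfProd (ptOf v₂) (x := (x : X)) fun p hp => by simp [hv₂ p hp, a]
    have hw : ∀ s k, w (Fin.cons s k) = (v₂ (s, k)).1 := fun s k => loopOfProd_cons _ _ s k
    -- Now the points form a loop of X with null image, which exactness at π_{n+1}(X) deforms to a
    -- loop `b` of the fibre.
    obtain ⟨b', hb⟩ := (h.exact_total (n + 1) (piMk w)).1 (by
      refine piMk_eq_iff.2 ⟨⟨fun p => (v₂ ((cubeCons n).symm p.2)).2 p.1, by fun_prop⟩,
        fun k => (hv₂u _).1, fun k => (hv₂u _).2, fun s k hk => ?_⟩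
      change (v₂ ((cubeCons n).symm k)).2 s = y
      rw [hv₂ _ ?_]
      · rfl
      · have := cubeCons_mem_boundary n ((cubeCons n).symm k)
        rw [Homeomorph.apply_symm_apply] at this
        exact this.1 hk)
    obtain ⟨b, rfl⟩ := piMk_surjective b'
    obtain ⟨M, M0, M1, Mb⟩ := piMk_eq_iff.1 hb
    have M0' : ∀ s k, M (0, Fin.cons s k) = b (Fin.cons s k) := fun s k => M0 _
    have M1' : ∀ s k, M (1, Fin.cons s k) = (v₂ (s, k)).1 := fun s k => (M1 _).trans (hw s k)
    have hbF : ∀ k, f (b k) = y := fun k => (b k).2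
    have Mb' : ∀ θ, ∀ p ∈ bd (I × (Fin n → I)), M (θ, cubeCons n p) = x := fun θ p hp =>
      Mb θ _ ((cubeCons_mem_boundary n p).2 hp)
    have hMc : Continuous fun q : I × (I × (Fin n → I)) => M (σ q.1, cubeCons n q.2) :=
      M.continuous.comp ((by fun_prop : Continuous fun q : I × (I × (Fin n → I)) => σ q.1).prodMk
        ((cubeCons n).continuous.comp continuous_snd))
    obtain ⟨G, g0, g1, g2, g3, -⟩ := exists_fill₂ (K := I × (Fin n → I)) (pathOf v₂)
      ⟨fun q => f (M (σ q.1, cubeCons n q.2)), f.continuous.comp hMc⟩ (ContinuousMap.const _ y)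
      (fun _ => y)
      continuousOn_const Set.univ (fun k => by
        simp only [ContinuousMap.coe_mk, unitInterval.symm_zero, cubeCons_apply, M1',
          pathOf_apply, (hv₂u k).1])
      (fun k => by simp [(hv₂u k).2]) (fun t k hk => by simp [hv₂ k hk, a])
      (fun t k hk => by simp only [ContinuousMap.coe_mk, Mb' _ k hk]; exact hx.symm)
      (fun t k hk => rfl) (fun _ => trivial)
      (fun _ => trivial) (fun _ => trivial) (fun _ _ _ _ => trivial)
    simp only [ContinuousMap.coe_mk] at g1
    let V : C(I × (I × (Fin n → I)), X × C(I, Y)) :=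
      toPaths ⟨fun q => M (σ q.1, cubeCons n q.2), hMc⟩
        ⟨fun q => G (q.2.1, (q.1, q.2.2)), by fun_prop⟩
    have hV : ∀ θ k s, (V (θ, k)).2 s = G (θ, (s, k)) := fun _ _ _ => rfl
    have hV' : ∀ θ k, (V (θ, k)).1 = M (σ θ, cubeCons n k) := fun _ _ => rfl
    refine LiftRel.of_homotopy (u₁ := fun _ => a) (v₁ := V.comp ⟨fun k => (1, k), by fun_prop⟩)
      hoFiber_singleton_subset (fun _ => a) continuousOn_const (fun _ _ _ => haF) V (fun q => ?_)
      (fun s k hk => ?_) (fun _ _ => rfl) (fun _ _ => rfl) (fun k => ?_)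
      (fun _ => rfl) ?_
    · rw [mem_hoFiber_univ, hV, hV, hV', g1, g2]
      exact ⟨rfl, rfl⟩
    · exact Prod.ext (Mb' _ k hk) (ContinuousMap.ext fun t => g3 s t k hk)
    · refine Prod.ext ?_ (ContinuousMap.ext fun s => ?_)
      · rw [hV']
        simp only [unitInterval.symm_zero, cubeCons_apply, M1']
      · rw [hV]; simp [g0]
    have hbc : Continuous fun q : I × (I × (Fin n → I)) =>
        (b (Fin.cons (max q.2.1 q.1) q.2.2) : X) :=
      continuous_subtype_val.comp
        (b.1.continuous.comp (Continuous.finCons (by fun_prop) (by fun_prop)))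
    -- The loop `b` is pushed along its first coordinate to x. This stays in the fibre, so the paths
    -- need not change; the boundary moves, but within the fibre. A loop in the base remains.
    let V₃ : C(I × (I × (Fin n → I)), X × C(I, Y)) :=
      toPaths ⟨fun q => b (Fin.cons (max q.2.1 q.1) q.2.2), hbc⟩
        ⟨fun q => G (1, (q.1, q.2.2)), by fun_prop⟩
    have hV₃ : ∀ θ k s, (V₃ (θ, k)).2 s = G (1, (s, k)) := fun _ _ _ => rfl
    have hV₃' : ∀ θ k, (V₃ (θ, k)).1 = b (Fin.cons (max k.1 θ) k.2) := fun _ _ => rfl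
    have G0 : ∀ k, G (1, (0, k)) = y := fun k => by
      rw [g1, ← Prod.mk.eta (p := k), cubeCons_apply]
      simp only [unitInterval.symm_one, M0', hbF]
    have hGb : ∀ p ∈ bd (I × (I × (Fin n → I))), G (1, p) = y := by
      rintro ⟨s, k⟩ (rfl | rfl | hk)
      · exact G0 k
      · exact g2 1 k
      · exact g3 1 s k hk
    refine LiftRel.of_homotopy (u₁ := fun _ => a) (v₁ := toPaths (ContinuousMap.const _ (x : X))
      (G.comp ⟨fun q => (1, q), by fun_prop⟩))
      hoFiber_singleton_subset (fun p => V₃ p) V₃.continuous.continuousOn (fun s k hk => ?_) V₃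
      (fun q => ?_) (fun s k hk => rfl) (fun k hk => ?_) (fun k hk => ?_) (fun k => ?_)
      (fun k => ?_) ?_
    · rw [mem_hoFiber_singleton, hV₃', hbF]
      refine ⟨rfl, fun t => ?_⟩
      rw [hV₃, hGb _ (Or.inr (Or.inr hk))]
    · rw [mem_hoFiber_univ, hV₃, hV₃, hV₃', G0, g2, hbF]
      exact ⟨rfl, rfl⟩
    · refine Prod.ext ?_ (ContinuousMap.ext fun s => hGb _ (Or.inr (Or.inr hk)))
      rw [hV₃', max_eq_left (unitInterval.nonneg' : 0 ≤ k.1)]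
      exact congrArg Subtype.val (b.2 _ ((cubeCons_mem_boundary n k).2 hk))
    · refine Prod.ext ?_ (ContinuousMap.ext fun s => hGb _ (Or.inr (Or.inr hk)))
      rw [hV₃', max_eq_right (unitInterval.le_one' : k.1 ≤ 1), GenLoop.cons_eq b (Or.inr (Or.inl rfl))]
    · refine Prod.ext ?_ (ContinuousMap.ext fun s => rfl)
      rw [hV₃', max_eq_left (unitInterval.nonneg' : 0 ≤ k.1), ← M0']
      change _ = M (σ 1, cubeCons n k)
      rw [unitInterval.symm_one, cubeCons_apply]
    · refine Prod.ext ?_ (ContinuousMap.ext fun s => rfl)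
      rw [hV₃', max_eq_right (unitInterval.le_one' : k.1 ≤ 1), GenLoop.cons_eq b (Or.inr (Or.inl rfl))]
      rfl
    have hcb : ∀ k : Fin (n + 1) → I, k ∈ bd (Fin (n + 1) → I) →
        (cubeCons n).symm k ∈ bd (I × (Fin n → I)) := fun k hk => by
      have := cubeCons_mem_boundary n ((cubeCons n).symm k)
      rw [Homeomorph.apply_symm_apply] at this
      exact this.1 hk
    have hfin := liftRel_of_loop h hc (n := n + 1)
      (G.comp ⟨fun q => (1, (q.1, (cubeCons n).symm q.2)), by fun_prop⟩) (by
        rintro ⟨s, k⟩ (rfl | rfl | hk)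
        · exact G0 _
        · exact g2 1 _
        · exact g3 1 s _ (hcb k hk)) (fun _ => a) _ (fun _ _ => rfl) fun _ => rfl
    have := hfin.of_homeo (cubeCons n) fun p => (cubeCons_mem_boundary n p).symm
    refine (congrArg (LiftRel _ _ _ _) (ContinuousMap.ext fun p => ?_)).mp this
    refine Prod.ext rfl (ContinuousMap.ext fun s => Eq.symm ?_)
    change G (1, (s, p)) = G (1, (s, (cubeCons n).symm (cubeCons n p)))
    rw [Homeomorph.symm_apply_apply]

end FiberEquivOfExact

/-! ### The long exact sequence of a map whose fibres are equivalent to the homotopy fibres -/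

section ExactOfFiberEquiv
variable {X : Type u} {Y : Type v} [TopologicalSpace X] [TopologicalSpace Y] {f : C(X, Y)}
  {y : Y}

/-- Lifting of a cube, up to a homotopy which is constant on all faces but one, where it stays in
the fibre. -/
theorem FiberEquiv.exists_lift (hf : FiberEquiv f Set.univ y) {K : Type} [TopologicalSpace K]
    [CubeSpace K] (v : C(I × K, Y)) (hv : ∀ k, v (0, k) = y) (a : C(K, X)) (ha : ∀ k, f (a k) = v (1, k))
    (b : I × K → X) (hb : ContinuousOn b {p | p.2 ∈ bd K}) (hab : ∀ k ∈ bd K, b (1, k) = a k)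
    (hbv : ∀ s, ∀ k ∈ bd K, f (b (s, k)) = v (s, k)) :
    ∃ (W : C(I × K, X)) (Θ : C(I × (I × K), Y)), (∀ k, W (1, k) = a k) ∧
      (∀ s, ∀ k ∈ bd K, W (s, k) = b (s, k)) ∧ (∀ k, f (W (0, k)) = y) ∧
      (∀ p, Θ (0, p) = f (W p)) ∧ (∀ p, Θ (1, p) = v p) ∧ (∀ θ k, Θ (θ, (0, k)) = y) ∧
      (∀ θ k, Θ (θ, (1, k)) = v (1, k)) ∧ ∀ θ s, ∀ k ∈ bd K, Θ (θ, (s, k)) = v (s, k) := by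
  let c : X → X × C(I, Y) := fun x => (x, ContinuousMap.const I (f x))
  have hc : Continuous c := by
    refine continuous_id.prodMk ?_
    exact ContinuousMap.continuous_const'.comp f.continuous
  have hcs : Continuous fun p : I × K => (σ p.1, p.2) := by fun_prop
  let u : I × K → X := glue Prod.fst (fun p => a p.2) (fun p => b (σ p.1, p.2))
    fun p => b (σ p.1, p.2)
  have hu : ContinuousOn u {p | p.1 = 0 ∨ p.2 ∈ bd K} :=
    continuousOn_box (b := fun p => b (σ p.1, p.2)) a.continuous
      (hb.comp hcs.continuousOn fun p hp => hp) (fun k hk => by simp [hab k hk])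
  have hu0 : ∀ k, u (0, k) = a k := fun k => glue_of_zero (p := ((0 : I), k)) rfl
  have hub : ∀ s, ∀ k ∈ bd K, u (s, k) = b (σ s, k) := fun s k hk =>
    glue_of_agree (p := (s, k)) (by rintro rfl; simp [hab k hk]) fun _ => rfl
  have huv : ∀ p : I × K, p.1 = 0 ∨ p.2 ∈ bd K → f (u p) = v (σ p.1, p.2) := by
    rintro ⟨s, k⟩ (rfl | hk)
    · rw [hu0, ha]; simp
    · rw [hub s k hk, hbv _ k hk]
  -- `RelLift` compresses the face at 1, relative loops have their free face at 0; hence the flip by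
  -- σ. The paths of the lift provide the homotopy `Θ`.
  obtain ⟨w, hw, hwv, hw1⟩ := hf.relLift (Set.mem_univ y) K (v.comp ⟨_, hcs⟩) (fun p => c (u p))
    (hc.comp_continuousOn hu) (fun _ => trivial)
    (fun k => by simp [hv])
    (fun p hp => ⟨⟨rfl, fun _ => trivial⟩, huv p hp⟩)
    (fun k hk => ⟨rfl, fun s => by
      change f (u (1, k)) ∈ ({y} : Set Y)
      rw [huv _ (Or.inr hk)]; simp [hv]⟩)
  have hw0 : ∀ p, (w p).2 0 = f (w p).1 := fun p => (hwv p).1.1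
  have hw1' : ∀ p : I × K, (w p).2 1 = v (σ p.1, p.2) := fun p => (hwv p).2
  have hwb : ∀ p : I × K, p.1 = 0 ∨ p.2 ∈ bd K → ∀ θ, (w p).2 θ = v (σ p.1, p.2) := fun p hp θ => by
    rw [hw p hp]; exact huv p hp
  have hwf : ∀ k θ, (w (1, k)).2 θ = y := fun k => (hw1 k).2
  refine ⟨⟨fun p => (w (σ p.1, p.2)).1, by fun_prop⟩,
    ⟨fun p => (w (σ p.2.1, p.2.2)).2 p.1, by fun_prop⟩, fun k => ?_, fun s k hk => ?_, fun k => ?_,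
    fun p => hw0 _, fun p => ?_, fun θ k => ?_, fun θ k => ?_, fun θ s k hk => ?_⟩
  · simp [hw (0, k) (Or.inl rfl), c, hu0]
  · simp [hw (σ s, k) (Or.inr hk), c, hub _ k hk]
  · simp [← hw0, hwf]
  · simp [hw1']
  · simp [hwf]
  · simp [hwb (0, k) (Or.inl rfl)]
  · simp [hwb (σ s, k) (Or.inr hk)]

variable {x : f ⁻¹' {y}} {q : ℕ}

/-- A relative loop as a map on `I × I^q`. -/
def RelLoop.toProd {A : Set X} {x : X} (r : RelLoop q A x) : C(I × (Fin q → I), X) :=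
  r.1.comp (cubeCons q)

theorem RelLoop.toProd_apply {A : Set X} {x : X} (r : RelLoop q A x) (s : I) (k : Fin q → I) :
    RelLoop.toProd r (s, k) = r.1 (Fin.cons s k) := rfl

/-- The generalized loop in the base given by a relative loop. -/
def baseLoop (x : f ⁻¹' {y}) (r : RelLoop q (f ⁻¹' {y}) (x : X)) : Ω^ (Fin (q + 1)) Y y :=
  RelLoop.map f x (apply_of_mem_fiber f y) r

theorem baseLoop_apply (r : RelLoop q (f ⁻¹' {y}) (x : X)) (t) : baseLoop x r t = f (r.1 t) := rfl

theorem piMk_eq_iff_cons {Z : Type*} [TopologicalSpace Z] {z : Z} {p p' : Ω^ (Fin (q + 1)) Z z} :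
    piMk p = piMk p' ↔ ∃ κ : C(I × (I × (Fin q → I)), Z),
      (∀ t k, κ (0, (t, k)) = p (Fin.cons t k)) ∧ (∀ t k, κ (1, (t, k)) = p' (Fin.cons t k)) ∧
      ∀ s, ∀ c ∈ bd (I × (Fin q → I)), κ (s, c) = z := by
  rw [piMk_eq_iff]
  constructor
  · rintro ⟨κ, h0, h1, hb⟩
    exact ⟨κ.comp ((ContinuousMap.id I).prodMap (cubeCons q)), fun t k => h0 _, fun t k => h1 _,
      fun s c hc => hb s _ ((cubeCons_mem_boundary q c).2 hc)⟩
  · rintro ⟨κ, h0, h1, hb⟩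
    refine ⟨κ.comp ((ContinuousMap.id I).prodMap (cubeCons q).symm), fun k => ?_, fun k => ?_,
      fun s k hk => hb s _ ?_⟩
    · exact (h0 _ _).trans (congrArg p (Fin.cons_self_tail k))
    · exact (h1 _ _).trans (congrArg p' (Fin.cons_self_tail k))
    · have := cubeCons_mem_boundary q ((cubeCons q).symm k)
      rw [Homeomorph.apply_symm_apply] at this
      exact this.1 hk

/-- Surjectivity of π_{q+1}(X, F_y) → π_{q+1}(Y): the loop is lifted starting from the constant face
at 1. -/
theorem FiberEquiv.exists_relLoop (hf : FiberEquiv f Set.univ y) (c : π_ (q + 1) Y y) :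
    ∃ r : RelLoop q (f ⁻¹' {y}) (x : X), piMk (baseLoop x r) = c := by
  have hx : f x = y := x.2
  obtain ⟨c, rfl⟩ := piMk_surjective c
  obtain ⟨W, Θ, W1, Wb, W0, Θ0, Θ1, Θ2, Θ3, Θb⟩ := hf.exists_lift (GenLoop.toProd c)
    (fun k => GenLoop.cons_eq c (Or.inl rfl)) (ContinuousMap.const _ (x : X))
    (fun k => hx.trans (GenLoop.cons_eq c (Or.inr (Or.inl rfl))).symm) (fun _ => (x : X))
    continuousOn_const (fun _ _ => rfl)
    (fun s k hk => hx.trans (GenLoop.cons_eq c (Or.inr (Or.inr hk))).symm)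
  have W0 : ∀ k, W (0, k) ∈ f ⁻¹' {y} := W0
  have W1 : ∀ k, W (1, k) = x := W1
  refine ⟨relLoopOfProd W W0 W1 Wb, ?_⟩
  rw [piMk_eq_iff_cons]
  refine ⟨Θ, fun t k => ?_, fun t k => Θ1 _, ?_⟩
  · rw [baseLoop_apply, relLoopOfProd_cons, Θ0]
  · rintro s ⟨t, k⟩ (rfl | rfl | hk)
    · exact Θ2 _ _
    · exact (Θ3 _ _).trans (GenLoop.cons_eq c (Or.inr (Or.inl rfl)))
    · exact (Θb _ _ _ hk).trans (GenLoop.cons_eq c (Or.inr (Or.inr hk)))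

/-- Makes the connecting map independent of choices. The homotopy of base loops is lifted with `r`
and `r'` as two of its sides; the free face of the lift is a homotopy in the fibre. -/
theorem FiberEquiv.face_eq (hf : FiberEquiv f Set.univ y) {r r' : RelLoop q (f ⁻¹' {y}) (x : X)}
    (h : piMk (baseLoop x r) = piMk (baseLoop x r')) :
    piMk (RelLoop.face q _ x r) = piMk (RelLoop.face q _ x r') := by
  have hx : f x = y := x.2
  obtain ⟨κ, κ0, κ1, κb⟩ := piMk_eq_iff_cons.1 h
  have hcc : Continuous fun p : I × (I × (Fin q → I)) => (Fin.cons p.1 p.2.2 : Fin (q + 1) → I) :=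
    Continuous.finCons (by fun_prop) (by fun_prop)
  let b : I × (I × (Fin q → I)) → X := glue (fun p => p.2.1)
    (fun p => r.1 (Fin.cons p.1 p.2.2)) (fun p => r'.1 (Fin.cons p.1 p.2.2)) fun _ => x
  have b0 : ∀ t k, b (t, (0, k)) = r.1 (Fin.cons t k) := fun t k =>
    glue_of_zero (p := (t, ((0 : I), k))) rfl
  have b1 : ∀ t k, b (t, (1, k)) = r'.1 (Fin.cons t k) := fun t k =>
    glue_of_one (p := (t, ((1 : I), k))) rfl
  have bb : ∀ t s, ∀ k ∈ bd (Fin q → I), b (t, (s, k)) = x := fun t s k hk =>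
    glue_of_agree (p := (t, (s, k))) (fun _ => (RelLoop.cons_eq r (Or.inr hk)).symm)
      (fun _ => (RelLoop.cons_eq r' (Or.inr hk)).symm)
  obtain ⟨W, Θ, W1, Wb, W0, -⟩ := hf.exists_lift (K := I × (Fin q → I))
    ⟨fun p => κ (p.2.1, (p.1, p.2.2)), by fun_prop⟩ (fun k => κb _ _ (Or.inl rfl))
    (ContinuousMap.const _ (x : X)) (fun k => hx.trans (κb _ _ (Or.inr (Or.inl rfl))).symm) b
    (continuousOn_glue (C := {p : I × (I × (Fin q → I)) | p.2.2 ∈ bd (Fin q → I)}) (by fun_prop)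
      (isClosed_bd.preimage (by fun_prop)) (r.1.continuous.comp hcc).continuousOn
      (r'.1.continuous.comp hcc).continuousOn continuousOn_const
      (fun p hp _ => (RelLoop.cons_eq r (Or.inr hp)).symm)
      (fun p hp _ => (RelLoop.cons_eq r' (Or.inr hp)).symm))
    (by
      rintro ⟨s, k⟩ (rfl | rfl | hk)
      · rw [b0]; exact RelLoop.cons_eq r (Or.inl rfl)
      · rw [b1]; exact RelLoop.cons_eq r' (Or.inl rfl)
      · rw [bb _ _ k hk]; rfl)
    (by
      rintro t ⟨s, k⟩ (rfl | rfl | hk)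
      · rw [b0]; exact (κ0 t k).symm
      · rw [b1]; exact (κ1 t k).symm
      · rw [bb _ _ k hk]; exact hx.trans (κb s (t, k) (Or.inr (Or.inr hk))).symm)
  rw [piMk_eq_iff]
  refine ⟨⟨fun p => ⟨W (0, p), W0 p⟩, by fun_prop⟩, fun k => Subtype.ext ?_, fun k => Subtype.ext ?_,
    fun s k hk => Subtype.ext ?_⟩
  · exact (Wb 0 (0, k) (Or.inl rfl)).trans (b0 0 k)
  · exact (Wb 0 (1, k) (Or.inr (Or.inl rfl))).trans (b1 0 k)
  · exact (Wb 0 (s, k) (Or.inr (Or.inr hk))).trans (bb 0 s k hk)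

/-- The concatenation of a relative loop with a loop in the total space. -/
theorem RelLoop.exists_trans (r : RelLoop q (f ⁻¹' {y}) (x : X)) (b : Ω^ (Fin (q + 1)) X (x : X)) :
    ∃ R : RelLoop q (f ⁻¹' {y}) (x : X), RelLoop.face q _ x R = RelLoop.face q _ x r ∧
      piMk (genLoopMap (q + 1) f (x := (x : X)) x.2 b) * piMk (baseLoop x r) =
        piMk (baseLoop x R) := by
  obtain ⟨R, R0, R1⟩ := exists_concat (RelLoop.toProd r) (GenLoop.toProd b) (fun k =>
    (RelLoop.cons_eq r (Or.inl rfl)).trans (GenLoop.cons_eq b (Or.inl rfl)).symm)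
  have hR0 : ∀ k, R (0, k) = r.1 (Fin.cons 0 k) := fun k => by
    rw [← lowerHalf_zero, R0, lowerHalf_zero, RelLoop.toProd_apply]
  have hR1 : ∀ k, R (1, k) = x := fun k => by
    rw [← upperHalf_one, R1]; exact GenLoop.cons_eq b (Or.inr (Or.inl rfl))
  have hRb : ∀ s, ∀ k ∈ bd (Fin q → I), R (s, k) = x := by
    intro s k hk
    obtain ⟨t, rfl⟩ | ⟨t, rfl⟩ := exists_half s
    · rw [R0]; exact RelLoop.cons_eq r (Or.inr hk)
    · rw [R1]; exact GenLoop.cons_eq b (Or.inr (Or.inr hk))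
  have hRF : ∀ k, R (0, k) ∈ f ⁻¹' {y} := fun k => by
    rw [hR0]; exact r.2.1 _ rfl
  refine ⟨relLoopOfProd R hRF hR1 hRb, GenLoop.ext _ _ fun k => Subtype.ext ?_,
    piMk_mul_piMk_zero (fun s k => ?_) fun s k => ?_⟩
  · rw [RelLoop.face_apply, RelLoop.face_apply, relLoopOfProd_cons, hR0]
  · rw [baseLoop_apply, baseLoop_apply, relLoopOfProd_cons, R0]; rfl
  · rw [baseLoop_apply, relLoopOfProd_cons, R1]; rfl

/-- Concatenation in the second coordinate, which becomes the first coordinate of the faces. -/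
theorem RelLoop.exists_mul (r r' : RelLoop (q + 1) (f ⁻¹' {y}) (x : X)) :
    ∃ R : RelLoop (q + 1) (f ⁻¹' {y}) (x : X),
      piMk (RelLoop.face _ _ x r) * piMk (RelLoop.face _ _ x r') = piMk (RelLoop.face _ _ x R) ∧
      piMk (baseLoop x r) * piMk (baseLoop x r') = piMk (baseLoop x R) := by
  have hc : Continuous fun p : I × (I × (Fin q → I)) =>
      (Fin.cons p.2.1 (Fin.cons p.1 p.2.2 : Fin (q + 1) → I) : Fin (q + 2) → I) :=
    Continuous.finCons (by fun_prop) (Continuous.finCons (by fun_prop) (by fun_prop))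
  obtain ⟨R, R0, R1⟩ := exists_concat (r'.1.comp ⟨_, hc⟩) (r.1.comp ⟨_, hc⟩) (fun p =>
    (RelLoop.cons_eq r' (Or.inr ⟨0, Or.inr rfl⟩)).trans
      (RelLoop.cons_eq r (Or.inr ⟨0, Or.inl rfl⟩)).symm)
  have R0' : ∀ s t k, R (lowerHalf s, (t, k)) = r'.1 (Fin.cons t (Fin.cons s k)) :=
    fun s t k => R0 _ _
  have R1' : ∀ s t k, R (upperHalf s, (t, k)) = r.1 (Fin.cons t (Fin.cons s k)) :=
    fun s t k => R1 _ _
  let d : C(I × (Fin (q + 1) → I), X) :=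
    ⟨fun p => R (p.2 0, (p.1, Fin.tail p.2)), R.continuous.comp (by unfold Fin.tail; fun_prop)⟩
  have hd : ∀ t s k, d (t, Fin.cons s k) = R (s, (t, k)) := fun t s k => by simp [d]
  have hcase : ∀ P : (Fin (q + 1) → I) → Prop, (∀ s k, P (Fin.cons (lowerHalf s) k)) →
      (∀ s k, P (Fin.cons (upperHalf s) k)) → ∀ k, P k := by
    intro P h0 h1 k
    rw [← Fin.cons_self_tail k]
    obtain ⟨s, hs⟩ | ⟨s, hs⟩ := exists_half (k 0)
    · rw [hs]; exact h0 _ _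
    · rw [hs]; exact h1 _ _
  have hF : ∀ k, d (0, k) ∈ f ⁻¹' {y} := hcase _
    (fun s k => by rw [hd, R0']; exact r'.2.1 _ rfl) fun s k => by rw [hd, R1']; exact r.2.1 _ rfl
  have h1 : ∀ k, d (1, k) = x := hcase _
    (fun s k => by rw [hd, R0']; exact RelLoop.cons_eq r' (Or.inl rfl))
    fun s k => by rw [hd, R1']; exact RelLoop.cons_eq r (Or.inl rfl)
  have hb : ∀ t, ∀ k ∈ bd (Fin (q + 1) → I), d (t, k) = x := by
    intro t k hk
    have hk' : k 0 = 0 ∨ k 0 = 1 ∨ Fin.tail k ∈ bd (Fin q → I) := by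
      have := cubeCons_mem_boundary q ((cubeCons q).symm k)
      rw [Homeomorph.apply_symm_apply] at this
      exact this.1 hk
    have hkd : d (t, k) = R (k 0, (t, Fin.tail k)) := rfl
    rw [hkd]
    rcases hk' with h | h | h
    · rw [h, ← lowerHalf_zero, R0']
      exact RelLoop.cons_eq r' (Or.inr ⟨0, Or.inl rfl⟩)
    · rw [h, ← upperHalf_one, R1']
      exact RelLoop.cons_eq r (Or.inr ⟨0, Or.inr rfl⟩)
    · obtain ⟨s, hs⟩ | ⟨s, hs⟩ := exists_half (k 0)
      · rw [hs, R0']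
        exact RelLoop.cons_eq r' (Or.inr ((cubeCons_mem_boundary q (s, _)).2 (Or.inr (Or.inr h))))
      · rw [hs, R1']
        exact RelLoop.cons_eq r (Or.inr ((cubeCons_mem_boundary q (s, _)).2 (Or.inr (Or.inr h))))
  refine ⟨relLoopOfProd d hF h1 hb,
    piMk_mul_piMk_zero (fun s k => Subtype.ext ?_) fun s k => Subtype.ext ?_,
    piMk_mul_piMk_one (fun t s k => ?_) fun t s k => ?_⟩
  · rw [RelLoop.face_apply, RelLoop.face_apply, relLoopOfProd_cons, hd, R0']
  · rw [RelLoop.face_apply, RelLoop.face_apply, relLoopOfProd_cons, hd, R1']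
  · rw [baseLoop_apply, baseLoop_apply, relLoopOfProd_cons, hd, R0']
  · rw [baseLoop_apply, baseLoop_apply, relLoopOfProd_cons, hd, R1']

/-- The constant relative loop. -/
def RelLoop.const (q : ℕ) (x : f ⁻¹' {y}) : RelLoop q (f ⁻¹' {y}) (x : X) :=
  ⟨ContinuousMap.const _ (x : X), fun _ _ => x.2, fun _ _ => rfl⟩

theorem piMk_baseLoop_const : piMk (baseLoop x (RelLoop.const q x)) = piBase (q + 1) y :=
  congrArg piMk (GenLoop.ext _ _ fun _ => x.2)

theorem piMk_face_const : piMk (RelLoop.face q _ x (RelLoop.const q x)) = piBase q x := rfl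

/-- Relative loops with homotopic faces differ by a loop in the total space. -/
theorem RelLoop.exists_mul_of_face_eq {r r' : RelLoop q (f ⁻¹' {y}) (x : X)}
    (h : piMk (RelLoop.face q _ x r) = piMk (RelLoop.face q _ x r')) :
    ∃ b : Ω^ (Fin (q + 1)) X (x : X), piMk (genLoopMap (q + 1) f (x := (x : X)) x.2 b) *
      piMk (baseLoop x r) = piMk (baseLoop x r') := by
  have hx : f x = y := x.2
  obtain ⟨N, N0, N1, Nb⟩ := piMk_eq_iff.1 h
  -- The relative loops `r` and `r'` are joined along the homotopy of their faces; the top face of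
  -- `G` is the loop `b`.
  obtain ⟨G, g0, g1, g2, g3, -⟩ := exists_fill₂ (K := Fin q → I)
    (⟨fun p => (N p : X), by fun_prop⟩ : C(I × (Fin q → I), X)) (RelLoop.toProd r) (RelLoop.toProd r') (fun _ => (x : X))
    continuousOn_const Set.univ (fun k => (congrArg Subtype.val (N0 k)).symm)
    (fun k => (congrArg Subtype.val (N1 k)).symm)
    (fun t k hk => (congrArg Subtype.val (Nb t k hk)).symm)
    (fun t k hk => (RelLoop.cons_eq r (Or.inr hk)).symm)
    (fun t k hk => (RelLoop.cons_eq r' (Or.inr hk)).symm) (fun _ => trivial) (fun _ => trivial)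
    (fun _ => trivial) (fun _ _ _ _ => trivial)
  have g0' : ∀ p, f (G (0, p)) = y := fun p => by rw [g0]; exact (N p).2
  have g1' : ∀ t k, G (t, (0, k)) = r.1 (Fin.cons t k) := g1
  have g2' : ∀ t k, G (t, (1, k)) = r'.1 (Fin.cons t k) := g2
  have g11 : ∀ k, G (1, (1, k)) = x := fun k => by rw [g2']; exact RelLoop.cons_eq r' (Or.inl rfl)
  let b := loopOfProd (x := (x : X)) (G.comp ⟨fun p => (1, p), by fun_prop⟩) (by
    rintro ⟨s, k⟩ (rfl | rfl | hk)
    · exact (g1' 1 k).trans (RelLoop.cons_eq r (Or.inl rfl))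
    · exact g11 k
    · exact g3 1 s k hk)
  have hb : ∀ s k, b (Fin.cons s k) = G (1, (s, k)) := fun s k => loopOfProd_cons _ _ s k
  let P : ℝ → I := Set.projIcc 0 1 zero_le_one
  have hP : Continuous P := continuous_projIcc
  have hPl : ∀ a : ℝ, a ≤ 0 → P a = 0 := fun a ha => Set.projIcc_of_le_left _ ha
  have hPr : ∀ a : ℝ, 1 ≤ a → P a = 1 := fun a ha => Set.projIcc_of_right_le _ ha
  have hPs : ∀ s : I, P s = s := fun s => Set.projIcc_val _ s
  -- Two ways around the square from (0, 0) to (1, 1): at θ = 0 along `r` and then `b`, at θ = 1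
  -- through the fibre, constant in Y, and then along `r'`. All intermediate paths start in the edge
  -- lying in the fibre and end at (1, 1).
  let D : C(I × (I × (Fin q → I)), Y) := ⟨fun p => f (G (P (2 * (p.2.1 : ℝ) - p.1),
    (P (2 * (p.2.1 : ℝ) - 1 + p.1), p.2.2))), by fun_prop⟩
  have hD : ∀ θ s k, D (θ, (s, k)) = f (G (P (2 * (s : ℝ) - θ), (P (2 * (s : ℝ) - 1 + θ), k))) :=
    fun _ _ _ => rfl
  have hDb : ∀ θ, ∀ p ∈ bd (I × (Fin q → I)), D (θ, p) = y := by
    rintro θ ⟨s, k⟩ (rfl | rfl | hk)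
    · rw [hD, hPl _ (by have := θ.2.1; simpa using this), g0']
    · rw [hD, hPr (2 * ((1 : I) : ℝ) - θ) (by have := θ.2.2; push_cast; linarith),
        hPr (2 * ((1 : I) : ℝ) - 1 + θ) (by have := θ.2.1; push_cast; linarith), g11, hx]
    · rw [hD, g3 _ _ k hk, hx]
  have hlow : ∀ s : I, 2 * ((lowerHalf s : I) : ℝ) = s := fun s => by simp only [lowerHalf]; ring
  have hupp : ∀ s : I, 2 * ((upperHalf s : I) : ℝ) = 1 + s := fun s => by simp only [upperHalf]; ring
  let d : I → Ω^ (Fin (q + 1)) Y y := fun θ =>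
    loopOfProd (D.comp ⟨fun p => (θ, p), by fun_prop⟩) fun p hp => hDb θ p hp
  have hd : ∀ θ s k, d θ (Fin.cons s k) = D (θ, (s, k)) := fun θ s k => loopOfProd_cons _ _ s k
  have hd01 : piMk (d 0) = piMk (d 1) :=
    piMk_eq_iff_cons.2 ⟨D, fun t k => (hd 0 t k).symm, fun t k => (hd 1 t k).symm, hDb⟩
  have e0 : piMk (genLoopMap (q + 1) f (x := (x : X)) x.2 b) * piMk (baseLoop x r) = piMk (d 0) := by
    refine piMk_mul_piMk_zero (fun s k => ?_) fun s k => ?_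
    · have h1 : (s : ℝ) - 1 ≤ 0 := by have := s.2.2; linarith
      rw [hd, hD, hlow]
      simp only [Set.Icc.coe_zero, sub_zero, add_zero]
      rw [hPs, hPl _ h1, g1', baseLoop_apply]
    · have h1 : 1 ≤ 1 + (s : ℝ) := by have := s.2.1; linarith
      rw [hd, hD, hupp]
      simp only [Set.Icc.coe_zero, sub_zero, add_zero]
      rw [hPr _ h1, add_sub_cancel_left, hPs]
      exact congrArg f (hb s k).symm
  have e1 : piMk (baseLoop x r') * piMk GenLoop.const = piMk (d 1) := by
    refine piMk_mul_piMk_zero (fun s k => ?_) fun s k => ?_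
    · have h1 : (s : ℝ) - 1 ≤ 0 := by have := s.2.2; linarith
      rw [hd, hD, hlow]
      simp only [Set.Icc.coe_one]
      rw [hPl _ h1, g0']; rfl
    · have h1 : 1 ≤ 1 + (s : ℝ) := by have := s.2.1; linarith
      rw [hd, hD, hupp]
      simp only [Set.Icc.coe_one, add_sub_cancel_left, add_comm (s : ℝ) 1]
      rw [hPs, hPr _ h1, g2', baseLoop_apply]
  refine ⟨b, ?_⟩
  rw [e0, hd01, ← e1, ← piBase_eq, piBase_eq_one, mul_one]

/-- The long exact sequence of a map whose fibre is equivalent to the homotopy fibre. -/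
theorem FiberEquiv.exists_conn (hf : FiberEquiv f Set.univ y) (hsurj : Function.Surjective f)
    (x : f ⁻¹' {y}) : ∃ conn : ∀ q : ℕ, π_ (q + 1) Y y → π_ q (f ⁻¹' {y}) x,
      IsLongExact f y x conn ∧
        ∀ (q : ℕ) (r : RelPi q (f ⁻¹' {y}) (x : X)),
          conn q (relPiMap q f (f ⁻¹' {y}) x (fun _ ha => ha) r) =
            relBoundary q (f ⁻¹' {y}) x r := by
  have hx : f x = y := x.2
  -- The connecting map lifts a loop to a relative loop and takes its face; `hc` allows any other
  -- lift.
  choose R hR using fun (q : ℕ) (c : π_ (q + 1) Y y) => hf.exists_relLoop (x := x) c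
  let conn : ∀ q : ℕ, π_ (q + 1) Y y → π_ q (f ⁻¹' {y}) x :=
    fun q c => piMk (RelLoop.face q _ x (R q c))
  have hc : ∀ q (r : RelLoop q (f ⁻¹' {y}) (x : X)),
      conn q (piMk (baseLoop x r)) = piMk (RelLoop.face q _ x r) := fun q r => hf.face_eq (hR q _)
  have hmul : ∀ q (b : π_ (q + 1) X (x : X)) (c : π_ (q + 1) Y y),
      conn q (piMap (q + 1) f (x := (x : X)) hx b * c) = conn q c := by
    intro q b c
    obtain ⟨b, rfl⟩ := piMk_surjective b
    obtain ⟨r, rfl⟩ := hf.exists_relLoop (x := x) c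
    obtain ⟨r', h1, h2⟩ := RelLoop.exists_trans r b
    rw [piMap_piMk, h2, hc, hc, h1]
  have hex : ∀ q (c c' : π_ (q + 1) Y y), conn q c = conn q c' →
      ∃ b, c' = piMap (q + 1) f (x := (x : X)) hx b * c := by
    intro q c c' h
    obtain ⟨r, rfl⟩ := hf.exists_relLoop (x := x) c
    obtain ⟨r', rfl⟩ := hf.exists_relLoop (x := x) c'
    rw [hc, hc] at h
    obtain ⟨b, hb⟩ := RelLoop.exists_mul_of_face_eq h
    exact ⟨piMk b, hb.symm⟩
  have hbase : ∀ q, conn q 1 = piBase q x := fun q => by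
    rw [← piBase_eq_one, ← piMk_baseLoop_const (x := x), hc, piMk_face_const]
  refine ⟨conn, ⟨fun q a b => ?_, fun q a => ⟨fun h => ?_, ?_⟩, fun q b => ⟨fun h => ?_, ?_⟩,
    fun q c => ⟨fun h => ?_, ?_⟩, fun c c' => ⟨hex 0 c c', ?_⟩, fun a => ?_⟩, fun q r => ?_⟩
  · obtain ⟨r, rfl⟩ := hf.exists_relLoop (x := x) a
    obtain ⟨r', rfl⟩ := hf.exists_relLoop (x := x) b
    obtain ⟨r'', h1, h2⟩ := RelLoop.exists_mul r r'
    rw [h2, hc, hc, hc, h1]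
  · obtain ⟨p, rfl⟩ := piMk_surjective a
    obtain ⟨N, N0, N1, Nb⟩ := piMk_eq_iff.1 h
    refine ⟨piMk (baseLoop x (relLoopOfProd N (fun k => by rw [N0]; exact (p k).2) N1 Nb)), ?_⟩
    rw [hc]
    exact congrArg piMk (GenLoop.ext _ _ fun k => Subtype.ext
      ((relLoopOfProd_cons _ _ _ _ 0 k).trans (N0 k)))
  · rintro ⟨c, rfl⟩
    obtain ⟨r, rfl⟩ := hf.exists_relLoop (x := x) c
    rw [hc]
    exact piMk_eq_iff.2 ⟨RelLoop.toProd r, fun k => rfl,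
      fun k => RelLoop.cons_eq r (Or.inl rfl), fun s k hk => RelLoop.cons_eq r (Or.inr hk)⟩
  · obtain ⟨p, rfl⟩ := piMk_surjective b
    obtain ⟨κ, κ0, κ1, κb⟩ := piMk_eq_iff.1 h
    have hpb : ∀ k ∈ bd (Fin q → I), p k = x := p.2
    obtain ⟨W, Θ, W1, Wb, W0, -⟩ := hf.exists_lift
      (κ.comp ⟨fun p => (σ p.1, p.2), by fun_prop⟩)
      (fun k => by
        simp only [ContinuousMap.comp_apply, ContinuousMap.coe_mk, unitInterval.symm_zero]
        exact κ1 k) p.1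
      (fun k => by
        simp only [ContinuousMap.comp_apply, ContinuousMap.coe_mk, unitInterval.symm_one]
        exact (κ0 k).symm) (fun _ => (x : X)) continuousOn_const (fun k hk => (hpb k hk).symm)
      (fun s k hk => hx.trans (κb _ k hk).symm)
    refine ⟨piMk ⟨⟨fun k => ⟨W (0, k), W0 k⟩, by fun_prop⟩, fun k hk => Subtype.ext (Wb 0 k hk)⟩, ?_⟩
    exact piMk_eq_iff.2 ⟨W, fun k => rfl, W1, Wb⟩
  · rintro ⟨a, rfl⟩
    obtain ⟨p, rfl⟩ := piMk_surjective a
    exact congrArg piMk (GenLoop.ext _ _ fun k => (p k).2)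
  · obtain ⟨b, hb⟩ := hex q 1 c ((hbase q).trans h.symm)
    exact ⟨b, by rw [hb, mul_one]⟩
  · rintro ⟨b, rfl⟩
    have := hmul q b 1
    rw [mul_one] at this
    exact this.trans (hbase q)
  · rintro ⟨b, rfl⟩
    exact (hmul 0 b c).symm
  · obtain ⟨p, rfl⟩ := piMk_surjective a
    obtain ⟨x', hx'⟩ := hsurj (p 0)
    refine ⟨piMk ⟨ContinuousMap.const _ x', fun k ⟨i, _⟩ => i.elim0⟩, ?_⟩
    refine congrArg piMk (GenLoop.ext _ _ fun k => ?_)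
    rw [Subsingleton.elim k 0]
    exact hx'
  · obtain ⟨r, rfl⟩ := relMk_surjective r
    exact hc q r

theorem IsCQuasifibration.of_fiberEquiv {S : Set Y} (hsurj : Function.Surjective f)
    (hS : IsExhaustive S) (h : ∀ y ∈ S, FiberEquiv f Set.univ y) : IsCQuasifibration f S :=
  ⟨hsurj, hS, fun y hy x => (h y hy).exists_conn hsurj x⟩

end ExactOfFiberEquiv

/-! ### Filtrations -/

section Filtration
variable {X : Type u} {Y : Type v} [TopologicalSpace X] [TopologicalSpace Y]

theorem IsExhaustiveIn.exists_joinedIn {A S : Set Y} (h : IsExhaustiveIn A S) {y : Y} (hy : y ∈ A) :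
    ∃ z ∈ S, JoinedIn A y z := by
  obtain ⟨z, hz, hyz⟩ := h.2 ⟨y, hy⟩
  exact ⟨z, hz, (joinedIn_iff_joined hy z.2).2 hyz⟩

theorem isCDistinguished_iff_isGood {f : C(X, Y)} (hf : Function.Surjective f) {A S : Set Y} :
    IsCDistinguished f A S ↔ IsGood f A S := by
  have key : ∀ b : A, FiberEquiv (f.restrictPreimage A) Set.univ b ↔ FiberEquiv f A (b : Y) :=
    fun b => by
      rw [← fiberEquiv_restrictPreimage_iff f (subset_refl A) b, Subtype.coe_preimage_self]
  constructor
  · rintro ⟨hSA, h⟩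
    refine ⟨hSA, fun y hy => IsExhaustiveIn.exists_joinedIn ⟨hSA, h.exhaustive⟩ hy, fun b hb => ?_⟩
    exact (key ⟨b, hSA hb⟩).1 (h.fiberEquiv hb)
  · intro h
    refine ⟨h.subset, IsCQuasifibration.of_fiberEquiv (hf.restrictPreimage A) ?_ fun b hb =>
      (key b).2 (h.fiberEquiv b hb)⟩
    rintro ⟨y, hy⟩
    obtain ⟨z, hz, hyz⟩ := h.exhaustive y hy
    exact ⟨⟨z, h.subset hz⟩, hz, (joinedIn_iff_joined hy _).1 hyz⟩

/-- A deformation of `f⁻¹(U) → U` to `f⁻¹(A) → A` which is a weak equivalence on the relevant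
fibres carries the equivalence of fibres and homotopy fibres from `A` to `U`. -/
theorem IsGood.fiberEquiv_of_deformation {f : C(X, Y)} (hf : Function.Surjective f)
    {A U S : Set Y} (hA : IsGood f A S) (hAU : A ⊆ U)
    (D : Deformation (f.restrictPreimage U) (Subtype.val ⁻¹' A : Set U)) (y : U)
    (hy : ((D.h (y, 1) : U) : Y) ∈ S) (hw : IsWeakEquivalence (D.fiberMap y)) :
    FiberEquiv f U (y : Y) := by
  rw [← fiberEquiv_restrictPreimage_iff f (subset_refl U) y, Subtype.coe_preimage_self]
  refine D.fiberEquiv ?_ (D.we_fiber hw ?_)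
  · rw [fiberEquiv_restrictPreimage_iff f hAU]
    exact hA.fiberEquiv _ hy
  · obtain ⟨x, hx⟩ := hf.restrictPreimage U y
    exact ⟨x, hx⟩

theorem Deformation.joinedIn {f : C(X, Y)} {U A : Set Y}
    (D : Deformation (f.restrictPreimage U) (Subtype.val ⁻¹' A : Set U)) (y : U) :
    JoinedIn U (y : Y) (D.h (y, 1) : U) :=
  ⟨⟨⟨fun t => (D.h (y, t) : U), by fun_prop⟩, congrArg Subtype.val (D.h_zero y), rfl⟩,
    fun t => (D.h (y, t)).2⟩

/-- The inductive step along the filtration. -/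
theorem IsGood.step {f : C(X, Y)} (hf : Function.Surjective f) {A T S S' U O : Set Y}
    (hAT : A ⊆ T) (hAc : IsClosed A) (hA : IsGood f A S)
    (hST : S' ⊆ T) (hexh : ∀ O : Set Y, IsOpen O → IsExhaustiveIn (O ∩ T) (S' ∩ (O ∩ T)))
    (hdiff : ∀ O : Set Y, IsOpen O → IsGood f (O ∩ (T \ A)) (S' ∩ (O ∩ (T \ A))))
    (hUT : U ⊆ T) (hO : IsOpen O) (hAO : A ⊆ O) (hOU : O ∩ T ⊆ U)
    (D : Deformation (f.restrictPreimage U) (Subtype.val ⁻¹' A : Set U))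
    (hD : ∀ y : U, (y : Y) ∈ S' →
      ((D.h (y, 1) : U) : Y) ∈ S ∧ IsWeakEquivalence (D.fiberMap y)) : IsGood f T S' := by
  have hAU : A ⊆ U := fun y hy => hOU ⟨hAO hy, hAT hy⟩
  have hU : IsGood f U (S' ∩ U) := by
    refine ⟨Set.inter_subset_right, fun y hy => ?_, fun b hb => ?_⟩
    -- `U` need not be open in `T`, so the point is first moved into `A` by the deformation and then
    -- joined to `S'` within the open part `O ∩ T`.
    · have h1 := D.h_one_mem ⟨y, hy⟩
      obtain ⟨z, hz, hyz⟩ := (hexh O hO).exists_joinedIn ⟨hAO h1, hAT h1⟩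
      exact ⟨z, ⟨hz.1, hOU hz.2⟩, (D.joinedIn ⟨y, hy⟩).trans (hyz.mono hOU)⟩
    · obtain ⟨h1, h2⟩ := hD ⟨b, hb.2⟩ hb.1
      exact hA.fiberEquiv_of_deformation hf hAU D ⟨b, hb.2⟩ h1 h2
  have hV : IsGood f (T \ A) (S' ∩ (T \ A)) := by
    have := hdiff Set.univ isOpen_univ
    rwa [Set.univ_inter] at this
  have hWV : IsGood f ((O ∩ T) ∩ (T \ A)) (S' ∩ ((O ∩ T) ∩ (T \ A))) := by
    have := hdiff O hO
    rwa [show O ∩ (T \ A) = (O ∩ T) ∩ (T \ A) by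
      ext y; simp only [Set.mem_inter_iff, Set.mem_sdiff]; tauto] at this
  refine ⟨hST, fun y hy => ?_, fun b hb => ?_⟩
  · have := hexh Set.univ isOpen_univ
    rw [Set.univ_inter] at this
    obtain ⟨z, hz, hyz⟩ := this.exists_joinedIn hy
    exact ⟨z, hz.1, hyz⟩
  -- The cover consists of `O ∩ T` and `T \ A`; the good set around `O ∩ T` is `U`.
  · refine FiberEquiv.of_cover hV hU hWV hOU (fun y hy => ?_) hUT Set.sdiff_subset hO
      hAc.isOpen_compl subset_rfl Set.inter_subset_left (fun y hy => ⟨hy.2, hy.1⟩)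
      (fun y hy => hy.2) hb
    by_cases h : y ∈ A
    · exact Or.inl ⟨hAO h, hy⟩
    · exact Or.inr ⟨hy, h⟩

/-- A compact subset of the colimit of a sequence of `T_1` subspaces lies in one of them. -/
theorem IsSpaceFiltration.exists_subset_of_isCompact {F : ℕ+ → Set Y} (hF : IsSpaceFiltration F)
    (hT1 : ∀ i, T1Space (F i)) {C : Set Y} (hC : IsCompact C) :
    ∃ i, C ⊆ F i := by
  by_contra! h
  choose x hxC hxF using fun i => Set.not_subset.1 (h i)
  -- As x n lies outside F n, only the x n with n < i can lie in F i. Hence every subset of the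
  -- range is closed, and the range is a closed discrete subset of a compact set, so finite, and
  -- inside a single F j. That contradicts the choice of x j.
  have hfin : ∀ i, (Set.range x ∩ F i).Finite := by
    intro i
    refine ((Set.finite_Iio i).image x).subset ?_
    rintro _ ⟨⟨n, rfl⟩, hn⟩
    refine ⟨n, lt_of_not_ge fun hin => hxF n (hF.mono hin hn), rfl⟩
  have hcl : ∀ D ⊆ Set.range x, IsClosed D := by
    intro D hD
    refine hF.coherent.isClosed_iff.2 ?_
    rintro _ ⟨i, rfl⟩
    have := hT1 i
    have hDF : (D ∩ F i).Finite := (hfin i).subset fun y hy => ⟨hD hy.1, hy.2⟩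
    exact ((hDF.preimage Subtype.val_injective.injOn).subset
      fun y hy => ⟨hy, y.2⟩ : (Subtype.val ⁻¹' D : Set (F i)).Finite).isClosed
  have hdisc : DiscreteTopology (Set.range x) := by
    refine discreteTopology_iff_forall_isClosed.2 fun D => ?_
    rw [← Set.preimage_image_eq D Subtype.val_injective]
    exact (hcl _ (by rintro _ ⟨z, -, rfl⟩; exact z.2)).preimage continuous_subtype_val
  have hcomp : IsCompact (Set.range x) :=
    hC.of_isClosed_subset (hcl _ subset_rfl) (by rintro _ ⟨n, rfl⟩; exact hxC n)
  have hrange : (Set.range x).Finite := hcomp.finite ⟨hdisc⟩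
  have hex : ∀ y, ∃ i, y ∈ F i := fun y => Set.mem_iUnion.1 (hF.iUnion_eq ▸ Set.mem_univ y)
  choose n hn using hex
  obtain ⟨j, hj⟩ := (hrange.image n).bddAbove
  exact hxF j (hF.mono (hj ⟨x j, ⟨j, rfl⟩, rfl⟩) (hn (x j)))

theorem FiberEquiv.of_filtration {f : C(X, Y)} {F E : ℕ+ → Set Y} (hF : IsSpaceFiltration F)
    (hT1 : ∀ i, T1Space (F i)) (hE : Monotone E)
    (h : ∀ i, IsGood f (F i) (E i)) {b : Y} (hb : b ∈ ⋃ i, E i) : FiberEquiv f Set.univ b := by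
  obtain ⟨j, hj⟩ := Set.mem_iUnion.1 hb
  intro n u v hu huF hvF huv
  obtain ⟨i, hi⟩ := hF.exists_subset_of_isCompact hT1
    (isCompact_range (pathOf v).continuous)
  obtain ⟨w, hwF, hw, κ, h0, h1, hκb, hκF⟩ :=
    -- The index must be large enough both for the compact family of paths and for b to be one of
    -- the distinguished points.
    (h (max i j)).fiberEquiv b (hE (le_max_right i j) hj) n u v hu huF
      (fun k => ⟨⟨(hvF k).1.1, fun s => hF.mono (le_max_left i j) (hi ⟨(s, k), rfl⟩)⟩, (hvF k).2⟩)
      huv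
  exact ⟨w, hwF, hw, κ, h0, h1, hκb, fun p => hoFiber_mono (Set.subset_univ _) _ (hκF p)⟩

end Filtration

end

theorem mainTheorem1 {X : Type u} {Y : Type v} [TopologicalSpace X] [TopologicalSpace Y]
    (f : C(X, Y)) (hf : Function.Surjective f)
    -- the filtration by closed `T_1` subspaces `F i` and the subsets `E i` of `F i`
    (F E : ℕ+ → Set Y) (hF : IsSpaceFiltration F)
    (hclosed : ∀ i, IsClosed (F i)) (hT1 : ∀ i, T1Space (F i))
    (hEF : ∀ i, E i ⊆ F i) (hE : Monotone E)
    -- `E i` meets each open subset `O ∩ F i` of `F i` in an exhaustive subset of it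
    (hexh : ∀ i, ∀ O : Set Y, IsOpen O → IsExhaustiveIn (O ∩ F i) (E i ∩ (O ∩ F i)))
    (hbase : IsCDistinguished f (F 1) (E 1))
    (hdiff : ∀ i, ∀ O : Set Y, IsOpen O →
      IsCDistinguished f (O ∩ (F (i + 1) \ F i)) (E (i + 1) ∩ (O ∩ (F (i + 1) \ F i))))
    -- `U` is a neighbourhood of `F i` in `F (i + 1)` which deforms to `F i`
    (hdef : ∀ i, ∃ U : Set Y, U ⊆ F (i + 1) ∧
      (∃ O : Set Y, IsOpen O ∧ F i ⊆ O ∧ O ∩ F (i + 1) ⊆ U) ∧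
      ∃ D : Deformation (f.restrictPreimage U) (Subtype.val ⁻¹' F i : Set U),
        ∀ y : U, (y : Y) ∈ E (i + 1) →
          ((D.h (y, 1) : U) : Y) ∈ E i ∧ IsWeakEquivalence (D.fiberMap y)) :
    (∀ i, IsCDistinguished f (F i) (E i)) ∧ IsCQuasifibration f (⋃ i, E i) := by
  have hgood : ∀ i, IsGood f (F i) (E i) := by
    intro i
    induction i using PNat.recOn with
    | one => exact (isCDistinguished_iff_isGood hf).1 hbase
    | succ i ih =>
      obtain ⟨U, hUF, ⟨O, hO, hFO, hOU⟩, D, hD⟩ := hdef i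
      exact IsGood.step hf (hF.mono (PNat.lt_add_right i 1).le) (hclosed i) ih (hEF _) (hexh _)
        (fun O hO => (isCDistinguished_iff_isGood hf).1 (hdiff i O hO)) hUF hO hFO hOU D hD
  refine ⟨fun i => (isCDistinguished_iff_isGood hf).2 (hgood i),
    IsCQuasifibration.of_fiberEquiv hf (fun y => ?_)
      fun b hb => FiberEquiv.of_filtration hF hT1 hE hgood hb⟩
  obtain ⟨i, hi⟩ := Set.mem_iUnion.1 (hF.iUnion_eq ▸ Set.mem_univ y)
  obtain ⟨z, hz, hyz⟩ := (hgood i).exhaustive y hi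
  exact ⟨z, Set.mem_iUnion.2 ⟨i, hz⟩, hyz.joined⟩
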